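/- **Setting.** Let $n\ge 1$, $\lambda_0\in\mathbb C$ with $\operatorname{Im}\lambda_0\neq 0$, $0\ne\lambda^{[1]}\in\mathbb C$, and for $1\le k\le n$ $$a_k=\tfrac{2\operatorname{Im}\lambda_0}{n+1}\csc\tfrac{k\pi}{n+1},\quad b_k=\tfrac{2\operatorname{Im}\lambda_0}{n+1}\cot\tfrac{k\pi}{n+1}-2\operatorname{Re}\lambda_0,\quad \chi_0=2\operatorname{Re}\lambda_0+\tfrac{2\mathrm i\operatorname{Im}\lambda_0}{n+1},$$ $\|a\|^2=\sum_k a_k^2$, $q_k^{[0]}(x,t)=a_k\exp\big(\mathrm i(b_kx+(\|a\|^2-\tfrac{b_k^2}{2})t)\big)$. Let $\lambda(\varepsilon)=\lambda_0+\lambda^{[1]}\varepsilon^{n+1}$ and let $\chi(\varepsilon)=\chi_0+\sum_{i\ge1}\chi^{[i]}\varepsilon^i$ be a formal power series with $\big(\chi-2\lambda-\sum_i\frac{a_i^2}{\chi+b_i}\big)\prod_j(\chi+b_j)=0$. Define $\alpha_j,\beta_j,h_{1,j},h_{2,j}^{[k]}$ by $$\mathrm i(\chi-\lambda)=\sum_{j\ge0}\alpha_j\varepsilon^j,\quad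 \tfrac{\chi^2}{2}-\lambda^2-\|a\|^2=\sum_{j\ge0}\beta_j\varepsilon^j,\quad \ln\Big(\tfrac{\chi_0-\chi_0^*}{\chi^{[1]}\varepsilon}\tfrac{\chi-\chi_0}{\chi-\chi_0^*}\Big)=\sum_{j\ge1}h_{1,j}\varepsilon^j,\quad \ln\tfrac{\chi+b_k}{\chi_0+b_k}=\sum_{j\ge1}h^{[k]}_{2,j}\varepsilon^j,$$ put $C_1=|\chi^{[1]}|^2/|\chi_0-\chi_0^*|^2$, and let $S_j$ be the Schur polynomials, $\sum_j S_j(\mathbf z)\varepsilon^j=\exp(\sum_{j\ge1}z_j\varepsilon^j)$. For $\mathcal N=[N_1,\dots,N_n]$ with $N_l\in\mathbb Z_{\ge0}$, and parameters $d_{l,j}\in\mathbb C$, the $\mathcal N$-order vector rogue wave is $q_k^{\mathcal N}=q_k^{[0]}\det M^{[k]}/\det M^{[0]}$, where $M^{[s]}$ ($0\le s\le n$) is the block matrix whose $(l_1,l_2)$ block has the entries $\tau^{[s;l_1,l_2]}_{(n+1)(i-1)+l_1,(n+1)(j-1)+l_2}$, $1\le i\le N_{l_1}$, $1\le j\le N_{l_2}$,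 $$\tau^{[s;l_1,l_2]}_{i,j}=\sum_{v=0}^{\min(i,j)}C_1^v\,S_{i-v}\big(\mathbf x^{[l_1,-]}+v\mathbf h_1^*+(\mathbf h_2^{[s]})^*\big)\,S_{j-v}\big(\mathbf x^{[l_2,+]}+v\mathbf h_1-\mathbf h_2^{[s]}\big),\qquad \mathbf h_2^{[0]}=0,$$ $x_j^{[l,+]}=\alpha_jx+\mathrm i\beta_jt+d_{l,j}$, $x_j^{[l,-]}=(x_j^{[l,+]})^*$. Write $\hat q_k^{\mathcal N}=q_k^{\mathcal N}/q_k^{[0]}$. The normalized first-order rogue wave centred at the origin is $$\hat q^{[1]}_k(x,t)=1+\frac{2\mathrm i}{|\chi_0+b_k|^2}\,\frac{(\operatorname{Re}\chi_0+b_k)(x+\operatorname{Re}\chi_0\,t)-(\operatorname{Im}\chi_0)^2t+\frac{\mathrm i}{2}}{(x+\operatorname{Re}\chi_0\,t)^2+(\operatorname{Im}\chi_0)^2t^2+\frac1{4(\operatorname{Im}\chi_0)^2}}.$$ For $\kappa_{l,i}\in\mathbb C$ let $\sum_j\varphi_{l,j}(z)\varepsilon^j=\exp\big(z\varepsilon+\sum_{i\ge1,(n+1)\nmid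 i}\kappa_{l,i}\varepsilon^i\big)$, $\varphi_{l,j}=0$ for $j<0$. With $N=\sum_lN_l$, let $W_{\mathcal N}$ be $c_{\mathcal N}$ times the Wronskian of the $N$ polynomials $\varphi_{l,(n+1)(i-1)+l}$ ($1\le l\le n$, $1\le i\le N_l$, ordered block by block), with the constant $c_{\mathcal N}$ making it monic. If $\varphi_{l_j,m_j}$ $(1\le j\le N)$ are these polynomials, then $W^{[2]}_{\mathcal N}=c_{\mathcal N}\big[\det(\varphi_{l_j,m_j-\bar p_i})+\det(\varphi_{l_j,m_j-\hat p_i})\big]$, where $\bar p_i=\hat p_i=i-1$ except $\bar p_{N-1}=N$ and $\hat p_N=N+1$. Put $$\Gamma=\Gamma(\mathcal N)=\sum_{l}\tfrac{N_l}{2}\big(n(N_l-1)+2l\big)-\sum_{l<k}N_lN_k .$$ **Theorem.** Assume $N_1\ge\dots\ge N_n\ge0$, $N_1\geq 1$; $z_0\in\mathbb C\setminus\{0\}$; $\kappa_{1,1}=\dots=\kappa_{n,1}$; and $\kappa_{l,i}=z_0^i/i$ for $i>1$, $(n+1)\nmid i$. Let $\hat{\mathcal N}$ be obtained from $\mathcal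 N$ by lowering by one the last of the entries equal to $N_1$, and let $\Gamma_0=\Gamma(\hat{\mathcal N})$. Assume that all roots of $W_{\mathcal N}$ other than $z_0-\kappa_{1,1}$ are simple. For $A>0$ let the real point $(x_0,t_0)$ be given by $\mathrm i\chi^{[1]}(x_0+\chi_0t_0)=(z_0-\kappa_{1,1})A$, put $\hat\kappa_j=-(\alpha_jx_0+\mathrm i\beta_jt_0)$, and let $\mathbf q^{\mathcal N}$ have the parameters $d_{l,1}=\kappa_{1,1}A$, $d_{l,j}=\kappa_{l,j}A^j+\hat\kappa_j$ for $j>1$, $(n+1)\nmid j$, and $d_{l,j}=0$ for $(n+1)\mid j$. For a root $\bar z\neq z_0-\kappa_{1,1}$ of $W_{\mathcal N}$ let the real points $(\hat x,\hat t)$ and $(\bar x,\bar t)=(\bar x_{\bar z},\bar t_{\bar z})$ be given by $$\mathrm i\chi^{[1]}(\hat x+\chi_0\hat t)=\bar z,\qquad \mathrm i\chi^{[1]}(\bar x+\chi_0\bar t)=\bar zA-\Big(\alpha_2\hat x+\mathrm i\beta_2\hat t+\hat\kappa_2A^{-1}\Big)\frac{W^{[2]}_{\mathcal N}(\bar z)}{W'_{\mathcal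 N}(\bar z)}.$$ Then $z_0-\kappa_{1,1}$ has multiplicity $\Gamma_0$ as a root of $W_{\mathcal N}$ (it is not a root if $\Gamma_0=0$), $W_{\mathcal N}$ has exactly $\Gamma-\Gamma_0$ other roots $\bar z$, and there is a constant $c>0$, independent of $A$, such that the following holds for $1\le k\le n$ as $A\to\infty$. 1. (Simple-root region.) For all large $A$ the $\Gamma-\Gamma_0$ points $(\bar x_{\bar z},\bar t_{\bar z})$ have mutual distances, and distances to $(x_0,t_0)$, larger than $cA$. Uniformly for $\sqrt{(x-x_0)^2+(t-t_0)^2}>cA$, $$q_k^{\mathcal N}(x,t)-\Big(1+\sum_{\bar z}\big[\hat q_k^{[1]}(x-\bar x_{\bar z},t-\bar t_{\bar z})-1\big]\Big)q_k^{[0]}(x,t)\to0 ,$$ and for every $\bar z$ and $R>0$, uniformly for $\sqrt{(x-\bar x)^2+(t-\bar t)^2}\le R$, $\;q^{\mathcal N}_k(x,t)=\hat q_k^{[1]}(x-\bar x,t-\bar t)\,q_k^{[0]}(x,t)+O(A^{-1})$. 2. (Multiple-root region.) Let $\hat q_k^{\hat{\mathcal N}}$ be the normalized $\hat{\mathcal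 N}$-order rogue wave with the internal parameters $d_{l,j}=h_{1,j}$. Uniformly for $\sqrt{(x-x_0)^2+(t-t_0)^2}\le cA$, $$q_k^{\mathcal N}(x,t)-\hat q_k^{\hat{\mathcal N}}(x-x_0,t-t_0)\,q_k^{[0]}(x,t)\to0,$$ and for every $R>0$, uniformly for $\sqrt{(x-x_0)^2+(t-t_0)^2}\le R$, this difference is $O(A^{-1})$. 3. For every $\epsilon>0$ there are $R,A_0>0$ such that $|q_k^{\mathcal N}(x,t)-q_k^{[0]}(x,t)|\le\epsilon$ whenever $A\ge A_0$ and $(x,t)$ has distance at least $R$ from $(x_0,t_0)$ and from all $(\bar x_{\bar z},\bar t_{\bar z})$. -/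

import Mathlib

noncomputable section

namespace RogueWave

/-! ### Schur polynomials -/

/-- The formal power series `exp (∑_{j ≥ 1} z_j ε^j)`; the value `z 0` is not used. -/
def expSeries {R : Type*} [CommRing R] [Algebra ℚ R] (z : ℕ → R) : PowerSeries R :=
  (PowerSeries.exp R).subst (PowerSeries.mk fun j => if j = 0 then 0 else z j)

/-- The Schur polynomial `S_j(z_1, z_2, …)`. -/
def schur {R : Type*} [CommRing R] [Algebra ℚ R] (z : ℕ → R) (j : ℕ) : R :=
  PowerSeries.coeff j (expSeries z)

/-! ### The plane-wave background

Components are indexed by `k : Fin n`; the component `k` here is the one with number `k + 1`. -/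

/-- The angle `k π / (n + 1)`, for the component with number `k`. -/
def angle (n : ℕ) (k : Fin n) : ℝ := ((k : ℝ) + 1) * Real.pi / ((n : ℝ) + 1)

/-- The amplitudes `a_k = 2 Im λ₀ / (n+1) * csc (k π / (n+1))`. -/
def amp (n : ℕ) (lam0 : ℂ) (k : Fin n) : ℝ :=
  2 * lam0.im / ((n : ℝ) + 1) * (1 / Real.sin (angle n k))

/-- The wave numbers `b_k = 2 Im λ₀ / (n+1) * cot (k π / (n+1)) - 2 Re λ₀`. -/
def waveNum (n : ℕ) (lam0 : ℂ) (k : Fin n) : ℝ :=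
  2 * lam0.im / ((n : ℝ) + 1) * (Real.cos (angle n k) / Real.sin (angle n k)) - 2 * lam0.re

/-- `‖a‖₂²`. -/
def ampSq (n : ℕ) (lam0 : ℂ) : ℝ := ∑ k : Fin n, amp n lam0 k ^ 2

/-- The plane wave `q_k^{[0]}(x,t) = a_k exp (i (b_k x + (-b_k²/2 + ‖a‖²) t))`. -/
def planeWave (n : ℕ) (lam0 : ℂ) (k : Fin n) (x t : ℝ) : ℂ :=
  (amp n lam0 k : ℂ) *
    Complex.exp (Complex.I *
      ((waveNum n lam0 k * x + (-(waveNum n lam0 k) ^ 2 / 2 + ampSq n lam0) * t : ℝ) : ℂ))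

/-- The multiple root `χ₀ = 2 Re λ₀ + i 2 Im λ₀ / (n+1)`. -/
def chi0 (n : ℕ) (lam0 : ℂ) : ℂ :=
  ((2 * lam0.re : ℝ) : ℂ) + Complex.I * ((2 * lam0.im / ((n : ℝ) + 1) : ℝ) : ℂ)

/-- The perturbed eigenvalue `λ(ε) = λ₀ + λ₁ ε^(n+1)`. -/
def lamSeries (n : ℕ) (lam0 lam1 : ℂ) : PowerSeries ℂ :=
  PowerSeries.C lam0 + PowerSeries.C lam1 * PowerSeries.X ^ (n + 1)

/-- The characteristic equation
`(χ - 2λ - ∑_i a_i² / (χ + b_i)) ∏_j (χ + b_j) = 0`, with the product multiplied out so that no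
denominators occur, for formal power series `χ(ε)` and `λ(ε)`. -/
def CharEq (n : ℕ) (lam0 : ℂ) (chi lam : PowerSeries ℂ) : Prop :=
  (chi - 2 * lam) * ∏ j : Fin n, (chi + PowerSeries.C (waveNum n lam0 j : ℂ))
    - ∑ i : Fin n, PowerSeries.C ((amp n lam0 i : ℂ) ^ 2) *
        ∏ j ∈ Finset.univ.erase i, (chi + PowerSeries.C (waveNum n lam0 j : ℂ)) = 0

/-- The spectral data: an eigenvalue `λ₀` off the real axis, a nonzero `λ₁`, and a formal power
series `χ(ε) = χ₀ + ∑_{i ≥ 1} χ^{[i]} ε^i` which together with `λ(ε) = λ₀ + λ₁ ε^(n+1)` satisfies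
the characteristic equation. -/
structure SpectralData (n : ℕ) where
  lam0 : ℂ
  lam1 : ℂ
  chi : PowerSeries ℂ
  lam0_im_ne : lam0.im ≠ 0
  lam1_ne : lam1 ≠ 0
  chi_zero : PowerSeries.coeff 0 chi = chi0 n lam0
  charEq : CharEq n lam0 chi (lamSeries n lam0 lam1)

namespace SpectralData

variable {n : ℕ} (D : SpectralData n)

/-- `χ₀`. -/
def c0 : ℂ := chi0 n D.lam0

/-- `χ^{[1]}`. -/
def c1 : ℂ := PowerSeries.coeff 1 D.chi

/-- The plane wave `q_k^{[0]}`. -/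
def plane (k : Fin n) (x t : ℝ) : ℂ := planeWave n D.lam0 k x t

/-- `i (χ(ε) - λ(ε)) = ∑ α_j ε^j`. -/
def alpha (j : ℕ) : ℂ :=
  PowerSeries.coeff j (PowerSeries.C Complex.I * (D.chi - lamSeries n D.lam0 D.lam1))

/-- `χ(ε)²/2 - λ(ε)² - ‖a‖² = ∑ β_j ε^j`. -/
def beta (j : ℕ) : ℂ :=
  PowerSeries.coeff j (PowerSeries.C (1 / 2 : ℂ) * D.chi ^ 2
    - lamSeries n D.lam0 D.lam1 ^ 2 - PowerSeries.C (ampSq n D.lam0 : ℂ))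

/-- `∑ h_{1,j} ε^j = ln ((χ₀ - χ₀*) / (χ^{[1]} ε) * (χ(ε) - χ₀) / (χ(ε) - χ₀*))`; the quotient
`(χ(ε) - χ₀) / ε` is the series `∑ χ^{[i+1]} ε^i`. -/
def h1 (j : ℕ) : ℂ :=
  PowerSeries.coeff j (PowerSeries.logOf
    (PowerSeries.C ((D.c0 - star D.c0) / D.c1) *
      (PowerSeries.mk fun i => PowerSeries.coeff (i + 1) D.chi) *
      (D.chi - PowerSeries.C (star D.c0))⁻¹))

/-- `∑ h_{2,j}^{[k]} ε^j = ln ((χ(ε) + b_k) / (χ₀ + b_k))`. -/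
def h2 (k : Fin n) (j : ℕ) : ℂ :=
  PowerSeries.coeff j (PowerSeries.logOf
    (PowerSeries.C (D.c0 + (waveNum n D.lam0 k : ℂ))⁻¹ *
      (D.chi + PowerSeries.C (waveNum n D.lam0 k : ℂ))))

/-- `C₁ = |χ^{[1]}|² / |χ₀ - χ₀*|²`. -/
def C1 : ℝ := ‖D.c1‖ ^ 2 / ‖D.c0 - star D.c0‖ ^ 2

/-- `x_j^{[l,+]} = α_j x + β_j i t + d_{l,j}`. -/
def xPlus (d : Fin n → ℕ → ℂ) (x t : ℝ) (l : Fin n) (j : ℕ) : ℂ :=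
  D.alpha j * x + D.beta j * Complex.I * t + d l j

/-- `x_j^{[l,-]} = (x_j^{[l,+]})*`. -/
def xMinus (d : Fin n → ℕ → ℂ) (x t : ℝ) (l : Fin n) (j : ℕ) : ℂ :=
  star (D.xPlus d x t l j)

end SpectralData

/-! ### Index conventions

The order of a solution is a vector `N : Fin n → ℕ`; the entry `N l` is `N_{l+1}`. The rows and the
columns of the `N × N` block matrices are indexed by the pairs `⟨l, i⟩` with `i < N l`. -/

/-- The rows (or columns) of the block matrices. -/
abbrev BlockIdx {n : ℕ} (N : Fin n → ℕ) : Type := (l : Fin n) × Fin (N l)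

/-- The number `(n+1)(i-1) + l` that belongs to the `i`-th row of the `l`-th block
(both counted from `1`). -/
def degIdx {n : ℕ} {N : Fin n → ℕ} (p : BlockIdx N) : ℕ :=
  (n + 1) * (p.2 : ℕ) + ((p.1 : ℕ) + 1)

/-- The position, counted from `0`, of a pair in the ordering block by block. -/
def posIdx {n : ℕ} {N : Fin n → ℕ} (p : BlockIdx N) : ℕ := (finSigmaFinEquiv p : ℕ)

/-! ### The vector rogue wave solutions -/

namespace SpectralData

variable {n : ℕ} (D : SpectralData n)

/-- The entry `τ_{i,j}^{[s;l₁,l₂]}`. The sequence `g` is `0` for `s = 0` and `h_2^{[k]}` for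
`s = k ≥ 1`. -/
def tau (d : Fin n → ℕ → ℂ) (g : ℕ → ℂ) (x t : ℝ) (l₁ l₂ : Fin n) (i j : ℕ) : ℂ :=
  ∑ v ∈ Finset.range (min i j + 1), (D.C1 : ℂ) ^ v *
    schur (fun m => D.xMinus d x t l₁ m + (v : ℂ) * star (D.h1 m) + star (g m)) (i - v) *
    schur (fun m => D.xPlus d x t l₂ m + (v : ℂ) * D.h1 m - g m) (j - v)

/-- The block matrix `M^{[s]}`. -/
def rwMatrix (N : Fin n → ℕ) (d : Fin n → ℕ → ℂ) (g : ℕ → ℂ) (x t : ℝ) :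
    Matrix (BlockIdx N) (BlockIdx N) ℂ :=
  Matrix.of fun p r => D.tau d g x t p.1 r.1 (degIdx p) (degIdx r)

/-- The `k`-th component `q_k^N(x,t) = q_k^{[0]}(x,t) det M^{[k]} / det M^{[0]}` of the `N`-order
vector rogue wave with internal parameters `d`. -/
def wave (N : Fin n → ℕ) (d : Fin n → ℕ → ℂ) (k : Fin n) (x t : ℝ) : ℂ :=
  D.plane k x t *
    ((D.rwMatrix N d (D.h2 k) x t).det / (D.rwMatrix N d 0 x t).det)

/-- The normalized wave `q_k^N(x,t) / q_k^{[0]}(x,t)`. -/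
def waveHat (N : Fin n → ℕ) (d : Fin n → ℕ → ℂ) (k : Fin n) (x t : ℝ) : ℂ :=
  D.wave N d k x t * (D.plane k x t)⁻¹

/-- The normalized first-order rogue wave centred at the origin. -/
def firstHat (k : Fin n) (x t : ℝ) : ℂ :=
  let b : ℝ := waveNum n D.lam0 k
  let X : ℝ := x + D.c0.re * t
  1 + 2 * Complex.I / ((‖D.c0 + (b : ℂ)‖ ^ 2 : ℝ) : ℂ) *
    ((((D.c0.re + b) * X - D.c0.im ^ 2 * t : ℝ) : ℂ) + Complex.I / 2) /
    ((X ^ 2 + D.c0.im ^ 2 * t ^ 2 + 1 / (4 * D.c0.im ^ 2) : ℝ) : ℂ)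

/-- The point `(x,t)` of the plane with `i χ^{[1]} (x + χ₀ t) = w`. -/
def point (w : ℂ) : ℝ × ℝ :=
  ((w / (Complex.I * D.c1)).re - D.c0.re * ((w / (Complex.I * D.c1)).im / D.c0.im),
    (w / (Complex.I * D.c1)).im / D.c0.im)

theorem c0_re_im : D.c0.re = 2 * D.lam0.re ∧ D.c0.im = 2 * D.lam0.im / ((n : ℝ) + 1) := by
  unfold c0 chi0
  constructor
  · rw [Complex.add_re, Complex.re_mul_ofReal]
    simp
  · rw [Complex.add_im, Complex.im_mul_ofReal]
    simp

theorem c0_im_ne : D.c0.im ≠ 0 := by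
  rw [D.c0_re_im.2]
  exact div_ne_zero (mul_ne_zero two_ne_zero D.lam0_im_ne) (by positivity)

/-- `point w` is the only solution of its defining equation. -/
theorem point_iff (h : D.c1 ≠ 0) (w : ℂ) (x t : ℝ) :
    Complex.I * D.c1 * ((x : ℂ) + D.c0 * t) = w ↔ (x, t) = D.point w := by
  have hi := D.c0_im_ne
  have hI : Complex.I * D.c1 ≠ 0 := mul_ne_zero Complex.I_ne_zero h
  rw [mul_comm, ← eq_div_iff hI, Complex.ext_iff, point, Prod.mk.injEq]
  generalize w / (Complex.I * D.c1) = u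
  simp only [Complex.add_re, Complex.add_im, Complex.mul_re, Complex.mul_im, Complex.ofReal_re,
    Complex.ofReal_im, mul_zero, sub_zero, zero_add]
  constructor
  · rintro ⟨h₁, h₂⟩
    have ht : t = u.im / D.c0.im := by
      field_simp
      linarith
    rw [← ht]
    exact ⟨by linarith, rfl⟩
  · rintro ⟨h₁, h₂⟩
    subst h₂
    refine ⟨by rw [h₁]; ring, ?_⟩
    field_simp

end SpectralData

/-- Euclidean distance in the `(x,t)`-plane. -/
def planeDist (x t : ℝ) (p : ℝ × ℝ) : ℝ := Real.sqrt ((x - p.1) ^ 2 + (t - p.2) ^ 2)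

/-! ### Generalized mixed Adler--Moser polynomials -/

section GMAM

open Polynomial

variable {n : ℕ}

/-- `∑_j φ_{l,j}(z) ε^j = exp (z ε + ∑_{i ≥ 1, (n+1) ∤ i} κ_{l,i} ε^i)`. -/
def phi (kap : Fin n → ℕ → ℂ) (l : Fin n) (j : ℕ) : ℂ[X] :=
  schur (fun i => (if i = 1 then (X : ℂ[X]) else 0) +
    (if (n + 1) ∣ i then 0 else C (kap l i))) j

/-- `φ_{l, j - p}`, which is `0` for `p > j`. -/
def phiSub (kap : Fin n → ℕ → ℂ) (l : Fin n) (j p : ℕ) : ℂ[X] :=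
  if p ≤ j then phi kap l (j - p) else 0

/-- The Wronskian determinant of the polynomials `φ_{l,(n+1)(i-1)+l}`, `1 ≤ i ≤ N_l`,
`1 ≤ l ≤ n`, ordered block by block. -/
def gmamWronskian (N : Fin n → ℕ) (kap : Fin n → ℕ → ℂ) : ℂ[X] :=
  (Matrix.of fun p r : BlockIdx N => derivative^[posIdx p] (phi kap r.1 (degIdx r))).det

/-- The constant `c_N` which makes the polynomial monic. -/
def gmamConst (N : Fin n → ℕ) (kap : Fin n → ℕ → ℂ) : ℂ :=
  (gmamWronskian N kap).leadingCoeff⁻¹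

/-- The monic generalized mixed Adler--Moser polynomial `W_N`. -/
def gmam (N : Fin n → ℕ) (kap : Fin n → ℕ → ℂ) : ℂ[X] :=
  C (gmamConst N kap) * gmamWronskian N kap

/-- The polynomial `W_N^{[2]}`: the sum of the two determinants obtained by replacing the row
`(φ_{l_j, · - (N-2)})_j`, respectively the row `(φ_{l_j, · - (N-1)})_j`, of the determinant defining
`W_N` by the row whose indices are lowered by `2` more. -/
def gmamTwo (N : Fin n → ℕ) (kap : Fin n → ℕ → ℂ) : ℂ[X] :=
  let T : ℕ := ∑ l, N l
  let pbar : ℕ → ℕ := fun i => if i + 1 = T - 1 then T else i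
  let phat : ℕ → ℕ := fun i => if i + 1 = T then T + 1 else i
  C (gmamConst N kap) *
    ((Matrix.of fun p r : BlockIdx N => phiSub kap r.1 (degIdx r) (pbar (posIdx p))).det +
     (Matrix.of fun p r : BlockIdx N => phiSub kap r.1 (degIdx r) (phat (posIdx p))).det)

/-- `Γ = ∑_l N_l / 2 (n (N_l - 1) + 2 l) - ∑_{l < k} N_l N_k`. -/
def gammaDeg (N : Fin n → ℕ) : ℚ :=
  ∑ l : Fin n, (N l : ℚ) / 2 * ((n : ℚ) * ((N l : ℚ) - 1) + 2 * ((l : ℚ) + 1))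
    - ∑ l : Fin n, ∑ k ∈ Finset.Ioi l, (N l : ℚ) * (N k : ℚ)

/-- For `N_1 ≥ ⋯ ≥ N_n` with `N_1 ≥ 1`: the vector `N̂` obtained from `N` by lowering by one the last
of the entries that are equal to `N_1`. -/
def lowerVec (N : Fin n → ℕ) (l : Fin n) : ℕ :=
  if (∀ m, m ≤ l → N m = N l) ∧ (∀ m, l < m → N m < N l) then N l - 1 else N l

/-- The roots of `W_N` other than `w`. -/
def otherRoots (N : Fin n → ℕ) (kap : Fin n → ℕ → ℂ) (w : ℂ) : Finset ℂ :=
  (gmam N kap).roots.toFinset.erase w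

end GMAM

/-! ### Large internal parameters and predicted positions -/

namespace SpectralData

variable {n : ℕ} (D : SpectralData n)

/-- The position `(x_0, t_0)`, defined by `w = i χ^{[1]} (x_0 + χ₀ t_0) A⁻¹`, for the multiple root
`w`. -/
def multCenter (w : ℂ) (A : ℝ) : ℝ × ℝ := D.point (w * A)

/-- `κ̂_j = -(α_j x_0 + i β_j t_0)`. -/
def kapHat (w : ℂ) (A : ℝ) (j : ℕ) : ℂ :=
  -(D.alpha j * (D.multCenter w A).1 + Complex.I * D.beta j * (D.multCenter w A).2)

/-- The large internal parameters: `d_{l,1} = κ_{l,1} A`, `d_{l,j} = κ_{l,j} A^j + κ̂_j` for `j > 1`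
not divisible by `n + 1`, and `d_{l,j} = 0` if `n + 1` divides `j`. -/
def largeParam (kap : Fin n → ℕ → ℂ) (w : ℂ) (A : ℝ) (l : Fin n) (j : ℕ) : ℂ :=
  if (n + 1) ∣ j then 0
  else if j = 1 then kap l 1 * A
  else kap l j * (A : ℂ) ^ j + D.kapHat w A j

/-- The corrected shift
`Δ(z̄) + κ̂_2 A⁻¹ W^{[2]}(z̄) / W'(z̄)`, where `Δ(z̄) = (α_2 x̂ + β_2 i t̂) W^{[2]}(z̄) / W'(z̄)` and
`(x̂, t̂)` is the point with `i χ^{[1]} (x̂ + χ₀ t̂) = z̄`. -/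
def shift (N : Fin n → ℕ) (kap : Fin n → ℕ → ℂ) (w : ℂ) (A : ℝ) (z : ℂ) : ℂ :=
  (D.alpha 2 * (D.point z).1 + D.beta 2 * Complex.I * (D.point z).2) *
      ((gmamTwo N kap).eval z / (gmam N kap).derivative.eval z) +
    D.kapHat w A 2 * (A : ℂ)⁻¹ *
      ((gmamTwo N kap).eval z / (gmam N kap).derivative.eval z)

/-- The position `(x̄_0, t̄_0)` that belongs to the simple root `z̄`: the point with
`i χ^{[1]} (x̄_0 + χ₀ t̄_0) = z̄ A - shift`. -/
def simpleCenter (N : Fin n → ℕ) (kap : Fin n → ℕ → ℂ) (w : ℂ) (A : ℝ) (z : ℂ) : ℝ × ℝ :=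
  D.point (z * A - D.shift N kap w A z)

end SpectralData

end RogueWave

end

open RogueWave

/-! Every entry of the matrix $M^{[s]}$ is a sum over $v$ of products, so Cauchy–Binet turns its
determinant into a sum over strictly increasing row sequences $f$ of $C_1^{\sum f}$ times a
conjugated minor times a minor. For $s=0$ both minors coincide: the denominator is a sum of
nonnegative terms, nothing cancels, and it suffices to find the dominant minors.

Relative to $(x_0,t_0)$ the large parameters contribute the exponents $(z_0A)^j/j$, that is, a
factor $1/(1-z_0A\varepsilon)$. Exponents with $(n+1)\mid j$ only cause unimodular column operations
inside a block and may be changed at will. Hence all blocks share one generating function and only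
the sorted list $J$ of degrees matters (`det_rwMatrix_largeParam`). Likewise $W_{\mathcal N}(z)$ is
a constant times `colDet` at $y=z-w$ (`exists_eval_gmam`).

A factor $1/(1-a\varepsilon)$ allows each column to be reduced by a multiple of its predecessor.
Column $r$ then involves only the degrees from $\mathrm{lo}_r$ to $J_r$, with
$\mathrm{lo}=(0,J_0+1,\dots,J_{m-1}+1)$. The lowest and the highest power of $y$ give the
multiplicity $\Gamma_0$ and the degree $\Gamma$ (`root_structure`, `gammaDeg_eq`).

The asymptotics come from three scalings. Near $(x_0,t_0)$ only the degrees $\mathrm{lo}_r$ survive.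
The column of degree $0$ splits off a row and a column, and the rest is the matrix of the order
$\hat{\mathcal N}$ with $v+1$ in place of $v$, which accounts for the parameters $d_{l,j}=h_{1,j}$
(`rateOn_near_mult`). Near a simple root, with $\delta=1/A$, the minor with rows $0,\dots,m$
vanishes to first order in $\delta$ with a derivative linear in the displacement, the minor with
rows $0,\dots,m-1,m+1$ has the same order, and all others are smaller. The two terms give the
first-order wave; the contribution of $\varepsilon^2$ is absorbed by the shift with $W^{[2]}$
(`rateOn_near_simple`). This needs $h_{1,1}=0$, which follows from the factorization of the
characteristic polynomial (`h1_one`). At distance $\rho$ from $(x_0,t_0)$ and far from all other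
roots, the minor with rows $0,\dots,m$ is essentially a product of distances to the roots and
dominates the rest (`waveSum_ratio_far`). The regions are glued together in `simple_region` and
`multiple_region`. -/

noncomputable section

namespace RogueWave

open Finset

/-! ### Schur polynomials: recursion, sums and scaling of the arguments. -/

section SchurAlgebra

variable {R : Type*} [CommRing R] [Algebra ℚ R]

theorem natCast_succ_mul_cancel {k : ℕ} {a b : R} (h : ((k + 1 : ℕ) : R) * a = ((k + 1 : ℕ) : R) * b) :
    a = b := by
  have hk : algebraMap ℚ R (((k + 1 : ℕ) : ℚ)⁻¹) * ((k + 1 : ℕ) : R) = 1 := by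
    rw [← map_natCast (algebraMap ℚ R), ← map_mul, inv_mul_cancel₀ (by positivity), map_one]
  calc a = algebraMap ℚ R (((k + 1 : ℕ) : ℚ)⁻¹) * (((k + 1 : ℕ) : R) * a) := by
        rw [← mul_assoc, hk, one_mul]
    _ = b := by rw [h, ← mul_assoc, hk, one_mul]

/-- The series `∑_{j ≥ 1} z_j ε^j`. -/
def tailSeries (z : ℕ → R) : PowerSeries R := PowerSeries.mk fun j => if j = 0 then 0 else z j

theorem hasSubst_tailSeries {S : Type*} [CommRing S] (z : ℕ → S) : PowerSeries.HasSubst (tailSeries z) :=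
  PowerSeries.HasSubst.of_constantCoeff_zero' (by
    rw [← PowerSeries.coeff_zero_eq_constantCoeff_apply]; simp [tailSeries])

theorem derivative_expSeries (z : ℕ → R) :
    PowerSeries.derivative R (expSeries z) =
      PowerSeries.derivative R (tailSeries z) * expSeries z := by
  rw [expSeries, ← tailSeries, PowerSeries.derivative_subst (hasSubst_tailSeries z),
    PowerSeries.derivative_exp, mul_comm]

theorem schur_zero (z : ℕ → R) : schur z 0 = 1 := by
  have h0 : (PowerSeries.exp R - 1).constantCoeff = 0 := by simp
  have h1 : (tailSeries z).constantCoeff = 0 := by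
    rw [← PowerSeries.coeff_zero_eq_constantCoeff_apply]; simp [tailSeries]
  have h2 := PowerSeries.constantCoeff_subst_eq_zero (S := R) h1 _ h0
  rw [PowerSeries.subst_sub (hasSubst_tailSeries z), map_sub, sub_eq_zero] at h2
  rw [schur, expSeries, ← tailSeries, PowerSeries.coeff_zero_eq_constantCoeff_apply]
  refine Eq.trans h2 ?_
  rw [← PowerSeries.coe_substAlgHom (hasSubst_tailSeries z), map_one, map_one]

theorem natCast_mul_coeff_succ {S : Type*} [CommRing S] (f : PowerSeries S) (z : ℕ → S)
    (h : PowerSeries.derivative S f = PowerSeries.derivative S (tailSeries z) * f) (k : ℕ) :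
    ((k + 1 : ℕ) : S) * PowerSeries.coeff (k + 1) f =
      ∑ i ∈ range (k + 1), ((i + 1 : ℕ) : S) * z (i + 1) * PowerSeries.coeff (k - i) f := by
  have := congrArg (PowerSeries.coeff k) h
  rw [PowerSeries.coeff_derivative, PowerSeries.coeff_mul,
    Nat.sum_antidiagonal_eq_sum_range_succ_mk] at this
  rw [mul_comm]
  push_cast
  rw [this]
  refine sum_congr rfl fun i _ => ?_
  simp [PowerSeries.coeff_derivative, tailSeries]
  ring

theorem schur_succ (z : ℕ → R) (k : ℕ) :
    ((k + 1 : ℕ) : R) * schur z (k + 1) =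
      ∑ i ∈ range (k + 1), ((i + 1 : ℕ) : R) * z (i + 1) * schur z (k - i) :=
  natCast_mul_coeff_succ _ z (derivative_expSeries z) k

/-- The equation $F'=Z'F$, $F(0)=1$ has a single power series solution over a $\mathbb Q$-algebra.
The effect of maps, scalings and sums of the arguments is obtained by checking this recursion. -/
theorem eq_schur (z s : ℕ → R) (h0 : s 0 = 1)
    (h : ∀ k, ((k + 1 : ℕ) : R) * s (k + 1) =
      ∑ i ∈ range (k + 1), ((i + 1 : ℕ) : R) * z (i + 1) * s (k - i)) (k : ℕ) :
    s k = schur z k := by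
  induction k using Nat.strong_induction_on with
  | _ k ih =>
    cases k with
    | zero => rw [h0, schur_zero]
    | succ k =>
      refine natCast_succ_mul_cancel (k := k) ?_
      rw [h, schur_succ]
      exact sum_congr rfl fun i _ => by rw [ih (k - i) (by omega)]

theorem schur_congr {z z' : ℕ → R} (h : ∀ j, j ≠ 0 → z j = z' j) (k : ℕ) :
    schur z k = schur z' k := by
  refine eq_schur z' (schur z) (schur_zero z) (fun k => ?_) k
  rw [schur_succ]
  exact sum_congr rfl fun i _ => by rw [h (i + 1) (by omega)]

theorem map_schur {S : Type*} [CommRing S] [Algebra ℚ S] (f : R →+* S) (z : ℕ → R) (k : ℕ) :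
    f (schur z k) = schur (fun j => f (z j)) k := by
  refine eq_schur _ (fun k => f (schur z k)) (by simp [schur_zero]) (fun k => ?_) k
  have := congrArg f (schur_succ z k)
  simpa [map_sum] using this

theorem schur_scale (c : R) (z : ℕ → R) (k : ℕ) :
    schur (fun j => c ^ j * z j) k = c ^ k * schur z k := by
  symm
  refine eq_schur _ (fun k => c ^ k * schur z k) (by simp [schur_zero]) (fun k => ?_) k
  calc _ = c ^ (k + 1) * (((k + 1 : ℕ) : R) * schur z (k + 1)) := by ring
    _ = _ := by
      rw [schur_succ, mul_sum]
      refine sum_congr rfl fun i hi => ?_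
      have : k + 1 = (i + 1) + (k - i) := by have := mem_range.1 hi; omega
      rw [this, pow_add]
      ring

theorem schur_add (u y : ℕ → R) (k : ℕ) :
    schur (fun j => u j + y j) k = ∑ i ∈ range (k + 1), schur u i * schur y (k - i) := by
  have hD : PowerSeries.derivative R (expSeries u * expSeries y) =
      PowerSeries.derivative R (tailSeries fun j => u j + y j) * (expSeries u * expSeries y) := by
    have ht : (tailSeries fun j => u j + y j) = tailSeries u + tailSeries y := by
      ext j
      by_cases hj : j = 0 <;> simp [tailSeries, hj]
    rw [Derivation.leibniz, derivative_expSeries, derivative_expSeries, ht, map_add]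
    simp only [smul_eq_mul]
    ring
  have := eq_schur (fun j => u j + y j) (fun k => PowerSeries.coeff k (expSeries u * expSeries y))
    (by
      have h0 := schur_zero u
      have h1 := schur_zero y
      simp only [schur] at h0 h1
      simp [PowerSeries.coeff_mul, h0, h1]) (natCast_mul_coeff_succ _ _ hD) k
  rw [← this, PowerSeries.coeff_mul, Nat.sum_antidiagonal_eq_sum_range_succ_mk]
  rfl

theorem schur_const_zero (k : ℕ) : schur (fun _ => (0 : R)) k = if k = 0 then 1 else 0 := by
  symm
  refine eq_schur _ (fun k => if k = 0 then (1 : R) else 0) (by simp) (fun k => by simp) k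

/-- The exponential of a series in $\varepsilon^m$ is again a series in $\varepsilon^m$: in each
term of the recursion one of the two indices is not divisible by $m$. -/
theorem schur_support (m : ℕ) (y : ℕ → R) (hy : ∀ j, ¬ m ∣ j → y j = 0) (k : ℕ)
    (hk : ¬ m ∣ k) : schur y k = 0 := by
  induction k using Nat.strong_induction_on with
  | _ k ih =>
    cases k with
    | zero => simp at hk
    | succ k =>
      refine natCast_succ_mul_cancel (k := k) ?_
      rw [schur_succ, mul_zero]
      refine sum_eq_zero fun i hi => ?_
      have hi := mem_range.1 hi
      by_cases h : m ∣ i + 1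
      · rw [ih (k - i) (by omega), mul_zero]
        intro h'
        exact hk (by simpa [show i + 1 + (k - i) = k + 1 by omega] using dvd_add h h')
      · rw [hy _ h, mul_zero, zero_mul]

/-- The coefficients of the series `ε^v exp (∑_{j ≥ 1} z_j ε^j)`. -/
def schurShift (z : ℕ → R) (v j : ℕ) : R := if v ≤ j then schur z (j - v) else 0

theorem schurShift_add (u y : ℕ → R) (v j : ℕ) :
    schurShift (fun m => u m + y m) v j =
      ∑ k ∈ range (j + 1), schurShift u v k * schur y (j - k) := by
  unfold schurShift
  split_ifs with h
  · rw [schur_add]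
    obtain ⟨d, rfl⟩ := Nat.exists_eq_add_of_le h
    rw [show v + d + 1 = v + (d + 1) by ring, sum_range_add _ v (d + 1)]
    rw [sum_eq_zero (s := range v), zero_add]
    · simp only [Nat.le_add_right, if_true, Nat.add_sub_cancel_left]
      exact sum_congr rfl fun i _ => by rw [show v + d - (v + i) = d - i by omega]
    · intro i hi
      rw [if_neg (by have := mem_range.1 hi; omega), zero_mul]
  · symm
    refine sum_eq_zero fun k hk => ?_
    rw [if_neg (by have := mem_range.1 hk; omega), zero_mul]

theorem map_schurShift {S : Type*} [CommRing S] [Algebra ℚ S] (f : R →+* S) (z : ℕ → R)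
    (v k : ℕ) : f (schurShift z v k) = schurShift (fun j => f (z j)) v k := by
  unfold schurShift
  split_ifs
  · exact map_schur f z _
  · simp

theorem schurShift_self (z : ℕ → R) (v : ℕ) : schurShift z v v = 1 := by
  simp [schurShift, schur_zero]

theorem schurShift_of_lt (z : ℕ → R) {v k : ℕ} (h : k < v) : schurShift z v k = 0 := by
  simp [schurShift, h]

end SchurAlgebra

/-! ### Special values, smoothness and derivatives of Schur polynomials. -/

/-- $\exp(-\log(1-a\varepsilon))=1/(1-a\varepsilon)$. This is the effect of the special parameters
$\kappa_{l,i}=z_0^i/i$. -/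
theorem schur_geometric (a : ℂ) (k : ℕ) : schur (fun j => a ^ j / (j : ℂ)) k = a ^ k := by
  symm
  refine eq_schur _ (fun k => a ^ k) (by simp) (fun k => ?_) k
  rw [sum_congr rfl (g := fun _ => a ^ (k + 1))]
  · simp
  · intro i hi
    have := mem_range.1 hi
    rw [mul_div_cancel₀ _ (Nat.cast_ne_zero.2 (Nat.succ_ne_zero i)), ← pow_add]
    congr 1
    omega

theorem schur_single (y : ℂ) (k : ℕ) :
    schur (fun j => if j = 1 then y else 0) k = y ^ k / (k.factorial : ℂ) := by
  symm
  refine eq_schur _ (fun k => y ^ k / (k.factorial : ℂ)) (by simp) (fun k => ?_) k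
  rw [sum_eq_single 0]
  · rw [Nat.factorial_succ]
    push_cast
    have : ((k : ℂ) + 1) ≠ 0 := Nat.cast_add_one_ne_zero k
    have : (k.factorial : ℂ) ≠ 0 := Nat.cast_ne_zero.2 k.factorial_ne_zero
    simp
    field_simp
    ring
  · intro i _ hi
    simp [hi]
  · simp

theorem schurShift_add_geometric (u : ℕ → ℂ) (a : ℂ) (v j : ℕ) :
    schurShift (fun m => u m + a ^ m / (m : ℂ)) v j =
      ∑ k ∈ range (j + 1), a ^ (j - k) * schurShift u v k := by
  rw [schurShift_add]
  exact sum_congr rfl fun k _ => by rw [schur_geometric, mul_comm]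

theorem contDiff_schur {E : Type*} [NormedAddCommGroup E] [NormedSpace ℝ E] {m : WithTop ℕ∞}
    {z : E → ℕ → ℂ} (hz : ∀ j, ContDiff ℝ m fun p => z p j) (k : ℕ) :
    ContDiff ℝ m fun p => schur (z p) k := by
  induction k using Nat.strong_induction_on with
  | _ k ih =>
    cases k with
    | zero => simpa [schur_zero] using contDiff_const
    | succ k =>
      have : (fun p => schur (z p) (k + 1)) = fun p => ((k + 1 : ℕ) : ℂ)⁻¹ *
          ∑ i ∈ range (k + 1), ((i + 1 : ℕ) : ℂ) * z p (i + 1) * schur (z p) (k - i) := by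
        ext p
        rw [← schur_succ, inv_mul_cancel_left₀ (Nat.cast_ne_zero.2 (Nat.succ_ne_zero k))]
      rw [this]
      refine contDiff_const.mul (ContDiff.sum fun i _ => ?_)
      exact (contDiff_const.mul (hz _)).mul (ih (k - i) (by omega))

theorem contDiff_schurShift {E : Type*} [NormedAddCommGroup E] [NormedSpace ℝ E]
    {m : WithTop ℕ∞} {z : E → ℕ → ℂ} (hz : ∀ j, ContDiff ℝ m fun p => z p j) (v k : ℕ) :
    ContDiff ℝ m fun p => schurShift (z p) v k := by
  unfold schurShift
  split_ifs
  · exact contDiff_schur hz _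
  · exact contDiff_const

theorem hasDerivAt_schur_of_zero {y : ℝ → ℕ → ℂ} {y' : ℕ → ℂ} {t : ℝ}
    (h : ∀ j, HasDerivAt (fun s => y s j) (y' j) t) (h0 : ∀ j, y t j = 0) (k : ℕ) :
    HasDerivAt (fun s => schur (y s) k) (if k = 0 then 0 else y' k) t := by
  induction k using Nat.strong_induction_on with
  | _ k ih =>
    cases k with
    | zero => simpa [schur_zero] using hasDerivAt_const t (1 : ℂ)
    | succ k =>
      have : (fun s => schur (y s) (k + 1)) = fun s => ((k + 1 : ℕ) : ℂ)⁻¹ *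
          ∑ i ∈ range (k + 1), ((i + 1 : ℕ) : ℂ) * (y s (i + 1) * schur (y s) (k - i)) := by
        ext p
        simp only [← mul_assoc]
        rw [← schur_succ, inv_mul_cancel_left₀ (Nat.cast_ne_zero.2 (Nat.succ_ne_zero k))]
      rw [this]
      have hd := (HasDerivAt.fun_sum (u := range (k + 1)) fun i _ =>
        ((h (i + 1)).mul (ih (k - i) (by omega))).const_mul ((i + 1 : ℕ) : ℂ)).const_mul
          (((k + 1 : ℕ) : ℂ)⁻¹)
      refine hd.congr_deriv ?_
      symm
      rw [sum_eq_single k]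
      · simp only [h0, zero_mul, add_zero, Nat.sub_self, schur_zero, mul_one]
        rw [inv_mul_cancel_left₀ (Nat.cast_ne_zero.2 (Nat.succ_ne_zero k))]
        simp
      · intro i hi hik
        have hi := mem_range.1 hi
        have hy : y t = fun _ => 0 := funext h0
        rw [hy, schur_const_zero, if_neg (by omega)]
        simp
      · simp

/-- Differentiation multiplies the generating function by $s_1\varepsilon+s_2\varepsilon^2$, which
raises the shift $v$ by one or by two. -/
theorem hasDerivAt_schurShift {z : ℝ → ℕ → ℂ} {s₁ s₂ : ℂ} {t : ℝ}
    (h : ∀ j, HasDerivAt (fun s => z s j) (if j = 1 then s₁ else if j = 2 then s₂ else 0) t)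
    (v j : ℕ) :
    HasDerivAt (fun s => schurShift (z s) v j)
      (s₁ * schurShift (z t) (v + 1) j + s₂ * schurShift (z t) (v + 2) j) t := by
  by_cases hv : v ≤ j
  · obtain ⟨d, rfl⟩ := Nat.exists_eq_add_of_le hv
    -- Splitting off the value at $t$ leaves a factor whose arguments vanish at $t$; there only the
    -- linear term of the exponential is differentiated.
    have hf : (fun s => schurShift (z s) v (v + d)) = fun s =>
        ∑ i ∈ range (d + 1), schur (fun m => z s m - z t m) i * schur (z t) (d - i) := by
      ext s
      simp only [schurShift, hv, if_true, Nat.add_sub_cancel_left]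
      rw [← schur_add]
      congr 1
      ext m
      ring
    rw [hf]
    have hd := HasDerivAt.fun_sum (u := range (d + 1)) fun i _ =>
      (hasDerivAt_schur_of_zero (y := fun s m => z s m - z t m)
        (fun j => (h j).sub_const (z t j)) (by simp) i).mul_const (schur (z t) (d - i))
    refine hd.congr_deriv ?_
    symm
    rcases d with _ | _ | d
    · simp [schurShift]
    · simp [schurShift, sum_range_succ]
    · rw [sum_range_succ', sum_range_succ', sum_range_succ', sum_eq_zero]
      · simp [schurShift, show v + 1 ≤ v + (d + 1 + 1) by omega,
          show v + (d + 1 + 1) - (v + 1) = d + 1 by omega,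
          show v + (d + 1 + 1) - (v + 2) = d by omega]
        ring
      · intro i _
        simp
  · have h1 : ¬ v + 1 ≤ j := by omega
    have h2 : ¬ v + 2 ≤ j := by omega
    simpa [schurShift, hv, h1, h2] using hasDerivAt_const t (0 : ℂ)

/-! ### Derivatives and values of the polynomials $\varphi_{l,j}$. -/

section Phi

open Polynomial

variable {n : ℕ} (kap : Fin n → ℕ → ℂ) (l : Fin n)

theorem derivative_phi_succ (j : ℕ) : derivative (phi kap l (j + 1)) = phi kap l j := by
  induction j using Nat.strong_induction_on with
  | _ j ih =>
    refine natCast_succ_mul_cancel (k := j) ?_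
    unfold phi at ih ⊢
    set z : ℕ → ℂ[X] := fun i => (if i = 1 then (X : ℂ[X]) else 0) +
      (if (n + 1) ∣ i then 0 else C (kap l i)) with hz
    have hz' : ∀ i, derivative (z i) = if i = 1 then 1 else 0 := by
      intro i
      rw [hz]
      by_cases h1 : i = 1 <;> by_cases h2 : n + 1 ∣ i <;> simp [h1, h2]
      all_goals (split_ifs <;> simp)
    have h := congrArg derivative (schur_succ z j)
    rw [derivative_natCast_mul, derivative_sum] at h
    rw [h]
    -- The derivative of the exponent survives only for $i=0$ and gives $S_j$; the remaining terms
    -- form the recursion one step lower and sum to $jS_j$.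
    have h1 : ∀ i ∈ range (j + 1), derivative (((i + 1 : ℕ) : ℂ[X]) * z (i + 1) * schur z (j - i)) =
        (if i = 0 then schur z j else 0) +
        (if i < j then ((i + 1 : ℕ) : ℂ[X]) * z (i + 1) * schur z (j - 1 - i) else 0) := by
      intro i hi
      have hi := mem_range.1 hi
      rw [derivative_mul, derivative_natCast_mul, hz']
      congr 1
      · by_cases h0 : i = 0 <;> simp [h0]
      · split_ifs with hij
        · obtain ⟨d, hd⟩ : ∃ d, j - i = d + 1 := ⟨j - i - 1, by omega⟩
          rw [hd, ih d (by omega), show j - 1 - i = d by omega]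
        · rw [show j - i = 0 by omega, schur_zero]
          simp
    rw [sum_congr rfl h1, sum_add_distrib]
    have h2 : ∑ i ∈ range (j + 1),
        (if i < j then ((i + 1 : ℕ) : ℂ[X]) * z (i + 1) * schur z (j - 1 - i) else 0) =
        (j : ℂ[X]) * schur z j := by
      rw [sum_range_succ, if_neg (lt_irrefl j), add_zero,
        sum_congr rfl fun i hi => if_pos (mem_range.1 hi)]
      cases j with
      | zero => simp
      | succ j => rw [schur_succ]; rfl
    rw [h2]
    simp
    ring

theorem iterate_derivative_phi (p j : ℕ) :
    derivative^[p] (phi kap l j) = phiSub kap l j p := by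
  induction p with
  | zero => simp [phiSub]
  | succ p ih =>
    rw [Function.iterate_succ_apply', ih]
    unfold phiSub
    by_cases h : p + 1 ≤ j
    · rw [if_pos h, if_pos (by omega)]
      obtain ⟨d, hd⟩ : ∃ d, j - p = d + 1 := ⟨j - p - 1, by omega⟩
      rw [hd, derivative_phi_succ, show j - (p + 1) = d by omega]
    · rw [if_neg h]
      split_ifs with h'
      · rw [show j - p = 0 by omega, phi, schur_zero]
        simp
      · simp

theorem eval_phiSub (p j : ℕ) (y : ℂ) : (phiSub kap l j p).eval y =
    schurShift (fun i => (if i = 1 then y else 0) + if (n + 1) ∣ i then 0 else kap l i) p j := by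
  have h := map_schurShift (Polynomial.evalRingHom y) (fun i => (if i = 1 then (X : ℂ[X]) else 0) +
    (if (n + 1) ∣ i then 0 else C (kap l i))) p j
  rw [Polynomial.coe_evalRingHom] at h
  have h2 : phiSub kap l j p = schurShift (fun i => (if i = 1 then (X : ℂ[X]) else 0) +
    (if (n + 1) ∣ i then 0 else C (kap l i))) p j := rfl
  rw [h2, h]
  congr 1
  ext i
  split_ifs <;> simp

end Phi

/-! ### The Cauchy–Binet formula. -/

section CauchyBinet

/-- The strictly increasing sequences of length `T` of natural numbers below `L`. -/
def strictMonoFns (T L : ℕ) : Finset (Fin T → ℕ) :=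
  (Fintype.piFinset fun _ => range L).filter fun f => StrictMono f

theorem mem_strictMonoFns {T L : ℕ} {f : Fin T → ℕ} :
    f ∈ strictMonoFns T L ↔ (∀ i, f i < L) ∧ StrictMono f := by
  simp [strictMonoFns]

variable {R : Type*} [CommRing R]

theorem det_sum_eq_sum_piFinset {T : ℕ} (L : ℕ) (w : ℕ → R) (P Q : ℕ → Fin T → R) :
    (Matrix.of fun p r => ∑ v ∈ range L, w v * P v p * Q v r).det =
      ∑ f ∈ Fintype.piFinset fun _ : Fin T => range L,
        (∏ i, w (f i) * P (f i) i) * (Matrix.of fun i r => Q (f i) r).det := by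
  have h := (Matrix.detRowAlternating (R := R) (n := Fin T)).toMultilinearMap.map_sum_finset
    (fun p v => (w v * P v p) • Q v) (fun _ => range L)
  have h1 : (Matrix.of fun p r => ∑ v ∈ range L, w v * P v p * Q v r).det =
      (Matrix.detRowAlternating (R := R) (n := Fin T)).toMultilinearMap
        fun p => ∑ v ∈ range L, (w v * P v p) • Q v := by
    change Matrix.det _ = Matrix.det _
    congr 1
    ext p r
    simp
  rw [h1, h]
  refine sum_congr rfl fun f _ => ?_
  rw [MultilinearMap.map_smul_univ]
  rfl

/-- The Cauchy-Binet formula, with a weight for every row. -/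
theorem det_sum_mul_mul {T : ℕ} (L : ℕ) (w : ℕ → R) (P Q : ℕ → Fin T → R) :
    (Matrix.of fun p r => ∑ v ∈ range L, w v * P v p * Q v r).det =
      ∑ f ∈ strictMonoFns T L, (∏ i, w (f i)) *
        (Matrix.of fun i p => P (f i) p).det * (Matrix.of fun i r => Q (f i) r).det := by
  classical
  rw [det_sum_eq_sum_piFinset]
  have h1 : ∀ f ∈ strictMonoFns T L, (∏ i, w (f i)) *
        (Matrix.of fun i p => P (f i) p).det * (Matrix.of fun i r => Q (f i) r).det =
      ∑ σ : Equiv.Perm (Fin T), (∏ i, w (f (σ i)) * P (f (σ i)) i) *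
        (Matrix.of fun i r => Q (f (σ i)) r).det := by
    intro f _
    have : ∀ σ : Equiv.Perm (Fin T), (Matrix.of fun i r => Q (f (σ i)) r).det =
        ((Equiv.Perm.sign σ : ℤ) : R) * (Matrix.of fun i r => Q (f i) r).det := fun σ =>
      Matrix.det_permute σ (Matrix.of fun i r => Q (f i) r)
    simp only [this, prod_mul_distrib]
    rw [Matrix.det_apply', mul_sum, sum_mul]
    refine sum_congr rfl fun σ _ => ?_
    rw [Equiv.prod_comp σ fun i => w (f i)]
    simp only [Matrix.of_apply]
    ring
  rw [sum_congr rfl h1, ← sum_product']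
  symm
  -- An injective sequence is an increasing one composed with a permutation, in exactly one way; a
  -- sequence that is not injective gives a determinant with two equal rows.
  refine sum_of_injOn (fun x : (Fin T → ℕ) × Equiv.Perm (Fin T) => x.1 ∘ x.2) ?_ ?_ ?_ ?_
  · rintro ⟨f, σ⟩ hf ⟨g, τ⟩ hg h
    have hf := (mem_strictMonoFns.1 (mem_product.1 (mem_coe.1 hf)).1).2
    have hg := (mem_strictMonoFns.1 (mem_product.1 (mem_coe.1 hg)).1).2
    simp only at h hf hg
    have hfg : f = g := by
      refine (hf.range_inj hg).1 ?_
      rw [← σ.surjective.range_comp f, ← τ.surjective.range_comp g, h]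
    subst hfg
    have : σ = τ := Equiv.ext fun i => hf.injective (congrFun h i)
    rw [this]
  · rintro ⟨f, σ⟩ hf
    have hf := (mem_strictMonoFns.1 (mem_product.1 (mem_coe.1 hf)).1).1
    simpa [Fintype.mem_piFinset] using fun i => hf (σ i)
  · intro f hf hf'
    have hni : ¬ Function.Injective f := by
      intro hinj
      apply hf'
      refine ⟨(f ∘ Tuple.sort f, (Tuple.sort f)⁻¹), ?_, ?_⟩
      · simp only [coe_product, Set.mem_prod, mem_coe, mem_univ, and_true]
        refine mem_strictMonoFns.2 ⟨fun i => ?_, ?_⟩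
        · simpa using Fintype.mem_piFinset.1 hf (Tuple.sort f i)
        · exact (Tuple.monotone_sort f).strictMono_of_injective
            (hinj.comp (Tuple.sort f).injective)
      · ext i
        simp
    have : ∃ i j, f i = f j ∧ i ≠ j := by
      simpa [Function.Injective] using hni
    obtain ⟨i, j, hij, hne⟩ := this
    rw [Matrix.det_zero_of_row_eq hne (by ext r; simp [hij]), mul_zero]
  · rintro ⟨f, σ⟩ _
    rfl

end CauchyBinet

/-! ### Increasing sequences with the smallest sums. -/

section StrictMono

variable {m : ℕ}

/-- The sequence `0, …, m - 1, m + 1`. -/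
def bumpLast (m : ℕ) (i : Fin (m + 1)) : ℕ := if (i : ℕ) = m then m + 1 else i

theorem strictMono_add_le {f : Fin (m + 1) → ℕ} (hf : StrictMono f) (i : Fin (m + 1)) :
    f i + (m - i) ≤ f (Fin.last m) := by
  induction i using Fin.reverseInduction with
  | last => simp
  | cast i ih =>
    have h := hf (Fin.castSucc_lt_succ (i := i))
    have := i.isLt
    simp only [Fin.val_succ, Fin.val_castSucc] at ih ⊢
    omega

theorem strictMono_le {f : Fin (m + 1) → ℕ} (hf : StrictMono f) (i : Fin (m + 1)) :
    (i : ℕ) ≤ f i := by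
  induction i using Fin.induction with
  | zero => simp
  | succ i ih =>
    have h := hf (Fin.castSucc_lt_succ (i := i))
    simp only [Fin.val_succ, Fin.val_castSucc] at ih ⊢
    omega

/-- Near a simple root a minor carries the weight $\delta^{\sum f}$, so the sequences of the two
smallest sums must be known exactly. Since $f_i\ge i$ and $f_i+(m-i)\le f_m$, the last entry
decides: $m$ leaves one sequence, $m+1$ leaves one of excess $1$, and anything larger has excess at
least $2$. -/
theorem strictMono_trichotomy {f : Fin (m + 1) → ℕ} (hf : StrictMono f) :
    f = (fun i : Fin (m + 1) => (i : ℕ)) ∨ f = bumpLast m ∨ ∑ i : Fin (m + 1), (i : ℕ) + 2 ≤ ∑ i, f i := by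
  rw [Fin.sum_univ_castSucc, Fin.sum_univ_castSucc f]
  have hle := strictMono_le hf
  have hadd := strictMono_add_le hf
  have hs : ∑ i : Fin m, ((Fin.castSucc i : Fin (m + 1)) : ℕ) ≤ ∑ i : Fin m, f i.castSucc :=
    sum_le_sum fun i _ => hle i.castSucc
  have hl := hle (Fin.last m)
  simp only [Fin.val_last] at *
  by_cases h0 : f (Fin.last m) = m
  · left
    ext i
    have h1 := hle i
    have h2 := hadd i
    have := i.isLt
    omega
  by_cases h1 : f (Fin.last m) = m + 1
  · by_cases h2 : ∀ i : Fin m, f i.castSucc = i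
    · right; left
      ext i
      induction i using Fin.lastCases with
      | last => simp [bumpLast, h1]
      | cast i =>
        have := i.isLt
        simp [bumpLast, h2, this.ne]
    · right; right
      push Not at h2
      obtain ⟨i, hi⟩ := h2
      have : ∑ i : Fin m, ((Fin.castSucc i : Fin (m + 1)) : ℕ) < ∑ i : Fin m, f i.castSucc := by
        refine sum_lt_sum (fun i _ => hle i.castSucc) ⟨i, mem_univ _, ?_⟩
        have := hle i.castSucc
        simp only [Fin.val_castSucc] at this ⊢
        omega
      omega
  · right; right
    omega

theorem strictMono_bumpLast : StrictMono (bumpLast m) := by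
  intro i j hij
  have := i.isLt
  have := j.isLt
  have : (i : ℕ) < j := hij
  unfold bumpLast
  split_ifs <;> omega

theorem strictMono_val : StrictMono (fun i : Fin (m + 1) => (i : ℕ)) := fun _ _ h => h

theorem bumpLast_ne_val : bumpLast m ≠ fun i : Fin (m + 1) => (i : ℕ) := fun h => by
  simpa [bumpLast] using congrFun h (Fin.last m)

theorem sum_bumpLast : ∑ i, bumpLast m i = ∑ i : Fin (m + 1), (i : ℕ) + 1 := by
  rw [Fin.sum_univ_castSucc, Fin.sum_univ_castSucc]
  have : ∀ i : Fin m, bumpLast m i.castSucc = i := fun i => by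
    have := i.isLt
    simp [bumpLast, this.ne]
  simp only [this]
  simp [bumpLast, add_assoc]

end StrictMono

/-! ### Derivative of a determinant whose rows are shifts of one another. -/

section DetDerivative

theorem hasDerivAt_det {ι : Type*} [Fintype ι] [DecidableEq ι] {M : ℝ → Matrix ι ι ℂ}
    {M' : Matrix ι ι ℂ} {t : ℝ} (h : ∀ i j, HasDerivAt (fun s => M s i j) (M' i j) t) :
    HasDerivAt (fun s => (M s).det) (∑ i, ((M t).updateRow i (M' i)).det) t := by
  simp only [Matrix.det_apply']
  have hd := HasDerivAt.fun_sum (u := (univ : Finset (Equiv.Perm ι))) fun σ _ =>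
    (HasDerivAt.fun_finsetProd (u := (univ : Finset ι)) fun i _ => h (σ i) i).const_mul
      (((Equiv.Perm.sign σ : ℤ) : ℂ))
  refine hd.congr_deriv ?_
  rw [sum_comm]
  refine sum_congr rfl fun σ _ => ?_
  rw [← mul_sum]
  congr 1
  rw [← Equiv.sum_comp σ fun i => ∏ x, (M t).updateRow i (M' i) (σ x) x]
  refine sum_congr rfl fun j _ => ?_
  rw [← mul_prod_erase univ (fun i => (M t).updateRow (σ j) (M' (σ j)) (σ i) i) (mem_univ j)]
  simp only [Matrix.updateRow_self, smul_eq_mul]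
  rw [mul_comm]
  congr 1
  refine prod_congr rfl fun i hi => ?_
  rw [Matrix.updateRow_ne]
  exact fun h => (mem_erase.1 hi).1 (σ.injective h)

variable {m : ℕ}

/-- The sequence `0, …, m` with `m - 1` replaced by `m + 1`. -/
def bumpPenult (m : ℕ) (i : Fin (m + 1)) : ℕ := if (i : ℕ) + 1 = m then m + 1 else i

/-- The sequence `0, …, m` with `m` replaced by `m + 2`. -/
def bumpLastTwo (m : ℕ) (i : Fin (m + 1)) : ℕ := if (i : ℕ) + 1 = m + 1 then m + 2 else i

/-- Raising a row index by one or two repeats another row unless the new index leaves $0,\dots,m$. A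
raise by one therefore survives only in the last row, a raise by two only in the last two; for $m=0$
there is no penultimate row. -/
theorem hasDerivAt_det_shift {M : ℝ → Matrix (Fin (m + 1)) (Fin (m + 1)) ℂ}
    {G : ℕ → Fin (m + 1) → ℂ} {s₁ s₂ : ℂ} {t : ℝ} (h0 : ∀ i j, M t i j = G i j)
    (h : ∀ i j, HasDerivAt (fun s => M s i j) (s₁ * G (i + 1) j + s₂ * G (i + 2) j) t) :
    HasDerivAt (fun s => (M s).det)
      (s₁ * (Matrix.of fun i r => G (bumpLast m i) r).det +
        s₂ * ((if m = 0 then 0 else (Matrix.of fun i r => G (bumpPenult m i) r).det) +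
          (Matrix.of fun i r => G (bumpLastTwo m i) r).det)) t := by
  refine (hasDerivAt_det (M' := Matrix.of fun (i j : Fin (m + 1)) => s₁ * G (i + 1) j + s₂ * G (i + 2) j)
    (by simpa using h)).congr_deriv ?_
  have hM : M t = Matrix.of fun (i j : Fin (m + 1)) => G i j := by ext i j; simp [h0]
  have hrow : ∀ i : Fin (m + 1), (Matrix.of fun (i : Fin (m + 1)) j => s₁ * G (i + 1) j +
      s₂ * G (i + 2) j) i = s₁ • G (i + 1) + s₂ • G (i + 2) := fun i => by ext j; simp
  simp only [hrow, Matrix.det_updateRow_add, Matrix.det_updateRow_smul, sum_add_distrib]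
  rw [← mul_sum, ← mul_sum]
  have hdup : ∀ (i j : Fin (m + 1)) (v : ℕ), i ≠ j → v = j →
      ((M t).updateRow i (G v)).det = 0 := by
    intro i j v hij hv
    refine Matrix.det_zero_of_row_eq hij ?_
    ext r
    rw [Matrix.updateRow_self, Matrix.updateRow_ne hij.symm, h0, hv]
  congr 2
  · rw [Fin.sum_univ_castSucc, sum_eq_zero, zero_add]
    · congr 1
      ext i j
      by_cases hi : i = Fin.last m
      · subst hi; simp [bumpLast]
      · have hi' : (i : ℕ) ≠ m := fun h => hi (Fin.ext h)
        simp [Matrix.updateRow_ne hi, h0, bumpLast, hi']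
    · intro i _
      exact hdup _ i.succ _ Fin.castSucc_lt_succ.ne (by simp)
  · rw [Fin.sum_univ_castSucc]
    congr 1
    · cases m with
      | zero => simp
      | succ m =>
        rw [if_neg (Nat.succ_ne_zero m), Fin.sum_univ_castSucc, sum_eq_zero, zero_add]
        · congr 1
          ext i j
          by_cases hi : i = (Fin.last m).castSucc
          · subst hi; simp [bumpPenult]
          · have hi' : (i : ℕ) ≠ m := fun h => hi (Fin.ext h)
            simp [Matrix.updateRow_ne hi, h0, bumpPenult, hi']
        · intro i _
          refine hdup _ i.succ.succ _ (fun h => ?_) (by simp)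
          have := congrArg Fin.val h
          simp at this
          omega
    · congr 1
      ext i j
      by_cases hi : i = Fin.last m
      · subst hi; simp [bumpLastTwo]
      · have hi' : (i : ℕ) ≠ m := fun h => hi (Fin.ext h)
        simp [Matrix.updateRow_ne hi, h0, bumpLastTwo, hi']

end DetDerivative

/-- $1/(j-i)!$ is the falling factorial of $j$ of length $i$ divided by $j!$. Falling factorials are
monic of degree $i$, so the determinant is a Vandermonde determinant up to nonzero factors. -/
theorem det_inv_factorial_ne_zero {T : ℕ} {j : Fin T → ℕ} (hj : Function.Injective j) :
    (Matrix.of fun i r : Fin T =>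
      if (i : ℕ) ≤ j r then (((j r - i).factorial : ℕ) : ℂ)⁻¹ else 0).det ≠ 0 := by
  have h := Matrix.det_eval_matrixOfPolynomials_eq_det_vandermonde (fun r => ((j r : ℕ) : ℂ))
    (fun i : Fin T => descPochhammer ℂ i) (fun i => descPochhammer_natDegree ℂ i)
    (fun i => monic_descPochhammer ℂ i)
  have hv : (Matrix.vandermonde fun r => ((j r : ℕ) : ℂ)).det ≠ 0 :=
    Matrix.det_vandermonde_ne_zero_iff.2 fun a b hab => hj (Nat.cast_injective hab)
  rw [h] at hv
  have h2 := Matrix.det_mul_column (fun r => (((j r).factorial : ℕ) : ℂ)) (Matrix.of fun r i : Fin T =>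
      if (i : ℕ) ≤ j r then (((j r - i).factorial : ℕ) : ℂ)⁻¹ else 0)
  rw [← Matrix.det_transpose]
  intro h0
  apply hv
  have h0' : (Matrix.of fun r i : Fin T =>
      if (i : ℕ) ≤ j r then (((j r - i).factorial : ℕ) : ℂ)⁻¹ else 0).det = 0 := h0
  rw [h0', mul_zero] at h2
  rw [← h2]
  congr 1
  ext r i
  simp only [Matrix.of_apply]
  rw [descPochhammer_eval_eq_descFactorial]
  split_ifs with hij
  · rw [eq_mul_inv_iff_mul_eq₀ (Nat.cast_ne_zero.2 (Nat.factorial_ne_zero _)), mul_comm]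
    exact_mod_cast Nat.factorial_mul_descFactorial hij
  · rw [Nat.descFactorial_of_lt (not_le.1 hij)]
    simp

/-! ### Reduction of columns with a geometric factor, and splitting off a row and a column. -/

section ColumnReduction

variable {m : ℕ}

/-- `0, J_0 + 1, …, J_{m-1} + 1`. -/
def lowIdx (J : Fin (m + 1) → ℕ) : Fin (m + 1) → ℕ :=
  Fin.cons 0 fun r => J r.castSucc + 1

theorem lowIdx_zero (J : Fin (m + 1) → ℕ) : lowIdx J 0 = 0 := rfl

theorem lowIdx_succ (J : Fin (m + 1) → ℕ) (r : Fin m) : lowIdx J r.succ = J r.castSucc + 1 := rfl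

theorem lowIdx_le {J : Fin (m + 1) → ℕ} (hJ : StrictMono J) (r : Fin (m + 1)) :
    lowIdx J r ≤ J r := by
  induction r using Fin.cases with
  | zero => simp [lowIdx_zero]
  | succ r => exact hJ Fin.castSucc_lt_succ

theorem strictMono_lowIdx {J : Fin (m + 1) → ℕ} (hJ : StrictMono J) : StrictMono (lowIdx J) := by
  refine Fin.strictMono_iff_lt_succ.2 fun i => ?_
  rw [lowIdx_succ]
  exact Nat.lt_succ_of_le (lowIdx_le hJ _)

/-- Multiplying the coefficient of degree $J_{r-1}$ by $a^{J_r-J_{r-1}}$ reproduces all terms with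
$k\le J_{r-1}$ in the coefficient of degree $J_r$. Subtracting this multiple of the preceding column
removes them. -/
theorem det_geometric_reduce {R : Type*} [CommRing R] (a : R) {J : Fin (m + 1) → ℕ}
    (hJ : StrictMono J) (e : Fin (m + 1) → ℕ → R) :
    (Matrix.of fun i r => ∑ k ∈ range (J r + 1), a ^ (J r - k) * e i k).det =
      (Matrix.of fun i r => ∑ k ∈ Icc (lowIdx J r) (J r), a ^ (J r - k) * e i k).det := by
  refine Matrix.det_eq_of_forall_col_eq_smul_add_pred
    (fun r => a ^ (J r.succ - J r.castSucc)) (fun i => ?_) (fun i r => ?_)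
  · simp only [Matrix.of_apply, lowIdx_zero]
    congr 1
    ext k
    simp
  · have hlt := hJ (Fin.castSucc_lt_succ (i := r))
    simp only [Matrix.of_apply, lowIdx_succ, mul_sum]
    rw [← sum_range_add_sum_Ico _ (show J r.castSucc + 1 ≤ J r.succ + 1 by omega), add_comm]
    congr 1
    · refine sum_congr rfl fun k hk => ?_
      have := mem_range.1 hk
      rw [← mul_assoc, ← pow_add]
      congr 2
      omega

/-- The row with index $0$ contains only the term $v=0$, so multiples of it remove that term from
all other rows; the first column then has a single nonzero candidate. This is how the order drops
from $\mathcal N$ to $\hat{\mathcal N}$ while $v$ becomes $v+1$. -/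
theorem det_sum_cons {R : Type*} [CommRing R] (L : ℕ) (w : ℕ → R) (P Q : ℕ → Fin (m + 1) → R)
    (hP : ∀ v, P v 0 = if v = 0 then 1 else 0) (hQ : ∀ v, Q v 0 = if v = 0 then 1 else 0) :
    (Matrix.of fun p r => ∑ v ∈ range (L + 1), w v * P v p * Q v r).det =
      w 0 * (Matrix.of fun p r : Fin m =>
        ∑ v ∈ range L, w (v + 1) * P (v + 1) p.succ * Q (v + 1) r.succ).det := by
  set M : Matrix (Fin (m + 1)) (Fin (m + 1)) R :=
    Matrix.of fun p r => ∑ v ∈ range (L + 1), w v * P v p * Q v r with hM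
  set B : Matrix (Fin (m + 1)) (Fin (m + 1)) R := Matrix.of fun p r =>
    if p = 0 then M 0 r else ∑ v ∈ range L, w (v + 1) * P (v + 1) p * Q (v + 1) r with hB
  have hM0 : ∀ r, M 0 r = w 0 * Q 0 r := by
    intro r
    rw [hM, Matrix.of_apply, sum_range_succ', sum_eq_zero]
    · simp [hP]
    · simp [hP]
  have hdet : M.det = B.det := by
    refine Matrix.det_eq_of_forall_row_eq_smul_add_const (fun p => if p = 0 then 0 else P 0 p) 0
      (by simp) (fun p r => ?_)
    by_cases hp : p = 0
    · subst hp; simp [hB]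
    · simp only [hB, Matrix.of_apply, if_neg hp, if_true, hM0]
      rw [hM, Matrix.of_apply, sum_range_succ']
      ring
  rw [hdet, Matrix.det_succ_column_zero, Fin.sum_univ_succ, sum_eq_zero, add_zero]
  · have : B 0 0 = w 0 := by simp [hB, hM0, hQ]
    rw [this]
    simp only [Fin.val_zero, pow_zero, one_mul]
    congr 2
  · intro j _
    have : B j.succ 0 = 0 := by
      simp [hB, hQ]
    rw [this]
    ring

end ColumnReduction

/-! ### Cotangent identities and the characteristic polynomial. -/

section Trigonometry

variable (n : ℕ)

/-- `cot (k π / (n + 1))`. -/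
def cotAngle (k : Fin n) : ℝ := Real.cos (angle n k) / Real.sin (angle n k)

variable {n}

theorem angle_pos (k : Fin n) : 0 < angle n k := by
  unfold angle
  positivity

theorem angle_lt_pi (k : Fin n) : angle n k < Real.pi := by
  unfold angle
  rw [div_lt_iff₀ (by positivity), mul_comm]
  have : ((k : ℕ) : ℝ) < n := by exact_mod_cast k.isLt
  exact mul_lt_mul_of_pos_left (by linarith) Real.pi_pos

theorem sin_angle_pos (k : Fin n) : 0 < Real.sin (angle n k) :=
  Real.sin_pos_of_pos_of_lt_pi (angle_pos k) (angle_lt_pi k)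

theorem angle_injective : Function.Injective (angle n) := by
  intro a b h
  unfold angle at h
  have hn : ((n : ℝ) + 1) ≠ 0 := by positivity
  rw [div_left_inj' hn, mul_left_inj' Real.pi_ne_zero] at h
  exact Fin.ext (by exact_mod_cast add_right_cancel h)

theorem cotAngle_injective : Function.Injective (cotAngle n) := by
  intro a b h
  unfold cotAngle at h
  rw [div_eq_div_iff (sin_angle_pos a).ne' (sin_angle_pos b).ne'] at h
  have hs : Real.sin (angle n b - angle n a) = 0 := by rw [Real.sin_sub]; linarith
  rw [Real.sin_eq_zero_iff_of_lt_of_lt] at hs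
  · exact angle_injective (by linarith)
  · have := angle_pos b; have := angle_lt_pi a; linarith
  · have := angle_pos a; have := angle_lt_pi b; linarith

theorem sum_cotAngle : ∑ k : Fin n, cotAngle n k = 0 := by
  have h : ∀ k : Fin n, cotAngle n (Fin.revPerm k) = - cotAngle n k := by
    intro k
    have : angle n (Fin.revPerm k) = Real.pi - angle n k := by
      unfold angle
      have hk := k.isLt
      have : (((Fin.revPerm k : Fin n) : ℕ) : ℝ) = n - (k + 1) := by
        rw [Fin.revPerm_apply, Fin.val_rev, Nat.cast_sub (by omega)]
        push_cast
        ring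
      rw [this]
      field_simp
      ring
    rw [cotAngle, this, Real.cos_pi_sub, Real.sin_pi_sub, cotAngle, neg_div]
  have h2 := Equiv.sum_comp Fin.revPerm (cotAngle n)
  simp only [h, sum_neg_distrib] at h2
  linarith

theorem one_add_cotAngle_sq (k : Fin n) :
    1 + cotAngle n k ^ 2 = (1 / Real.sin (angle n k)) ^ 2 := by
  have := (sin_angle_pos k).ne'
  unfold cotAngle
  field_simp
  exact Real.sin_sq_add_cos_sq _

/-- $-\cot\theta\pm\mathrm i=-e^{\mp\mathrm i\theta}/\sin\theta$, and $(n+1)\theta$ is a multiple of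
$\pi$. -/
theorem cotAngle_pow_eq (k : Fin n) :
    (-(cotAngle n k : ℂ) + Complex.I) ^ (n + 1) = (-(cotAngle n k : ℂ) - Complex.I) ^ (n + 1) := by
  have hs : (Real.sin (angle n k) : ℂ) ≠ 0 := Complex.ofReal_ne_zero.2 (sin_angle_pos k).ne'
  have h1 : -(cotAngle n k : ℂ) + Complex.I =
      -(Complex.exp (((-angle n k : ℝ) : ℂ) * Complex.I) / Real.sin (angle n k)) := by
    rw [Complex.exp_mul_I, ← Complex.ofReal_cos, ← Complex.ofReal_sin, Real.cos_neg, Real.sin_neg,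
      cotAngle]
    push_cast at hs ⊢
    field_simp
    ring
  have h2 : -(cotAngle n k : ℂ) - Complex.I =
      -(Complex.exp (((angle n k : ℝ) : ℂ) * Complex.I) / Real.sin (angle n k)) := by
    rw [Complex.exp_mul_I, ← Complex.ofReal_cos, ← Complex.ofReal_sin, cotAngle]
    push_cast at hs ⊢
    field_simp
    ring
  rw [h1, h2, neg_pow, neg_pow (_ / _), div_pow, div_pow, ← Complex.exp_nat_mul,
    ← Complex.exp_nat_mul]
  congr 2
  rw [Complex.exp_eq_exp_iff_exists_int]
  refine ⟨-((k : ℤ) + 1), ?_⟩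
  have hn : ((n : ℂ) + 1) ≠ 0 := Nat.cast_add_one_ne_zero n
  unfold angle
  push_cast
  field_simp
  ring

open Polynomial

theorem two_I_mul_ne_zero : 2 * Complex.I * ((n : ℂ) + 1) ≠ 0 :=
  mul_ne_zero (mul_ne_zero two_ne_zero Complex.I_ne_zero) (Nat.cast_add_one_ne_zero n)

/-- Both sides vanish at the $n$ distinct points $-\cot\theta_j$ and have the same coefficient in
degree $n$, so their difference has degree less than $n$ and too many zeros. -/
theorem prod_X_add_cotAngle : C (2 * Complex.I * ((n : ℂ) + 1)) *
    ∏ j : Fin n, (X + C (cotAngle n j : ℂ)) =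
      (X + C Complex.I) ^ (n + 1) - (X + C (-Complex.I)) ^ (n + 1) := by
  refine eq_of_degree_sub_lt_of_eval_index_eq (univ : Finset (Fin n))
    (v := fun j => -(cotAngle n j : ℂ)) ?_ ?_ ?_
  · intro a _ b _ h
    exact cotAngle_injective (Complex.ofReal_injective (neg_injective h))
  · rw [card_univ, Fintype.card_fin, degree_lt_iff_coeff_zero]
    intro k hk
    have hmon : (∏ j : Fin n, (X + C (cotAngle n j : ℂ))).Monic :=
      monic_prod_of_monic _ _ fun j _ => monic_X_add_C _
    have hdeg : (∏ j : Fin n, (X + C (cotAngle n j : ℂ))).natDegree = n := by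
      rw [natDegree_prod_of_monic _ _ fun j _ => monic_X_add_C _]
      simp
    rw [coeff_sub, coeff_sub, coeff_C_mul, coeff_X_add_C_pow, coeff_X_add_C_pow]
    rcases eq_or_lt_of_le hk with rfl | hk
    · have : (∏ j : Fin n, (X + C (cotAngle n j : ℂ))).coeff n = 1 := by
        conv_lhs => rw [← hdeg]
        convert! hmon.coeff_natDegree using 2
        rw [hdeg]
      rw [this]
      simp
      ring
    · rw [coeff_eq_zero_of_natDegree_lt (by omega)]
      rcases eq_or_lt_of_le (Nat.succ_le_of_lt hk) with rfl | hk
      · simp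
      · rw [Nat.choose_eq_zero_of_lt hk]
        simp
  · intro j _
    rw [eval_mul, eval_prod, prod_eq_zero (mem_univ j) (by simp), mul_zero]
    simp only [eval_sub, eval_pow, eval_add, eval_X, eval_C]
    rw [cotAngle_pow_eq, ← sub_eq_add_neg, sub_self]

/-- In normalized variables this is the $(n+1)$-fold root $\chi_0$ at $\lambda_0$. With
$Q=\prod(X+c_j)$, the identity $1+c^2=(1+X^2)-(X+c)(X-c)$ and $\sum c_i=0$ turn the sum into
$(1+X^2)Q'-nXQ$; inserting $Q$ as a difference of two powers makes everything but one power cancel.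
-/
theorem char_polynomial_identity :
    (X - C (Complex.I * ((n : ℂ) + 1))) * ∏ j : Fin n, (X + C (cotAngle n j : ℂ)) -
      ∑ i : Fin n, C (1 + (cotAngle n i : ℂ) ^ 2) *
        ∏ j ∈ univ.erase i, (X + C (cotAngle n j : ℂ)) = (X - C Complex.I) ^ (n + 1) := by
  set Q : ℂ[X] := ∏ j : Fin n, (X + C (cotAngle n j : ℂ)) with hQ
  have hQ' : derivative Q = ∑ i : Fin n, ∏ j ∈ univ.erase i, (X + C (cotAngle n j : ℂ)) := by
    rw [hQ, derivative_prod_finset]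
    simp
  have hsum : ∑ i : Fin n, C (1 + (cotAngle n i : ℂ) ^ 2) *
      ∏ j ∈ univ.erase i, (X + C (cotAngle n j : ℂ)) =
      (1 + X ^ 2) * derivative Q - (n : ℂ[X]) * X * Q := by
    have : ∀ i : Fin n, C (1 + (cotAngle n i : ℂ) ^ 2) *
        ∏ j ∈ univ.erase i, (X + C (cotAngle n j : ℂ)) =
        (1 + X ^ 2) * ∏ j ∈ univ.erase i, (X + C (cotAngle n j : ℂ)) -
          (X * Q - C (cotAngle n i : ℂ) * Q) := by
      intro i
      rw [hQ, ← mul_prod_erase univ (fun j => X + C (cotAngle n j : ℂ)) (mem_univ i)]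
      simp only [map_add, map_pow, map_one]
      ring
    rw [sum_congr rfl fun i _ => this i, sum_sub_distrib, sum_sub_distrib, ← mul_sum, ← hQ',
      ← sum_mul, ← sum_mul, ← map_sum, ← Complex.ofReal_sum, sum_cotAngle]
    simp
  rw [hsum]
  have hK := prod_X_add_cotAngle (n := n)
  rw [← hQ] at hK
  have hK' := congrArg derivative hK
  rw [derivative_C_mul, derivative_sub, derivative_X_add_C_pow, derivative_X_add_C_pow] at hK'
  have hne : C (2 * Complex.I * ((n : ℂ) + 1)) ≠ 0 := C_ne_zero.2 two_I_mul_ne_zero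
  refine mul_left_cancel₀ hne ?_
  have h1 : C (2 * Complex.I * ((n : ℂ) + 1)) *
      ((X - C (Complex.I * ((n : ℂ) + 1))) * Q - ((1 + X ^ 2) * derivative Q - (n : ℂ[X]) * X * Q)) =
      ((n : ℂ[X]) + 1) * (X - C Complex.I) * (C (2 * Complex.I * ((n : ℂ) + 1)) * Q) -
        (1 + X ^ 2) * (C (2 * Complex.I * ((n : ℂ) + 1)) * derivative Q) := by
    have : C (Complex.I * ((n : ℂ) + 1)) = C Complex.I * ((n : ℂ[X]) + 1) := by simp
    rw [this]
    ring
  rw [h1, hK, hK']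
  have h2 : (1 + X ^ 2 : ℂ[X]) = (X + C Complex.I) * (X - C Complex.I) := by
    have : C Complex.I * C Complex.I = (-1 : ℂ[X]) := by rw [← C_mul, Complex.I_mul_I]; simp
    linear_combination this
  rw [h2]
  have h3 : C (2 * Complex.I * ((n : ℂ) + 1)) = 2 * C Complex.I * ((n : ℂ[X]) + 1) := by
    simp only [map_mul, map_add, map_natCast, map_one]
    rfl
  rw [h3]
  simp only [map_neg, ← sub_eq_add_neg, map_natCast, Nat.add_sub_cancel]
  push_cast
  ring

end Trigonometry

/-! ### First coefficients of the spectral series. -/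

theorem coeff_one_logOf {f : PowerSeries ℂ} (hf : PowerSeries.coeff 0 f = 1) :
    PowerSeries.coeff 1 (PowerSeries.logOf f) = PowerSeries.coeff 1 f := by
  have h0 : PowerSeries.constantCoeff (f - 1) = 0 := by
    rw [map_sub, ← PowerSeries.coeff_zero_eq_constantCoeff_apply, hf]
    simp
  have hs : PowerSeries.HasSubst (f - 1) := PowerSeries.HasSubst.of_constantCoeff_zero' h0
  have h := congrArg (PowerSeries.coeff 0) (PowerSeries.derivative_subst (f := PowerSeries.log ℂ) hs)
  rw [PowerSeries.coeff_derivative] at h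
  have h2 : (PowerSeries.constantCoeff (R := ℂ))
      ((PowerSeries.derivative ℂ (PowerSeries.log ℂ)).subst (f - 1)) = 1 := by
    have h3 := PowerSeries.constantCoeff_subst_eq_zero (S := ℂ) h0
      (PowerSeries.derivative ℂ (PowerSeries.log ℂ) - 1) (by
        rw [map_sub, ← PowerSeries.coeff_zero_eq_constantCoeff_apply, PowerSeries.coeff_derivative]
        simp)
    rw [PowerSeries.subst_sub hs, map_sub, sub_eq_zero] at h3
    refine Eq.trans h3 ?_
    rw [← PowerSeries.coe_substAlgHom hs, map_one, map_one]
  rw [PowerSeries.coeff_zero_eq_constantCoeff_apply, map_mul, h2,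
    ← PowerSeries.coeff_zero_eq_constantCoeff_apply, PowerSeries.coeff_derivative] at h
  rw [PowerSeries.logOf_eq]
  simpa using h

namespace SpectralData

variable {n : ℕ} (D : SpectralData n)

/-- `p = 2 Im λ₀ / (n + 1)`, which is the imaginary part of `χ₀`. -/
theorem c0_eq : D.c0 = ((2 * D.lam0.re : ℝ) : ℂ) + Complex.I * (D.c0.im : ℂ) := by
  rw [D.c0_re_im.2]
  rfl

theorem star_c0_eq :
    star D.c0 = ((2 * D.lam0.re : ℝ) : ℂ) - Complex.I * (D.c0.im : ℂ) := by
  have h := D.c0_re_im.1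
  apply Complex.ext <;> simp [h]

theorem c0_sub_star : D.c0 - star D.c0 = 2 * Complex.I * (D.c0.im : ℂ) := by
  rw [star_c0_eq]
  nth_rewrite 1 [c0_eq]
  ring

theorem c0_sub_star_ne : D.c0 - star D.c0 ≠ 0 := by
  rw [c0_sub_star]
  exact mul_ne_zero (mul_ne_zero two_ne_zero Complex.I_ne_zero)
    (Complex.ofReal_ne_zero.2 D.c0_im_ne)

theorem waveNum_eq (k : Fin n) :
    waveNum n D.lam0 k = D.c0.im * cotAngle n k - 2 * D.lam0.re := by
  rw [D.c0_re_im.2]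
  rfl

theorem amp_eq (k : Fin n) : amp n D.lam0 k = D.c0.im * (1 / Real.sin (angle n k)) := by
  rw [D.c0_re_im.2]
  rfl

theorem amp_ne (k : Fin n) : amp n D.lam0 k ≠ 0 := by
  rw [amp_eq]
  exact mul_ne_zero D.c0_im_ne (one_div_ne_zero (sin_angle_pos k).ne')

theorem c0_add_waveNum_ne (k : Fin n) : D.c0 + (waveNum n D.lam0 k : ℂ) ≠ 0 := by
  intro h
  have := congrArg Complex.im h
  simp at this
  exact D.c0_im_ne this

/-- The substitution $Y=(\chi-2\operatorname{Re}\lambda_0)/\operatorname{Im}\chi_0$ turns $\chi+b_j$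
into a multiple of $Y+\cot\theta_j$ and $\chi-\chi_0$, $\chi-\chi_0^*$ into multiples of
$Y\mp\mathrm i$. The two polynomial identities are then evaluated at $Y$. -/
theorem prod_chi_add_waveNum :
    PowerSeries.C (2 * Complex.I * ((n : ℂ) + 1) * (D.c0.im : ℂ)) *
      ∏ j : Fin n, (D.chi + PowerSeries.C (waveNum n D.lam0 j : ℂ)) =
    (D.chi - PowerSeries.C (star D.c0)) ^ (n + 1) - (D.chi - PowerSeries.C D.c0) ^ (n + 1) ∧
    (1 ≤ n → (D.chi - PowerSeries.C D.c0) ^ (n + 1) =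
      PowerSeries.C (2 * D.lam1) * PowerSeries.X ^ (n + 1) *
        ∏ j : Fin n, (D.chi + PowerSeries.C (waveNum n D.lam0 j : ℂ))) := by
  have hp : (D.c0.im : ℂ) ≠ 0 := Complex.ofReal_ne_zero.2 D.c0_im_ne
  set p : ℂ := (D.c0.im : ℂ) with hpdef
  set s : ℂ := ((2 * D.lam0.re : ℝ) : ℂ) with hs
  set Y : PowerSeries ℂ := PowerSeries.C p⁻¹ * (D.chi - PowerSeries.C s) with hY
  have hpY : PowerSeries.C p * Y = D.chi - PowerSeries.C s := by
    rw [hY, ← mul_assoc, ← map_mul, mul_inv_cancel₀ hp, map_one, one_mul]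
  have hchi : ∀ j : Fin n, D.chi + PowerSeries.C (waveNum n D.lam0 j : ℂ) =
      PowerSeries.C p * (Y + PowerSeries.C (cotAngle n j : ℂ)) := by
    intro j
    rw [mul_add, hpY, waveNum_eq, hs, hpdef, ← map_mul]
    push_cast
    rw [map_sub]
    ring
  have hc0 : D.chi - PowerSeries.C D.c0 = PowerSeries.C p * (Y - PowerSeries.C Complex.I) := by
    rw [mul_sub, hpY, c0_eq, ← map_mul, map_add, ← hpdef, ← hs, mul_comm p]
    ring
  have hc0' : D.chi - PowerSeries.C (star D.c0) =
      PowerSeries.C p * (Y + PowerSeries.C Complex.I) := by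
    rw [mul_add, hpY, star_c0_eq, ← map_mul, map_sub, ← hpdef, ← hs, mul_comm p]
    ring
  have hprod : ∀ S : Finset (Fin n), ∏ j ∈ S, (D.chi + PowerSeries.C (waveNum n D.lam0 j : ℂ)) =
      PowerSeries.C p ^ S.card * ∏ j ∈ S, (Y + PowerSeries.C (cotAngle n j : ℂ)) := by
    intro S
    rw [prod_congr rfl fun j _ => hchi j, prod_mul_distrib, prod_const]
  constructor
  · have h := congrArg (Polynomial.aeval Y) (prod_X_add_cotAngle (n := n))
    simp only [map_mul, map_sub, map_pow, map_add, map_prod, Polynomial.aeval_X,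
      Polynomial.aeval_C] at h
    rw [hprod, card_univ, Fintype.card_fin, hc0, hc0']
    simp only [PowerSeries.algebraMap_apply, Algebra.algebraMap_self, RingHom.id_apply] at h
    simp only [map_mul, map_add]
    simp only [map_neg] at h
    rw [mul_pow, mul_pow, ← mul_sub, sub_eq_add_neg Y, ← h]
    ring
  · intro hn
    have h := congrArg (Polynomial.aeval Y) (char_polynomial_identity (n := n))
    simp only [map_mul, map_sub, map_pow, map_add, map_prod, map_sum, Polynomial.aeval_X,
      Polynomial.aeval_C, PowerSeries.algebraMap_apply, Algebra.algebraMap_self,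
      RingHom.id_apply] at h
    have hc := D.charEq
    unfold CharEq at hc
    have hlam : D.chi - 2 * lamSeries n D.lam0 D.lam1 =
        PowerSeries.C p * (Y - PowerSeries.C (Complex.I * ((n : ℂ) + 1))) -
          PowerSeries.C (2 * D.lam1) * PowerSeries.X ^ (n + 1) := by
      have h2 : (2 * D.lam0 : ℂ) = s + p * (Complex.I * ((n : ℂ) + 1)) := by
        rw [hpdef, D.c0_re_im.2, hs]
        have hn : ((n : ℂ) + 1) ≠ 0 := Nat.cast_add_one_ne_zero n
        push_cast
        field_simp
        nth_rewrite 1 [← Complex.re_add_im D.lam0]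
        ring
      have h3 : (2 : PowerSeries ℂ) * PowerSeries.C D.lam0 = PowerSeries.C (2 * D.lam0) := by
        rw [map_mul]
        rfl
      have h4 : (2 : PowerSeries ℂ) * PowerSeries.C D.lam1 = PowerSeries.C (2 * D.lam1) := by
        rw [map_mul]
        rfl
      rw [lamSeries, mul_add, ← mul_assoc, h3, h4, h2, mul_sub, hpY, map_add, ← map_mul]
      ring
    have hamp : ∀ i : Fin n, ((amp n D.lam0 i : ℂ)) ^ 2 = p ^ 2 * (1 + (cotAngle n i : ℂ) ^ 2) := by
      intro i
      rw [amp_eq, hpdef]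
      have := one_add_cotAngle_sq i
      exact_mod_cast (by rw [this]; ring :
        (D.c0.im * (1 / Real.sin (angle n i))) ^ 2 = D.c0.im ^ 2 * (1 + cotAngle n i ^ 2))
    have hterm : ∀ i : Fin n, PowerSeries.C ((amp n D.lam0 i : ℂ) ^ 2) *
        ∏ j ∈ univ.erase i, (D.chi + PowerSeries.C (waveNum n D.lam0 j : ℂ)) =
        PowerSeries.C p ^ (n + 1) * ((PowerSeries.C 1 + PowerSeries.C (cotAngle n i : ℂ) ^ 2) *
          ∏ j ∈ univ.erase i, (Y + PowerSeries.C (cotAngle n j : ℂ))) := by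
      intro i
      rw [hprod, card_erase_of_mem (mem_univ i), card_univ, Fintype.card_fin, hamp,
        show n + 1 = 2 + (n - 1) by omega, pow_add]
      simp only [map_mul, map_add, map_pow]
      ring
    rw [sum_congr rfl fun i _ => hterm i, ← mul_sum, hlam, sub_mul] at hc
    have hc2 : PowerSeries.C p ^ (n + 1) * ((Y - PowerSeries.C Complex.I) ^ (n + 1)) =
        PowerSeries.C (2 * D.lam1) * PowerSeries.X ^ (n + 1) *
          ∏ j : Fin n, (D.chi + PowerSeries.C (waveNum n D.lam0 j : ℂ)) := by
      rw [← h]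
      rw [hprod, card_univ, Fintype.card_fin] at hc ⊢
      simp only [map_mul, map_add] at hc ⊢
      linear_combination hc
    rw [hc0, mul_pow, hc2]

/-- `(χ(ε) - χ₀) / ε`. -/
def chiShift : PowerSeries ℂ := PowerSeries.mk fun i => PowerSeries.coeff (i + 1) D.chi

theorem chi_sub_c0 : D.chi - PowerSeries.C D.c0 = PowerSeries.X * D.chiShift := by
  have h := PowerSeries.eq_X_mul_shift_add_const D.chi
  rw [← PowerSeries.coeff_zero_eq_constantCoeff_apply, D.chi_zero] at h
  nth_rewrite 1 [h]
  rw [chiShift, c0]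
  ring

/-- Eliminating $\prod_j(\chi+b_j)$ from the two relations of `prod_chi_add_waveNum` and cancelling
$\varepsilon^{n+1}$. It says that $\big((\chi-\chi_0)/(\chi-\chi_0^*)\big)^{n+1}$ depends on
$\varepsilon^{n+1}$ only. -/
theorem chiShift_pow (hn : 1 ≤ n) : ∃ μ : ℂ, μ ≠ 0 ∧
    D.chiShift ^ (n + 1) * (1 + PowerSeries.C μ * PowerSeries.X ^ (n + 1)) =
      PowerSeries.C μ * (D.chi - PowerSeries.C (star D.c0)) ^ (n + 1) := by
  have hp : (D.c0.im : ℂ) ≠ 0 := Complex.ofReal_ne_zero.2 D.c0_im_ne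
  set K : ℂ := 2 * Complex.I * ((n : ℂ) + 1) * (D.c0.im : ℂ) with hK
  have hKne : K ≠ 0 := mul_ne_zero two_I_mul_ne_zero hp
  refine ⟨2 * D.lam1 / K, div_ne_zero (mul_ne_zero two_ne_zero D.lam1_ne) hKne, ?_⟩
  obtain ⟨h1, h2⟩ := D.prod_chi_add_waveNum
  have h2 := h2 hn
  rw [chi_sub_c0] at h1 h2
  set B := ∏ j : Fin n, (D.chi + PowerSeries.C (waveNum n D.lam0 j : ℂ)) with hB
  have hX : (PowerSeries.X : PowerSeries ℂ) ^ (n + 1) ≠ 0 := pow_ne_zero _ PowerSeries.X_ne_zero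
  have h3 : D.chiShift ^ (n + 1) = PowerSeries.C (2 * D.lam1) * B := by
    refine mul_left_cancel₀ hX ?_
    rw [← mul_pow, h2]
    ring
  have h4 : PowerSeries.C (2 * D.lam1) = PowerSeries.C (2 * D.lam1 / K) * PowerSeries.C K := by
    rw [← map_mul, div_mul_cancel₀ _ hKne]
  rw [← hK, mul_pow] at h1
  rw [mul_add, mul_one]
  nth_rewrite 1 [h3]
  rw [h4]
  linear_combination PowerSeries.C (2 * D.lam1 / K) * h1

theorem coeff_zero_chiShift : PowerSeries.coeff 0 D.chiShift = D.c1 := by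
  simp [chiShift, c1]

theorem coeff_zero_chi_sub : PowerSeries.coeff 0 (D.chi - PowerSeries.C (star D.c0)) =
    D.c0 - star D.c0 := by
  rw [map_sub, D.chi_zero]
  simp [c0]

theorem coeff_one_chi_sub (c : ℂ) : PowerSeries.coeff 1 (D.chi - PowerSeries.C c) = D.c1 := by
  rw [map_sub, PowerSeries.coeff_C]
  simp [c1]

theorem coeff_one_pow (f : PowerSeries ℂ) (m : ℕ) : PowerSeries.coeff 1 (f ^ (m + 1)) =
    (m + 1) * PowerSeries.coeff 0 f ^ m * PowerSeries.coeff 1 f := by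
  induction m with
  | zero => simp
  | succ m ih =>
    rw [pow_succ, PowerSeries.coeff_mul, Finset.Nat.antidiagonal_succ]
    simp only [Finset.Nat.antidiagonal_zero, Finset.map_singleton, Finset.sum_cons,
      Finset.sum_singleton, Function.Embedding.prodMap, Function.Embedding.coeFn_mk, Prod.map]
    simp only [Function.Embedding.refl_apply, Nat.succ_eq_add_one, zero_add]
    rw [ih, PowerSeries.coeff_zero_eq_constantCoeff_apply, map_pow,
      PowerSeries.coeff_zero_eq_constantCoeff_apply]
    push_cast
    ring

/-- Coefficients of degree $0$ and $1$ in `chiShift_pow`; the factor $1+\mu\varepsilon^{n+1}$ does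
not reach degree $1$. -/
theorem c1_relations (hn : 1 ≤ n) : D.c1 ≠ 0 ∧
    PowerSeries.coeff 2 D.chi * (D.c0 - star D.c0) = D.c1 ^ 2 := by
  obtain ⟨μ, hμ, h⟩ := D.chiShift_pow hn
  have hd := D.c0_sub_star_ne
  have e0 : D.c1 ^ (n + 1) = μ * (D.c0 - star D.c0) ^ (n + 1) := by
    have := congrArg (PowerSeries.coeff 0) h
    simp only [PowerSeries.coeff_zero_eq_constantCoeff_apply, map_mul, map_pow, map_add] at this
    simp only [← PowerSeries.coeff_zero_eq_constantCoeff_apply] at this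
    rw [coeff_zero_chiShift, coeff_zero_chi_sub] at this
    simpa using this
  have e1 : D.c1 ^ n * PowerSeries.coeff 2 D.chi = μ * ((D.c0 - star D.c0) ^ n * D.c1) := by
    have := congrArg (PowerSeries.coeff 1) h
    have hz : PowerSeries.coeff 1 (D.chiShift ^ (n + 1) *
        (PowerSeries.C μ * PowerSeries.X ^ (n + 1))) = 0 := by
      rw [← mul_assoc, PowerSeries.coeff_mul_X_pow', if_neg (by omega)]
    rw [mul_add, mul_one, map_add, hz, add_zero, PowerSeries.coeff_C_mul, coeff_one_pow,
      coeff_one_pow, coeff_zero_chiShift, coeff_zero_chi_sub, coeff_one_chi_sub] at this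
    have hn' : ((n : ℂ) + 1) ≠ 0 := Nat.cast_add_one_ne_zero n
    have h2 : PowerSeries.coeff 1 D.chiShift = PowerSeries.coeff 2 D.chi := by simp [chiShift]
    rw [h2] at this
    refine mul_left_cancel₀ hn' ?_
    linear_combination this
  have hc : D.c1 ≠ 0 := by
    intro h0
    rw [h0, zero_pow (by omega)] at e0
    exact mul_ne_zero hμ (pow_ne_zero _ hd) e0.symm
  refine ⟨hc, mul_left_cancel₀ (pow_ne_zero n hc) ?_⟩
  linear_combination (D.c0 - star D.c0) * e1 - D.c1 * e0

/-- The second relation of `c1_relations` says exactly that the argument of the logarithm has no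
linear term. Otherwise the term $v\,h_{1,1}$ would make the first-order variation of a minor differ
from row to row. -/
theorem h1_one (hn : 1 ≤ n) : D.h1 1 = 0 := by
  obtain ⟨hc, h2⟩ := D.c1_relations hn
  have hd := D.c0_sub_star_ne
  set V := D.chi - PowerSeries.C (star D.c0) with hV
  have hV0 : PowerSeries.constantCoeff V ≠ 0 := by
    rw [← PowerSeries.coeff_zero_eq_constantCoeff_apply, coeff_zero_chi_sub]
    exact hd
  set u := PowerSeries.C ((D.c0 - star D.c0) / D.c1) * D.chiShift * V⁻¹ with hu
  have huV : u * V = PowerSeries.C ((D.c0 - star D.c0) / D.c1) * D.chiShift := by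
    rw [hu, mul_assoc, PowerSeries.inv_mul_cancel _ hV0, mul_one]
  have hu0 : PowerSeries.coeff 0 u = 1 := by
    have := congrArg (PowerSeries.coeff 0) huV
    simp only [PowerSeries.coeff_zero_eq_constantCoeff_apply, map_mul] at this
    simp only [← PowerSeries.coeff_zero_eq_constantCoeff_apply] at this
    rw [coeff_zero_chi_sub, coeff_zero_chiShift] at this
    rw [PowerSeries.coeff_zero_C, div_mul_cancel₀ _ hc] at this
    exact mul_right_cancel₀ hd (by rw [this, one_mul])
  have hu1 : PowerSeries.coeff 1 u = 0 := by
    have := congrArg (PowerSeries.coeff 1) huV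
    rw [PowerSeries.coeff_C_mul, PowerSeries.coeff_mul, Finset.Nat.antidiagonal_succ] at this
    simp only [Finset.Nat.antidiagonal_zero, Finset.map_singleton, Finset.sum_cons,
      Finset.sum_singleton, Function.Embedding.prodMap, Function.Embedding.coeFn_mk,
      Prod.map, Function.Embedding.refl_apply, Nat.succ_eq_add_one, zero_add] at this
    rw [hu0, coeff_zero_chi_sub, coeff_one_chi_sub] at this
    have h3 : PowerSeries.coeff 1 D.chiShift = PowerSeries.coeff 2 D.chi := by simp [chiShift]
    rw [h3, div_mul_eq_mul_div, mul_comm _ (PowerSeries.coeff 2 D.chi), h2, pow_two,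
      mul_div_cancel_left₀ _ hc] at this
    refine mul_right_cancel₀ hd ?_
    linear_combination this
  change PowerSeries.coeff 1 (PowerSeries.logOf u) = 0
  rw [coeff_one_logOf hu0, hu1]

theorem h2_one (k : Fin n) : D.h2 k 1 = D.c1 / (D.c0 + (waveNum n D.lam0 k : ℂ)) := by
  have hne := D.c0_add_waveNum_ne k
  unfold h2
  rw [coeff_one_logOf]
  · rw [PowerSeries.coeff_C_mul, map_add, PowerSeries.coeff_C]
    simp [c1, div_eq_inv_mul]
  · rw [PowerSeries.coeff_C_mul, map_add, D.chi_zero, PowerSeries.coeff_C, if_pos rfl]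
    exact inv_mul_cancel₀ hne

theorem coeff_one_lamSeries (hn : 1 ≤ n) : PowerSeries.coeff 1 (lamSeries n D.lam0 D.lam1) = 0 := by
  rw [lamSeries, map_add, PowerSeries.coeff_C, PowerSeries.coeff_C_mul, PowerSeries.coeff_X_pow]
  simp only [one_ne_zero, if_false, zero_add]
  rw [if_neg (by omega), mul_zero]

theorem alpha_one (hn : 1 ≤ n) : D.alpha 1 = Complex.I * D.c1 := by
  rw [alpha, PowerSeries.coeff_C_mul, map_sub, D.coeff_one_lamSeries hn, sub_zero, c1]

theorem beta_one (hn : 1 ≤ n) : D.beta 1 = D.c0 * D.c1 := by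
  rw [beta, map_sub, map_sub, PowerSeries.coeff_C_mul, coeff_one_pow, coeff_one_pow,
    D.coeff_one_lamSeries hn, PowerSeries.coeff_C, D.chi_zero]
  simp [c0, c1]
  ring

end SpectralData

/-! ### Column operations inside the blocks. -/

section Blocks

variable {n : ℕ} {N : Fin n → ℕ}

theorem degIdx_injective : Function.Injective (degIdx : BlockIdx N → ℕ) := by
  rintro ⟨l, i⟩ ⟨l', i'⟩ h
  have hl := l.isLt
  have hl' := l'.isLt
  unfold degIdx at h
  simp only at h
  have h1 : (i : ℕ) = i' := by
    rcases lt_trichotomy (i : ℕ) i' with h2 | h2 | h2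
    · have := Nat.mul_le_mul_left (n + 1) (Nat.succ_le_of_lt h2)
      rw [Nat.mul_succ] at this
      omega
    · exact h2
    · have := Nat.mul_le_mul_left (n + 1) (Nat.succ_le_of_lt h2)
      rw [Nat.mul_succ] at this
      omega
  have h2 : l = l' := Fin.ext (by rw [h1] at h; omega)
  subst h2
  rw [Fin.ext h1]

theorem exists_strictMono_equiv {ι : Type*} [Fintype ι] {T : ℕ} (hT : Fintype.card ι = T)
    {b : ι → ℕ} (hb : Function.Injective b) : ∃ e : Fin T ≃ ι, StrictMono fun i => b (e i) := by
  let e₀ : Fin T ≃ ι := (Fintype.equivFinOfCardEq hT).symm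
  refine ⟨(Tuple.sort (b ∘ e₀)).trans e₀, ?_⟩
  exact (Tuple.monotone_sort (b ∘ e₀)).strictMono_of_injective
    ((hb.comp e₀.injective).comp (Tuple.sort _).injective)

/-- The matrix of the column operations which multiply the columns of the block `l` by the series
`exp (∑ y_{l,j} ε^j)` in `ε^(n+1)`. -/
def blockShift (N : Fin n → ℕ) (y : Fin n → ℕ → ℂ) : Matrix (BlockIdx N) (BlockIdx N) ℂ :=
  Matrix.of fun p r =>
    if p.1 = r.1 ∧ degIdx p ≤ degIdx r then schur (y r.1) (degIdx r - degIdx p) else 0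

/-- When the pairs are sorted by degree, the matrix is upper triangular with unit diagonal. -/
theorem det_blockShift (y : Fin n → ℕ → ℂ) : (blockShift N y).det = 1 := by
  obtain ⟨e, he⟩ := exists_strictMono_equiv (ι := BlockIdx N) rfl degIdx_injective
  rw [← Matrix.det_submatrix_equiv_self e, Matrix.det_of_isUpperTriangular]
  · refine prod_eq_one fun i _ => ?_
    simp [blockShift, schur_zero]
  · intro i j hij
    have : degIdx (e j) < degIdx (e i) := he hij
    simp [blockShift, not_le.2 this]

/-- A series in $\varepsilon^{n+1}$ couples only degrees that are congruent modulo $n+1$. All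
smaller degrees in the class of a block occur in that block, so multiplication by the series is a
column operation within it. -/
theorem schurShift_block (u : ℕ → ℂ) {y : Fin n → ℕ → ℂ} (hy : ∀ l j, ¬ (n + 1) ∣ j → y l j = 0)
    (v : ℕ) (r : BlockIdx N) :
    schurShift (fun j => u j + y r.1 j) v (degIdx r) =
      ∑ p : BlockIdx N, schurShift u v (degIdx p) * blockShift N y p r := by
  rw [schurShift_add]
  symm
  have h1 : ∀ p : BlockIdx N, schurShift u v (degIdx p) * blockShift N y p r =
      if p.1 = r.1 ∧ degIdx p ≤ degIdx r then
        schurShift u v (degIdx p) * schur (y r.1) (degIdx r - degIdx p) else 0 := by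
    intro p
    rw [blockShift, Matrix.of_apply]
    split_ifs <;> simp
  rw [sum_congr rfl fun p _ => h1 p, ← sum_filter]
  refine sum_of_injOn degIdx (degIdx_injective.injOn) ?_ ?_ ?_
  · intro p hp
    have := (mem_filter.1 (mem_coe.1 hp)).2.2
    simp only [coe_range, Set.mem_Iio]
    omega
  · intro k hk hk'
    rw [schur_support (n + 1) _ (hy r.1), mul_zero]
    rintro ⟨c, hc⟩
    have hk := mem_range.1 hk
    apply hk'
    obtain ⟨l, i⟩ := r
    simp only [degIdx] at hc hk
    have hl := l.isLt
    have hi := i.isLt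
    -- Since $l+1\le n$ in the numbering from $0$, a larger $c$ would make the degree $k$ negative.
    have hci : c ≤ i := by
      by_contra hlt
      have := Nat.mul_le_mul_left (n + 1) (Nat.succ_le_of_lt (not_le.1 hlt))
      rw [Nat.mul_succ] at this
      omega
    have hsub : (n + 1) * ((i : ℕ) - c) + (n + 1) * c = (n + 1) * i := by
      rw [← mul_add, Nat.sub_add_cancel hci]
    refine ⟨⟨l, ⟨i - c, by omega⟩⟩, mem_coe.2 (mem_filter.2 ⟨mem_univ _, rfl, ?_⟩), ?_⟩
    · simp only [degIdx]
      omega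
    · simp only [degIdx]
      omega
  · intro p _
    rfl

theorem det_sum_block (L : ℕ) (w : ℕ → ℂ) (u u' : ℕ → ℕ → ℂ) {y : Fin n → ℕ → ℂ}
    (hy : ∀ l j, ¬ (n + 1) ∣ j → y l j = 0) :
    (Matrix.of fun p r : BlockIdx N => ∑ v ∈ range L, w v *
      star (schurShift (fun j => u v j + y p.1 j) v (degIdx p)) *
        schurShift (fun j => u' v j + y r.1 j) v (degIdx r)).det =
    (Matrix.of fun p r : BlockIdx N => ∑ v ∈ range L, w v *
      star (schurShift (u v) v (degIdx p)) * schurShift (u' v) v (degIdx r)).det := by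
  have h : (Matrix.of fun p r : BlockIdx N => ∑ v ∈ range L, w v *
      star (schurShift (fun j => u v j + y p.1 j) v (degIdx p)) *
        schurShift (fun j => u' v j + y r.1 j) v (degIdx r)) =
      (blockShift N y).conjTranspose * (Matrix.of fun p r : BlockIdx N => ∑ v ∈ range L, w v *
        star (schurShift (u v) v (degIdx p)) * schurShift (u' v) v (degIdx r)) *
          blockShift N y := by
    ext p r
    simp only [Matrix.of_apply, Matrix.mul_apply, Matrix.conjTranspose_apply]
    simp only [schurShift_block _ hy, star_sum, star_mul', mul_sum, sum_mul]
    rw [sum_comm]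
    refine sum_congr rfl fun q _ => ?_
    rw [sum_comm]
    refine sum_congr rfl fun q' _ => ?_
    refine sum_congr rfl fun v _ => ?_
    ring
  rw [h, Matrix.det_mul, Matrix.det_mul, Matrix.det_conjTranspose, det_blockShift]
  simp

theorem det_block (f : BlockIdx N → ℕ) (u : ℕ → ℂ) {y : Fin n → ℕ → ℂ}
    (hy : ∀ l j, ¬ (n + 1) ∣ j → y l j = 0) :
    (Matrix.of fun p r : BlockIdx N => schurShift (fun j => u j + y r.1 j) (f p) (degIdx r)).det =
      (Matrix.of fun p r : BlockIdx N => schurShift u (f p) (degIdx r)).det := by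
  have h : (Matrix.of fun p r : BlockIdx N =>
      schurShift (fun j => u j + y r.1 j) (f p) (degIdx r)) =
      (Matrix.of fun p r : BlockIdx N => schurShift u (f p) (degIdx r)) * blockShift N y := by
    ext p r
    simp only [Matrix.of_apply, Matrix.mul_apply]
    exact schurShift_block u hy _ _
  rw [h, Matrix.det_mul, det_blockShift, mul_one]

theorem card_blockIdx : Fintype.card (BlockIdx N) = ∑ l, N l := by
  simp [BlockIdx]

end Blocks

/-! ### The determinants of the wave matrices as sums over minors. -/

namespace SpectralData

variable {n : ℕ} (D : SpectralData n)

theorem C1_ne (hn : 1 ≤ n) : 0 < D.C1 :=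
  div_pos (pow_pos (norm_pos_iff.2 (D.c1_relations hn).1) 2)
    (pow_pos (norm_pos_iff.2 D.c0_sub_star_ne) 2)

/-- Cauchy–Binet needs one range of $v$ for all entries; the added terms vanish because the shift
exceeds a degree. -/
theorem tau_eq (d : Fin n → ℕ → ℂ) (g : ℕ → ℂ) (x t : ℝ) (l₁ l₂ : Fin n) (i j L : ℕ)
    (hi : i < L) : D.tau d g x t l₁ l₂ i j = ∑ v ∈ range L, (D.C1 : ℂ) ^ v *
      star (schurShift (fun m => D.xPlus d x t l₁ m + (v : ℂ) * D.h1 m + g m) v i) *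
        schurShift (fun m => D.xPlus d x t l₂ m + (v : ℂ) * D.h1 m - g m) v j := by
  unfold tau
  symm
  rw [← sum_subset (range_subset_range.2 (show min i j + 1 ≤ L by omega))]
  · refine sum_congr rfl fun v hv => ?_
    have := mem_range.1 hv
    rw [schurShift, if_pos (by omega), schurShift, if_pos (by omega)]
    congr 2
    have := map_schur (starRingEnd ℂ) (fun m => D.xPlus d x t l₁ m + (v : ℂ) * D.h1 m + g m) (i - v)
    rw [starRingEnd_apply] at this
    rw [this]
    congr 1
    ext m
    simp [xMinus]
  · intro v _ hv
    have : i < v ∨ j < v := by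
      have := mem_range.not.1 hv
      omega
    rcases this with h | h
    · rw [schurShift_of_lt _ h]; simp
    · rw [schurShift_of_lt _ h]; simp

/-- The sequence `α_j ξ + i β_j η + v h_{1,j} + g_j`. -/
def rowSeq (ξ η : ℝ) (v : ℕ) (g : ℕ → ℂ) (j : ℕ) : ℂ :=
  D.alpha j * ξ + Complex.I * D.beta j * η + (v : ℂ) * D.h1 j + g j

/-- The minor, with rows `f`, of the matrix with columns `J` and the generating functions
`ε^v exp (∑ (α_j ξ + i β_j η + v h_{1,j} + g_j) ε^j) / (1 - a ε)`. -/
def minorDet {T : ℕ} (J : Fin T → ℕ) (a : ℂ) (g : ℕ → ℂ) (f : Fin T → ℕ) (ξ η : ℝ) : ℂ :=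
  (Matrix.of fun i r => schurShift (fun j => D.rowSeq ξ η (f i) g j + a ^ j / (j : ℂ))
    (f i) (J r)).det

/-- The complex coordinate `i χ^{[1]} (ξ + χ₀ η)`. -/
def coord (ξ η : ℝ) : ℂ := Complex.I * D.c1 * ((ξ : ℂ) + D.c0 * η)

theorem coord_point (hn : 1 ≤ n) (w : ℂ) : D.coord (D.point w).1 (D.point w).2 = w :=
  (D.point_iff (D.c1_relations hn).1 w _ _).2 rfl

theorem alpha_one_add (hn : 1 ≤ n) (ξ η : ℝ) :
    D.alpha 1 * ξ + Complex.I * D.beta 1 * η = D.coord ξ η := by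
  rw [D.alpha_one hn, D.beta_one hn, coord]
  ring

/-- In the displacement from $(x_0,t_0)$ all blocks have the same generating function, with the
factor $1/(1-z_0A\varepsilon)$, up to series in $\varepsilon^{n+1}$. Removing these by
`det_sum_block` leaves a matrix to which Cauchy–Binet applies. -/
theorem det_rwMatrix_largeParam (hn : 1 ≤ n) {m : ℕ} {N : Fin n → ℕ}
    (e : Fin (m + 1) ≃ BlockIdx N) {L : ℕ} (hL : ∀ i, degIdx (e i) < L)
    (kap : Fin n → ℕ → ℂ) (kap11 z₀ w : ℂ) (hkap1 : ∀ l, kap l 1 = kap11)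
    (hkap : ∀ l i, 1 < i → ¬ (n + 1) ∣ i → kap l i = z₀ ^ i / (i : ℂ)) (hw : w = z₀ - kap11)
    (A : ℝ) (g : ℕ → ℂ) (x t : ℝ) :
    (D.rwMatrix N (D.largeParam kap w A) g x t).det =
      ∑ f ∈ strictMonoFns (m + 1) L, (D.C1 : ℂ) ^ (∑ i, f i) *
        star (D.minorDet (fun i => degIdx (e i)) (z₀ * A) g f (x - (D.multCenter w A).1)
          (t - (D.multCenter w A).2)) *
        D.minorDet (fun i => degIdx (e i)) (z₀ * A) (-g) f (x - (D.multCenter w A).1)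
          (t - (D.multCenter w A).2) := by
  set ξ := x - (D.multCenter w A).1 with hξ
  set η := t - (D.multCenter w A).2 with hη
  set d := D.largeParam kap w A with hd
  -- The whole discrepancy at exponents divisible by $n+1$, including the missing terms of the
  -- geometric factor.
  set y : Fin n → ℕ → ℂ := fun l j => if (n + 1) ∣ j then D.xPlus d x t l j -
    (D.alpha j * ξ + Complex.I * D.beta j * η + (z₀ * A) ^ j / (j : ℂ)) else 0 with hy
  have hx : ∀ l j, D.xPlus d x t l j =
      D.alpha j * ξ + Complex.I * D.beta j * η + (z₀ * A) ^ j / (j : ℂ) + y l j := by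
    intro l j
    by_cases hj : (n + 1) ∣ j
    · simp only [hy, if_pos hj]
      ring
    · simp only [hy, if_neg hj, xPlus, hd, largeParam]
      by_cases h1 : j = 1
      · subst h1
        -- For $j=1$ moving the origin contributes $wA$, and $w+\kappa_{1,1}=z_0$ completes the
        -- geometric factor; for $j>1$ the term $\hat\kappa_j$ undoes the move.
        have hc := D.coord_point hn (w * A)
        rw [← D.alpha_one_add hn] at hc
        rw [if_pos rfl, hkap1, hξ, hη, multCenter]
        push_cast
        rw [hw] at hc ⊢
        linear_combination hc
      · have hj0 : j ≠ 0 := fun h => hj (h ▸ dvd_zero _)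
        rw [if_neg h1, hkap l j (by omega) hj, kapHat, hξ, hη]
        push_cast
        ring
  have hy0 : ∀ l j, ¬ (n + 1) ∣ j → y l j = 0 := fun l j hj => by simp only [hy, if_neg hj]
  have hM : D.rwMatrix N d g x t = Matrix.of fun p r : BlockIdx N => ∑ v ∈ range L,
      (D.C1 : ℂ) ^ v *
      star (schurShift (fun j => (D.rowSeq ξ η v g j + (z₀ * A) ^ j / (j : ℂ)) + y p.1 j) v
        (degIdx p)) *
      schurShift (fun j => (D.rowSeq ξ η v (-g) j + (z₀ * A) ^ j / (j : ℂ)) + y r.1 j) v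
        (degIdx r) := by
    ext p r
    have hp := hL (e.symm p)
    rw [Equiv.apply_symm_apply] at hp
    rw [rwMatrix, Matrix.of_apply, Matrix.of_apply, D.tau_eq _ _ _ _ _ _ _ _ L hp]
    refine sum_congr rfl fun v _ => ?_
    have h1 : (fun m => D.xPlus d x t p.1 m + (v : ℂ) * D.h1 m + g m) =
        fun j => (D.rowSeq ξ η v g j + (z₀ * A) ^ j / (j : ℂ)) + y p.1 j := by
      ext j
      rw [hx, rowSeq]
      ring
    have h2 : (fun m => D.xPlus d x t r.1 m + (v : ℂ) * D.h1 m - g m) =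
        fun j => (D.rowSeq ξ η v (-g) j + (z₀ * A) ^ j / (j : ℂ)) + y r.1 j := by
      ext j
      rw [hx, rowSeq, Pi.neg_apply]
      ring
    rw [h1, h2]
  rw [hM, det_sum_block L _ _ _ hy0, ← Matrix.det_submatrix_equiv_self e]
  have h3 := det_sum_mul_mul L (fun v => (D.C1 : ℂ) ^ v)
    (fun v (p : Fin (m + 1)) => star (schurShift (fun j => D.rowSeq ξ η v g j +
      (z₀ * A) ^ j / (j : ℂ)) v (degIdx (e p))))
    (fun v (r : Fin (m + 1)) => schurShift (fun j => D.rowSeq ξ η v (-g) j +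
      (z₀ * A) ^ j / (j : ℂ)) v (degIdx (e r)))
  refine Eq.trans h3 (sum_congr rfl fun f _ => ?_)
  rw [prod_pow_eq_pow_sum]
  congr 2
  have := RingHom.map_det (starRingEnd ℂ) (Matrix.of fun (i r : Fin (m + 1)) =>
    schurShift (fun j => D.rowSeq ξ η (f i) g j + (z₀ * A) ^ j / (j : ℂ)) (f i) (degIdx (e r)))
  rw [starRingEnd_apply] at this
  exact this.symm

/-- Parameters equal to $h_{1,j}$ turn $v\,h_{1,j}$ into $(v+1)h_{1,j}$, the form in which the
lower-order matrix arises in the limit. -/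
theorem det_rwMatrix_h1 {m : ℕ} {N : Fin n → ℕ} (e : Fin m ≃ BlockIdx N) {L : ℕ}
    (hL : ∀ i, degIdx (e i) < L) (g : ℕ → ℂ) (x t : ℝ) :
    (D.rwMatrix N (fun _ => D.h1) g x t).det =
      (Matrix.of fun p r : Fin m => ∑ v ∈ range L, (D.C1 : ℂ) ^ v *
        star (schurShift (D.rowSeq x t (v + 1) g) v (degIdx (e p))) *
        schurShift (D.rowSeq x t (v + 1) (-g)) v (degIdx (e r))).det := by
  rw [← Matrix.det_submatrix_equiv_self e]
  congr 1
  ext p r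
  rw [Matrix.submatrix_apply, rwMatrix, Matrix.of_apply, Matrix.of_apply,
    D.tau_eq _ _ _ _ _ _ _ _ L (hL p)]
  refine sum_congr rfl fun v _ => ?_
  congr 3
  · congr 1
    ext j
    rw [rowSeq, xPlus]
    push_cast
    ring
  · ext j
    rw [rowSeq, xPlus, Pi.neg_apply]
    push_cast
    ring

end SpectralData

/-! ### The number $\Gamma$ and the lowered order. -/

section Degrees

variable {n : ℕ}

theorem sum_range_cast (k : ℕ) : ∑ i ∈ range k, (i : ℚ) = k * (k - 1) / 2 := by
  induction k with
  | zero => simp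
  | succ k ih =>
    rw [sum_range_succ, ih]
    push_cast
    ring

theorem sq_sum_eq (a : Fin n → ℚ) :
    (∑ l, a l) ^ 2 = ∑ l, a l ^ 2 + 2 * ∑ l, ∑ k ∈ Ioi l, a l * a k := by
  have hcomm : ∑ l, ∑ k ∈ Iio l, a l * a k = ∑ l, ∑ k ∈ Ioi l, a l * a k := by
    rw [sum_comm' (t' := univ) (s' := fun k => Ioi k) (by simp)]
    exact sum_congr rfl fun l _ => sum_congr rfl fun k _ => mul_comm _ _
  have hsplit : ∀ l, ∑ k, a l * a k = a l ^ 2 + ∑ k ∈ Iio l, a l * a k +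
      ∑ k ∈ Ioi l, a l * a k := by
    intro l
    have h1 : (univ : Finset (Fin n)) = Iic l ∪ Ioi l := by
      ext k; simp [le_or_gt]
    have h2 : Disjoint (Iic l) (Ioi l) := by
      rw [disjoint_left]; intro k hk hk'
      exact absurd (mem_Ioi.1 hk') (not_lt.2 (mem_Iic.1 hk))
    rw [h1, sum_union h2, ← Iio_insert, sum_insert (by simp), pow_two]
  rw [pow_two, sum_mul_sum, sum_congr rfl fun l _ => hsplit l, sum_add_distrib, sum_add_distrib,
    hcomm]
  ring

/-- This exhibits $\Gamma$ as the expected degree of the Wronskian, the sum of the degrees minus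
$0+1+\dots+(N-1)$. The mixed products come from expanding $(\sum_l N_l)^2$. -/
theorem gammaDeg_eq (N : Fin n → ℕ) :
    gammaDeg N = ∑ p : BlockIdx N, (degIdx p : ℚ) - ∑ i ∈ range (∑ l, N l), (i : ℚ) := by
  have h1 : ∑ p : BlockIdx N, (degIdx p : ℚ) =
      ∑ l, (((n : ℚ) + 1) * (N l * (N l - 1) / 2) + N l * ((l : ℚ) + 1)) := by
    rw [Fintype.sum_sigma]
    refine sum_congr rfl fun l _ => ?_
    have : ∀ i : Fin (N l), ((degIdx (⟨l, i⟩ : BlockIdx N) : ℕ) : ℚ) =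
        ((n : ℚ) + 1) * (i : ℕ) + ((l : ℚ) + 1) := by
      intro i
      simp [degIdx]
    rw [sum_congr rfl fun i _ => this i, sum_add_distrib, ← mul_sum,
      Fin.sum_univ_eq_sum_range (fun i => (i : ℚ)), sum_range_cast]
    simp
    ring
  have h2 := sq_sum_eq fun l => (N l : ℚ)
  rw [h1, sum_range_cast, gammaDeg]
  push_cast
  have h3 : ∀ l : Fin n, (N l : ℚ) / 2 * ((n : ℚ) * ((N l : ℚ) - 1) + 2 * ((l : ℚ) + 1)) =
      (((n : ℚ) + 1) * (N l * (N l - 1) / 2) + N l * ((l : ℚ) + 1)) -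
        ((N l : ℚ) ^ 2 - N l) / 2 := by
    intro l; ring
  rw [sum_congr rfl fun l _ => h3 l, sum_sub_distrib, ← sum_div, sum_sub_distrib]
  linear_combination (1 / 2 : ℚ) * h2

theorem exists_lowerVec_eq {N : Fin n → ℕ} (hN : Antitone N) (hpos : 0 < ∑ l, N l) :
    ∃ l₀ : Fin n, 0 < N l₀ ∧ (∀ l, N l ≤ N l₀) ∧ (∀ l, N l = N l₀ → l ≤ l₀) ∧
      ∀ l, lowerVec N l = if l = l₀ then N l₀ - 1 else N l := by
  obtain ⟨l₁, -, hl₁⟩ : ∃ l ∈ (univ : Finset (Fin n)), 0 < N l :=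
    exists_lt_of_sum_lt (by simpa using hpos)
  obtain ⟨l₂, -, hmax⟩ := exists_max_image (univ : Finset (Fin n)) N ⟨l₁, mem_univ _⟩
  have hS : (univ.filter fun l => N l = N l₂).Nonempty := ⟨l₂, by simp⟩
  set l₀ := (univ.filter fun l => N l = N l₂).max' hS with hl₀
  have hN₀ : N l₀ = N l₂ := (mem_filter.1 (max'_mem _ hS)).2
  have hle : ∀ l, N l = N l₀ → l ≤ l₀ := fun l hl =>
    le_max' _ _ (mem_filter.2 ⟨mem_univ _, by rw [hl, hN₀]⟩)
  have hmax' : ∀ l, N l ≤ N l₀ := fun l => hN₀ ▸ hmax l (mem_univ l)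
  refine ⟨l₀, lt_of_lt_of_le hl₁ (hmax' l₁), hmax', hle, fun l => ?_⟩
  unfold lowerVec
  by_cases hl : l = l₀
  · subst hl
    rw [if_pos rfl, if_pos]
    refine ⟨fun k hk => le_antisymm (hmax' k) (hN hk), fun k hk => ?_⟩
    exact lt_of_le_of_ne (hmax' k) fun h => absurd (hle k h) (not_le.2 hk)
  · rw [if_neg hl, if_neg]
    rintro ⟨h1, h2⟩
    rcases lt_or_gt_of_ne hl with h | h
    · exact absurd (h2 l₀ h) (not_lt.2 (hmax' l))
    · exact absurd (hle l (h1 l₀ h.le).symm) (not_le.2 h)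

theorem sum_lowerVec {N : Fin n → ℕ} (hN : Antitone N) (hpos : 0 < ∑ l, N l) :
    ∑ l, lowerVec N l + 1 = ∑ l, N l := by
  obtain ⟨l₀, h0, -, -, h⟩ := exists_lowerVec_eq hN hpos
  rw [sum_congr rfl fun l _ => h l, ← add_sum_erase univ _ (mem_univ l₀),
    ← add_sum_erase univ N (mem_univ l₀), if_pos rfl]
  have : ∑ x ∈ univ.erase l₀, (if x = l₀ then N l₀ - 1 else N x) = ∑ x ∈ univ.erase l₀, N x :=
    sum_congr rfl fun x hx => if_neg (ne_of_mem_erase hx)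
  rw [this]
  omega

/-- The largest degree belongs to the last row of the last among the longest blocks, precisely the
pair that the lowering deletes. Two increasing enumerations with the same range agree. -/
theorem degIdx_lowerVec {N : Fin n → ℕ} (hN : Antitone N) (hpos : 0 < ∑ l, N l) {m : ℕ}
    {e : Fin (m + 1) ≃ BlockIdx N} (he : StrictMono fun i => degIdx (e i))
    {e' : Fin m ≃ BlockIdx (lowerVec N)} (he' : StrictMono fun i => degIdx (e' i)) (r : Fin m) :
    degIdx (e' r) = degIdx (e r.castSucc) := by
  obtain ⟨l₀, h0, hmax, hlast, h⟩ := exists_lowerVec_eq hN hpos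
  set p₀ : BlockIdx N := ⟨l₀, ⟨N l₀ - 1, by omega⟩⟩ with hp₀
  have htop : ∀ p : BlockIdx N, degIdx p ≤ degIdx p₀ := by
    rintro ⟨l, i⟩
    have hi := i.isLt
    have hl := l.isLt
    have hNl := hmax l
    have hd : degIdx p₀ = (n + 1) * (N l₀ - 1) + ((l₀ : ℕ) + 1) := rfl
    rw [hd]
    simp only [degIdx]
    rcases eq_or_lt_of_le (show (i : ℕ) ≤ N l₀ - 1 by omega) with h1 | h1
    · have : l ≤ l₀ := hlast l (by omega)
      have : (l : ℕ) ≤ l₀ := this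
      rw [h1]
      omega
    · have := Nat.mul_le_mul_left (n + 1) (Nat.succ_le_of_lt h1)
      rw [Nat.mul_succ] at this
      omega
  have hlast' : e (Fin.last m) = p₀ := by
    apply degIdx_injective
    refine le_antisymm (htop _) ?_
    have := he.monotone (Fin.le_last (e.symm p₀))
    simpa using this
  have hmono : StrictMono fun r : Fin m => degIdx (e r.castSucc) :=
    he.comp (Fin.strictMono_castSucc)
  have hrange : Set.range (fun i => degIdx (e' i)) =
      Set.range fun r : Fin m => degIdx (e r.castSucc) := by
    ext d
    constructor
    · rintro ⟨i, rfl⟩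
      rcases hp : e' i with ⟨l, j⟩
      have hj := j.isLt
      have hjN : (j : ℕ) < N l := by
        have hj := hj.trans_eq (h l)
        split_ifs at hj with hl
        · subst hl; omega
        · exact hj
      set q : BlockIdx N := ⟨l, ⟨j, hjN⟩⟩ with hq
      have hqp : q ≠ p₀ := by
        intro hqp
        rw [hq, hp₀, Sigma.mk.injEq] at hqp
        obtain ⟨hl, hj'⟩ := hqp
        subst hl
        have := congrArg Fin.val (eq_of_heq hj')
        have hj := hj.trans_eq (h l)
        rw [if_pos rfl] at hj
        simp at this
        omega
      have hne : e.symm q ≠ Fin.last m := by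
        intro h'
        apply hqp
        rw [← hlast', ← h', Equiv.apply_symm_apply]
      refine ⟨(e.symm q).castPred hne, ?_⟩
      simp only [Fin.castSucc_castPred, Equiv.apply_symm_apply]
      rw [hp]
      rfl
    · rintro ⟨r, rfl⟩
      rcases hp : e r.castSucc with ⟨l, j⟩
      have hj := j.isLt
      have hjl : (j : ℕ) < lowerVec N l := by
        rw [h]
        split_ifs with hl
        · subst hl
          have : (j : ℕ) ≠ N l - 1 := by
            intro h'
            have : e r.castSucc = e (Fin.last m) := by
              rw [hp, hlast', hp₀]
              congr
              exact Fin.ext h'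
            exact (Fin.castSucc_lt_last r).ne (e.injective this)
          omega
        · exact hj
      refine ⟨e'.symm ⟨l, ⟨j, hjl⟩⟩, ?_⟩
      simp only [Equiv.apply_symm_apply]
      rw [hp]
      rfl
  exact congrFun ((he'.range_inj hmono).1 hrange) r

end Degrees

/-! ### From the Wronskian to determinants in sorted columns. -/

section Reindex

theorem exists_det_submatrix_eq {ι κ : Type*} [Fintype ι] [DecidableEq ι] [Fintype κ]
    [DecidableEq κ] (e₁ e₂ : κ ≃ ι) : ∃ s : ℂ, s ≠ 0 ∧ ∀ A : Matrix ι ι (Polynomial ℂ),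
      A.det = Polynomial.C s * (A.submatrix e₁ e₂).det := by
  set σ : Equiv.Perm ι := e₁.symm.trans e₂ with hσ
  refine ⟨((Equiv.Perm.sign σ : ℤ) : ℂ), ?_, fun A => ?_⟩
  · rcases Int.units_eq_one_or (Equiv.Perm.sign σ) with h | h <;> simp [h]
  · have h1 : A.submatrix e₁ e₂ = (A.submatrix id σ).submatrix e₁ e₁ := by
      ext i j
      simp [hσ]
    rw [h1, Matrix.det_submatrix_equiv_self, Matrix.det_permute']
    rcases Int.units_eq_one_or (Equiv.Perm.sign σ) with h | h <;> simp [h]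

/-- The determinant, with rows `f`, of the coefficients of `ε^i exp (y ε) / (1 - a ε)`. -/
def colDet {T : ℕ} (J : Fin T → ℕ) (a : ℂ) (f : Fin T → ℕ) (y : ℂ) : ℂ :=
  (Matrix.of fun i r => schurShift (fun j => (if j = 1 then y else 0) + a ^ j / (j : ℂ))
    (f i) (J r)).det

variable {n m : ℕ} {N : Fin n → ℕ}

/-- The exponents divisible by $n+1$, absent from $\varphi$, are inserted by block column operations
so as to complete the geometric factor. The sign $s$ depends only on the reordering, so $W$, $W'$
and $W^{[2]}$ share it and their quotients are unaffected. -/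
theorem exists_eval_det_phiSub (hm : ∑ l, N l = m + 1)
    (e : Fin (m + 1) ≃ BlockIdx N) (kap : Fin n → ℕ → ℂ) (kap11 z₀ w : ℂ)
    (hkap1 : ∀ l, kap l 1 = kap11)
    (hkap : ∀ l i, 1 < i → ¬ (n + 1) ∣ i → kap l i = z₀ ^ i / (i : ℂ)) (hw : w = z₀ - kap11) :
    ∃ s : ℂ, s ≠ 0 ∧ ∀ (ρ : ℕ → ℕ) (z : ℂ),
      ((Matrix.of fun p r : BlockIdx N => phiSub kap r.1 (degIdx r) (ρ (posIdx p))).det).eval z =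
        s * colDet (fun i => degIdx (e i)) z₀ (fun i => ρ i) (z - w) := by
  set e₁ : Fin (m + 1) ≃ BlockIdx N := (finCongr hm.symm).trans finSigmaFinEquiv.symm with he₁
  have hpos : ∀ i, posIdx (e₁ i) = i := fun i => by simp [posIdx, he₁]
  obtain ⟨s, hs, h⟩ := exists_det_submatrix_eq e₁ e
  refine ⟨s, hs, fun ρ z => ?_⟩
  set u : ℕ → ℂ := fun j => (if j = 1 then z - w else 0) + z₀ ^ j / (j : ℂ) with hu
  set y : Fin n → ℕ → ℂ := fun _ j => if (n + 1) ∣ j then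
    (if j = 1 then z else 0) - u j else 0 with hy
  have hy0 : ∀ l j, ¬ (n + 1) ∣ j → y l j = 0 := fun l j hj => by simp only [hy, if_neg hj]
  have huy : ∀ (l : Fin n) (j : ℕ), ((if j = 1 then z else 0) +
      if (n + 1) ∣ j then 0 else kap l j) = u j + y l j := by
    intro l j
    by_cases hj : (n + 1) ∣ j
    · simp only [hy, if_pos hj]
      ring
    · simp only [hy, if_neg hj, hu]
      by_cases h1 : j = 1
      · subst h1
        rw [hkap1, hw]
        simp
        ring
      · have hj0 : j ≠ 0 := fun h => hj (h ▸ dvd_zero _)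
        rw [hkap l j (by omega) hj]
        simp [h1]
  have hmap : ∀ B : Matrix (BlockIdx N) (BlockIdx N) (Polynomial ℂ), B.det.eval z =
      (B.map (Polynomial.eval z)).det := by
    intro B
    have := RingHom.map_det (Polynomial.evalRingHom z) B
    rw [Polynomial.coe_evalRingHom] at this
    exact this
  have hmap' : ∀ B : Matrix (Fin (m + 1)) (Fin (m + 1)) (Polynomial ℂ), B.det.eval z =
      (B.map (Polynomial.eval z)).det := by
    intro B
    have := RingHom.map_det (Polynomial.evalRingHom z) B
    rw [Polynomial.coe_evalRingHom] at this
    exact this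
  set B : Matrix (BlockIdx N) (BlockIdx N) (Polynomial ℂ) :=
    Matrix.of fun p r => Polynomial.C (schurShift u (ρ (posIdx p)) (degIdx r)) with hB
  have h1 : ((Matrix.of fun p r : BlockIdx N =>
      phiSub kap r.1 (degIdx r) (ρ (posIdx p))).det).eval z = B.det.eval z := by
    rw [hmap, hmap]
    have hl : (Matrix.of fun p r : BlockIdx N =>
        phiSub kap r.1 (degIdx r) (ρ (posIdx p))).map (Polynomial.eval z) =
        Matrix.of fun p r : BlockIdx N =>
          schurShift (fun j => u j + y r.1 j) (ρ (posIdx p)) (degIdx r) := by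
      ext p r
      simp only [Matrix.map_apply, Matrix.of_apply]
      rw [eval_phiSub]
      congr 1
      ext j
      exact huy _ _
    rw [hl, det_block _ _ hy0]
    congr 1
    ext p r
    simp [hB]
  rw [h1, h B, Polynomial.eval_mul, Polynomial.eval_C, hmap', colDet]
  congr 2
  ext i r
  simp [hB, hpos, hu]

end Reindex

/-! ### Multiplicity of the special root and degree. -/

section RootStructure

open Polynomial

variable {m : ℕ}

theorem rootMultiplicity_of_X_pow_mul {q H : ℂ[X]} {a b : ℕ} (h : X ^ a * q = X ^ b * H)
    (hH : H.eval 0 ≠ 0) : q ≠ 0 ∧ a + q.rootMultiplicity 0 = b := by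
  have hH0 : H ≠ 0 := fun h => hH (by simp [h])
  have hR : X ^ b * H ≠ 0 := mul_ne_zero (pow_ne_zero _ X_ne_zero) hH0
  have hq : q ≠ 0 := by
    rintro rfl
    exact hR (by rw [← h, mul_zero])
  refine ⟨hq, ?_⟩
  have hX : ∀ k : ℕ, (X ^ k : ℂ[X]).rootMultiplicity 0 = k := by
    intro k
    have := rootMultiplicity_X_sub_C_pow (0 : ℂ) k
    simpa using this
  have h2 := congrArg (rootMultiplicity 0) h
  rw [rootMultiplicity_mul (h ▸ hR), rootMultiplicity_mul hR, hX, hX,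
    rootMultiplicity_eq_zero (p := H) (x := 0) hH, add_zero] at h2
  exact h2

/-- $G$ is the reversed polynomial up to a power of $X$, and neither of them vanishes at $0$. -/
theorem natDegree_of_eval_inv {q G : ℂ[X]} {d : ℕ}
    (h : ∀ u : ℂ, u ≠ 0 → u ^ d * q.eval u⁻¹ = G.eval u) (hG : G.eval 0 ≠ 0) :
    q.natDegree = d := by
  have h1 : X ^ d * q.reverse = X ^ q.natDegree * G := by
    refine eq_of_infinite_eval_eq _ _ (Set.Infinite.mono (s := {u : ℂ | u ≠ 0}) ?_ ?_)
    · intro u hu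
      have hu : u ≠ 0 := hu
      have := invertibleOfNonzero (inv_ne_zero hu)
      have h2 := eval₂_reverse_mul_pow (RingHom.id ℂ) u⁻¹ q
      rw [invOf_eq_inv, inv_inv, inv_pow] at h2
      change eval u (X ^ d * q.reverse) = eval u (X ^ q.natDegree * G)
      have h3 : eval u q.reverse * (u ^ q.natDegree)⁻¹ = eval u⁻¹ q := h2
      rw [eval_mul, eval_mul, eval_pow, eval_pow, eval_X, ← h u hu, ← h3]
      have := pow_ne_zero q.natDegree hu
      field_simp
    · exact (Set.finite_singleton (0 : ℂ)).infinite_compl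
  have hGne : G ≠ 0 := fun h => hG (by simp [h])
  have hrev : q.reverse ≠ 0 := (rootMultiplicity_of_X_pow_mul h1 hG).1
  have hq : q ≠ 0 := fun h => hrev (by simp [h])
  have hrev0 : q.reverse.eval 0 ≠ 0 := by
    rw [← coeff_zero_eq_eval_zero, coeff_zero_reverse]
    exact leadingCoeff_ne_zero.2 hq
  have h2 := (rootMultiplicity_of_X_pow_mul h1 hG).2
  rw [rootMultiplicity_eq_zero hrev0, add_zero] at h2
  exact h2.symm

theorem colDet_eq (J : Fin (m + 1) → ℕ) (a y : ℂ) (f : Fin (m + 1) → ℕ) :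
    colDet J a f y = (Matrix.of fun i r => ∑ k ∈ range (J r + 1), a ^ (J r - k) *
      (if f i ≤ k then y ^ (k - f i) / ((k - f i).factorial : ℂ) else 0)).det := by
  unfold colDet
  congr 1
  ext i r
  rw [Matrix.of_apply, Matrix.of_apply, schurShift_add_geometric]
  refine sum_congr rfl fun k _ => ?_
  rw [schurShift]
  simp only [schur_single]

/-- `y^(∑ i) det = y^(∑ lo) H(y)` with `H(0) ≠ 0`. -/
theorem exists_low_factor {J : Fin (m + 1) → ℕ} (hJ : StrictMono J) {a : ℂ} (ha : a ≠ 0) :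
    ∃ H : ℂ[X], H.eval 0 ≠ 0 ∧ ∀ y : ℂ,
      y ^ (∑ i : Fin (m + 1), (i : ℕ)) * colDet J a (fun i => i) y =
        y ^ (∑ r, lowIdx J r) * H.eval y := by
  set Hm : Matrix (Fin (m + 1)) (Fin (m + 1)) ℂ[X] := Matrix.of fun i r =>
    ∑ k ∈ Icc (lowIdx J r) (J r), C (a ^ (J r - k) *
      (if (i : ℕ) ≤ k then (((k - i).factorial : ℕ) : ℂ)⁻¹ else 0)) * X ^ (k - lowIdx J r) with hHm
  have heval : ∀ y, Hm.det.eval y = (Matrix.of fun (i r : Fin (m + 1)) =>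
      ∑ k ∈ Icc (lowIdx J r) (J r), a ^ (J r - k) *
      (if (i : ℕ) ≤ k then (((k - i).factorial : ℕ) : ℂ)⁻¹ else 0) * y ^ (k - lowIdx J r)).det := by
    intro y
    have := RingHom.map_det (Polynomial.evalRingHom y) Hm
    rw [Polynomial.coe_evalRingHom] at this
    rw [this]
    congr 1
    ext i r
    simp only [RingHom.mapMatrix_apply, Matrix.map_apply, hHm, Matrix.of_apply, map_sum]
    refine sum_congr rfl fun k _ => ?_
    rw [coe_evalRingHom, eval_mul, eval_C, eval_pow, eval_X]
  refine ⟨Hm.det, ?_, fun y => ?_⟩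
  · rw [heval]
    -- At $y=0$ only $k=\mathrm{lo}_r$ is left; this is where $a\ne0$ enters.
    have h1 : (Matrix.of fun (i r : Fin (m + 1)) =>
        ∑ k ∈ Icc (lowIdx J r) (J r), a ^ (J r - k) *
        (if (i : ℕ) ≤ k then (((k - i).factorial : ℕ) : ℂ)⁻¹ else 0) *
          (0 : ℂ) ^ (k - lowIdx J r)) = Matrix.of fun (i r : Fin (m + 1)) =>
        a ^ (J r - lowIdx J r) * (Matrix.of fun (i r : Fin (m + 1)) =>
          if (i : ℕ) ≤ lowIdx J r then (((lowIdx J r - i).factorial : ℕ) : ℂ)⁻¹ else 0) i r := by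
      ext i r
      simp only [Matrix.of_apply]
      rw [sum_eq_single (lowIdx J r)]
      · simp
      · intro k hk hne
        have := (mem_Icc.1 hk).1
        rw [zero_pow (by omega), mul_zero]
      · intro h
        exact absurd (mem_Icc.2 ⟨le_rfl, lowIdx_le hJ r⟩) h
    rw [h1, Matrix.det_mul_row]
    exact mul_ne_zero (prod_ne_zero_iff.2 fun r _ => pow_ne_zero _ ha)
      (det_inv_factorial_ne_zero (strictMono_lowIdx hJ).injective)
  -- Row $i$ multiplied by $y^i$ turns $y^{k-i}$ into $y^k$, and column $r$ then releases
  -- $y^{\mathrm{lo}_r}$.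
  · rw [colDet_eq, det_geometric_reduce _ hJ, heval, ← prod_pow_eq_pow_sum, ← prod_pow_eq_pow_sum,
      ← Matrix.det_mul_column, ← Matrix.det_mul_row]
    congr 1
    ext i r
    simp only [Matrix.of_apply, mul_sum]
    refine sum_congr rfl fun k hk => ?_
    have hk := mem_Icc.1 hk
    split_ifs with hik
    · have h1 : y ^ k = y ^ (i : ℕ) * y ^ (k - i) := by rw [← pow_add]; congr 1; omega
      have h2 : y ^ k = y ^ (lowIdx J r) * y ^ (k - lowIdx J r) := by
        rw [← pow_add]; congr 1; omega
      calc _ = (y ^ (i : ℕ) * y ^ (k - i)) * (a ^ (J r - k) * ((k - i).factorial : ℂ)⁻¹) := by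
            rw [div_eq_mul_inv]; ring
        _ = _ := by rw [← h1, h2]; ring
    · simp

/-- The top coefficient is read off at $y=1/u$, where the unreduced columns already suffice: at
$u=0$ only $k=J_r$ remains. -/
theorem exists_high_factor {J : Fin (m + 1) → ℕ} (hJ : StrictMono J) (a : ℂ) :
    ∃ G : ℂ[X], G.eval 0 ≠ 0 ∧ ∀ u : ℂ, u ≠ 0 →
      u ^ (∑ r, J r) * (u⁻¹ ^ (∑ i : Fin (m + 1), (i : ℕ)) * colDet J a (fun i => i) u⁻¹) =
        G.eval u := by
  set Gm : Matrix (Fin (m + 1)) (Fin (m + 1)) ℂ[X] := Matrix.of fun i r =>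
    ∑ k ∈ range (J r + 1), C (a ^ (J r - k) *
      (if (i : ℕ) ≤ k then (((k - i).factorial : ℕ) : ℂ)⁻¹ else 0)) * X ^ (J r - k) with hGm
  have heval : ∀ y, Gm.det.eval y = (Matrix.of fun (i r : Fin (m + 1)) =>
      ∑ k ∈ range (J r + 1), a ^ (J r - k) *
      (if (i : ℕ) ≤ k then (((k - i).factorial : ℕ) : ℂ)⁻¹ else 0) * y ^ (J r - k)).det := by
    intro y
    have := RingHom.map_det (Polynomial.evalRingHom y) Gm
    rw [Polynomial.coe_evalRingHom] at this
    rw [this]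
    congr 1
    ext i r
    simp only [RingHom.mapMatrix_apply, Matrix.map_apply, hGm, Matrix.of_apply, map_sum]
    refine sum_congr rfl fun k _ => ?_
    rw [coe_evalRingHom, eval_mul, eval_C, eval_pow, eval_X]
  refine ⟨Gm.det, ?_, fun u hu => ?_⟩
  · rw [heval]
    convert det_inv_factorial_ne_zero hJ.injective using 3
    ext i r
    rw [sum_eq_single (J r)]
    · simp
    · intro k hk hne
      have := mem_range.1 hk
      rw [zero_pow (by omega), mul_zero]
    · intro h
      simp at h
  · rw [colDet_eq, heval, ← prod_pow_eq_pow_sum, ← prod_pow_eq_pow_sum,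
      ← Matrix.det_mul_column, ← Matrix.det_mul_row]
    congr 1
    ext i r
    simp only [Matrix.of_apply, mul_sum]
    refine sum_congr rfl fun k hk => ?_
    have hk := mem_range.1 hk
    split_ifs with hik
    · have h1 : u⁻¹ ^ k = u⁻¹ ^ (i : ℕ) * u⁻¹ ^ (k - i) := by rw [← pow_add]; congr 1; omega
      have h2 : u ^ (J r) = u ^ (J r - k) * u ^ k := by
        rw [← pow_add]; congr 1; omega
      have h3 : u ^ k * u⁻¹ ^ k = 1 := by rw [← mul_pow, mul_inv_cancel₀ hu, one_pow]
      calc _ = u ^ (J r) * (u⁻¹ ^ (i : ℕ) * u⁻¹ ^ (k - i)) *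
              (a ^ (J r - k) * ((k - i).factorial : ℂ)⁻¹) := by
            rw [div_eq_mul_inv]; ring
        _ = u ^ (J r - k) * (u ^ k * u⁻¹ ^ k) * (a ^ (J r - k) * ((k - i).factorial : ℂ)⁻¹) := by
            rw [← h1, h2]; ring
        _ = _ := by rw [h3]; ring
    · simp

/-- The lowest power of $y=z-w$ gives the multiplicity at $w$ and the highest one the degree. The
sum of the row indices compensates for row $i$ lowering degrees by $i$. -/
theorem root_structure {J : Fin (m + 1) → ℕ} (hJ : StrictMono J) {a w s : ℂ} (ha : a ≠ 0)
    (hs : s ≠ 0) {W : ℂ[X]} (hW : ∀ z, W.eval z = s * colDet J a (fun i => i) (z - w)) :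
    W ≠ 0 ∧ ∑ i : Fin (m + 1), (i : ℕ) + W.rootMultiplicity w = ∑ r, lowIdx J r ∧
      ∑ i : Fin (m + 1), (i : ℕ) + W.natDegree = ∑ r, J r := by
  set q := W.comp (X + C w) with hq
  have hqe : ∀ y, q.eval y = s * colDet J a (fun i => i) y := by
    intro y
    rw [hq, eval_comp, hW]
    simp
  obtain ⟨H, hH, h1⟩ := exists_low_factor hJ ha
  obtain ⟨G, hG, h2⟩ := exists_high_factor hJ a
  have h3 : X ^ (∑ i : Fin (m + 1), (i : ℕ)) * q = X ^ (∑ r, lowIdx J r) * (C s * H) := by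
    refine Polynomial.funext fun y => ?_
    simp only [eval_mul, eval_pow, eval_X, eval_C, hqe]
    linear_combination s * h1 y
  obtain ⟨hq0, h4⟩ := rootMultiplicity_of_X_pow_mul h3 (by simpa using ⟨hs, hH⟩)
  have h5 : (X ^ (∑ i : Fin (m + 1), (i : ℕ)) * q).natDegree = ∑ r, J r := by
    refine natDegree_of_eval_inv (G := C s * G) (fun u hu => ?_) (by simpa using ⟨hs, hG⟩)
    simp only [eval_mul, eval_pow, eval_X, eval_C, hqe]
    linear_combination s * h2 u hu
  have hW0 : W ≠ 0 := by
    rintro rfl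
    exact hq0 (by simp [hq])
  refine ⟨hW0, ?_, ?_⟩
  · rw [rootMultiplicity_eq_rootMultiplicity]
    exact h4
  · rw [natDegree_X_pow_mul _ hq0, hq, natDegree_comp] at h5
    rw [natDegree_X_add_C, mul_one] at h5
    omega

theorem eq_prod_otherRoots {W : ℂ[X]} (hm : W.Monic) {w : ℂ}
    (hsimple : ∀ z, W.IsRoot z → z ≠ w → W.rootMultiplicity z = 1) :
    W = (X - C w) ^ W.rootMultiplicity w * ∏ z ∈ W.roots.toFinset.erase w, (X - C z) := by
  have h1 := (IsAlgClosed.splits W).eq_prod_roots_of_monic hm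
  conv_lhs => rw [h1]
  rw [Finset.prod_multiset_map_count]
  have h2 : ∀ z ∈ W.roots.toFinset.erase w, (X - C z) ^ W.roots.count z = X - C z := by
    intro z hz
    have hz' := mem_erase.1 hz
    rw [count_roots, hsimple z ((mem_roots hm.ne_zero).1 (Multiset.mem_toFinset.1 hz'.2)) hz'.1,
      pow_one]
  by_cases hw : w ∈ W.roots.toFinset
  · rw [← mul_prod_erase _ _ hw, prod_congr rfl h2, count_roots]
  · rw [erase_eq_of_notMem hw] at h2 ⊢
    rw [prod_congr rfl h2, ← count_roots, Multiset.count_eq_zero_of_notMem, pow_zero, one_mul]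
    exact fun h => hw (Multiset.mem_toFinset.2 h)

end RootStructure

/-! ### Rescaling of the minors. -/

section Scaling

theorem schurShift_scale {c : ℂ} {u u' : ℕ → ℂ} (h : ∀ j, j ≠ 0 → u' j = c ^ j * u j) (v k : ℕ) :
    c ^ v * schurShift u' v k = c ^ k * schurShift u v k := by
  unfold schurShift
  split_ifs with hv
  · rw [schur_congr h, schur_scale, ← mul_assoc, ← pow_add]
    congr 2
    omega
  · simp

/-- The substitution $\varepsilon\mapsto c\varepsilon$ in all generating functions. -/
theorem det_geometric_scale {T : ℕ} (J f : Fin T → ℕ) {c : ℂ} (a : ℂ) {u u' : Fin T → ℕ → ℂ}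
    (h : ∀ i j, j ≠ 0 → u' i j = c ^ j * u i j) :
    c ^ (∑ i, f i) * (Matrix.of fun i r =>
        schurShift (fun j => u' i j + (c * a) ^ j / (j : ℂ)) (f i) (J r)).det =
      c ^ (∑ i, J i) * (Matrix.of fun i r =>
        schurShift (fun j => u i j + a ^ j / (j : ℂ)) (f i) (J r)).det := by
  rw [← prod_pow_eq_pow_sum, ← prod_pow_eq_pow_sum, ← Matrix.det_mul_column, ← Matrix.det_mul_row]
  congr 1
  ext i r
  simp only [Matrix.of_apply]
  refine schurShift_scale (fun j hj => ?_) _ _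
  rw [h i j hj, mul_pow]
  ring

variable {m : ℕ}

/-- The excess `∑ (J_r - lo_r)` of the degrees in the reduced columns. -/
def reducedExp (J : Fin (m + 1) → ℕ) : ℕ := ∑ r, (J r - lowIdx J r)

theorem reducedExp_add {J : Fin (m + 1) → ℕ} (hJ : StrictMono J) :
    reducedExp J + ∑ r, lowIdx J r = ∑ r, J r := by
  rw [reducedExp, ← sum_add_distrib]
  exact sum_congr rfl fun r _ => Nat.sub_add_cancel (lowIdx_le hJ r)

/-- The determinant with the reduced columns `∑ b^(J_r - k) q^(k - lo_r) e_k`. -/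
def reducedDet (J f : Fin (m + 1) → ℕ) (b q : ℂ) (u : Fin (m + 1) → ℕ → ℂ) : ℂ :=
  (Matrix.of fun i r => ∑ k ∈ Icc (lowIdx J r) (J r),
    b ^ (J r - k) * q ^ (k - lowIdx J r) * schurShift (u i) (f i) k).det

/-- Two scalings at once: $\varepsilon\mapsto c\varepsilon$, and a factor $q^{J_r-\mathrm{lo}_r}$ in
column $r$, split as $q^{J_r-k}q^{k-\mathrm{lo}_r}$. A large $a$ is thereby replaced by $caq$, which
a suitable $q$ keeps bounded. -/
theorem reducedDet_scale {J : Fin (m + 1) → ℕ} (hJ : StrictMono J) (f : Fin (m + 1) → ℕ)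
    {c q : ℂ} (a : ℂ) {u u' : Fin (m + 1) → ℕ → ℂ}
    (h : ∀ i j, j ≠ 0 → u' i j = c ^ j * u i j) :
    c ^ (∑ i, f i) * reducedDet J f (c * a * q) q u' =
      c ^ (∑ i, J i) * q ^ reducedExp J * (Matrix.of fun i r =>
        schurShift (fun j => u i j + a ^ j / (j : ℂ)) (f i) (J r)).det := by
  have h1 : (Matrix.of fun i r =>
        schurShift (fun j => u i j + a ^ j / (j : ℂ)) (f i) (J r)).det =
      (Matrix.of fun (i r : Fin (m + 1)) => ∑ k ∈ Icc (lowIdx J r) (J r),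
        a ^ (J r - k) * schurShift (u i) (f i) k).det := by
    simp only [schurShift_add_geometric]
    exact det_geometric_reduce a hJ fun i k => schurShift (u i) (f i) k
  rw [h1, ← prod_pow_eq_pow_sum, ← prod_pow_eq_pow_sum, reducedExp, ← prod_pow_eq_pow_sum,
    ← prod_mul_distrib, reducedDet, ← Matrix.det_mul_column, ← Matrix.det_mul_row]
  congr 1
  ext i r
  simp only [Matrix.of_apply, mul_sum]
  refine sum_congr rfl fun k hk => ?_
  have hk := mem_Icc.1 hk
  have hs := schurShift_scale (h i) (f i) k
  have h2 : c ^ (J r) = c ^ (J r - k) * c ^ k := by rw [← pow_add]; congr 1; omega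
  have h3 : q ^ (J r - lowIdx J r) = q ^ (J r - k) * q ^ (k - lowIdx J r) := by
    rw [← pow_add]; congr 1; omega
  rw [h2, h3, mul_pow, mul_pow]
  linear_combination (c ^ (J r - k) * a ^ (J r - k) * q ^ (J r - k) * q ^ (k - lowIdx J r)) * hs

end Scaling

/-! ### Smooth dependence of determinants. -/

section Smoothness

variable {E : Type*} [NormedAddCommGroup E] [NormedSpace ℝ E] {k : WithTop ℕ∞}

theorem contDiff_det {ι : Type*} [Fintype ι] [DecidableEq ι] {M : E → Matrix ι ι ℂ}
    (h : ∀ i j, ContDiff ℝ k fun p => M p i j) : ContDiff ℝ k fun p => (M p).det := by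
  simp only [Matrix.det_apply']
  exact ContDiff.sum fun σ _ => contDiff_const.mul (contDiff_prod fun i _ => h _ _)

theorem contDiff_reducedDet {m : ℕ} (J f : Fin (m + 1) → ℕ) {b q : E → ℂ}
    {u : E → Fin (m + 1) → ℕ → ℂ} (hb : ContDiff ℝ k b) (hq : ContDiff ℝ k q)
    (hu : ∀ i j, ContDiff ℝ k fun p => u p i j) :
    ContDiff ℝ k fun p => reducedDet J f (b p) (q p) (u p) := by
  unfold reducedDet
  refine contDiff_det fun i r => ?_
  simp only [Matrix.of_apply]
  refine ContDiff.sum fun k _ => ?_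
  exact ((hb.pow _).mul (hq.pow _)).mul (contDiff_schurShift (hu i) _ _)

end Smoothness

/-! ### Uniform convergence with rate $O(\delta)$. -/

section Rates

variable {E : Type*}

/-- `F δ p = F₀ p + O(δ)` as `δ → 0+`, uniformly for `p ∈ B`, with `F₀` bounded on `B`. -/
def RateOn (B : Set E) (F : ℝ → E → ℂ) (F₀ : E → ℂ) : Prop :=
  ∃ K b : ℝ, 0 < K ∧ 0 < b ∧ b ≤ 1 ∧ (∀ p ∈ B, ‖F₀ p‖ ≤ K) ∧
    ∀ δ, 0 < δ → δ ≤ b → ∀ p ∈ B, ‖F δ p - F₀ p‖ ≤ K * δ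

variable {B : Set E} {F G : ℝ → E → ℂ} {F₀ G₀ : E → ℂ}

theorem RateOn.const (B : Set E) (c : ℂ) : RateOn B (fun _ _ => c) fun _ => c :=
  ⟨‖c‖ + 1, 1, by positivity, one_pos, le_rfl, fun _ _ => by linarith, fun δ hδ _ _ _ => by
    simp only [sub_self, norm_zero]
    positivity⟩

theorem RateOn.add (hF : RateOn B F F₀) (hG : RateOn B G G₀) :
    RateOn B (fun δ p => F δ p + G δ p) fun p => F₀ p + G₀ p := by
  obtain ⟨K, b, hK, hb, hb1, h0, h⟩ := hF
  obtain ⟨K', b', hK', hb', hb1', h0', h'⟩ := hG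
  refine ⟨K + K', min b b', by positivity, lt_min hb hb', min_le_of_left_le hb1, fun p hp => ?_,
    fun δ hδ hδb p hp => ?_⟩
  · exact (norm_add_le _ _).trans (add_le_add (h0 p hp) (h0' p hp))
  · have h1 := h δ hδ (hδb.trans (min_le_left _ _)) p hp
    have h2 := h' δ hδ (hδb.trans (min_le_right _ _)) p hp
    calc ‖F δ p + G δ p - (F₀ p + G₀ p)‖ = ‖(F δ p - F₀ p) + (G δ p - G₀ p)‖ := by congr 1; ring
      _ ≤ _ := norm_add_le _ _
      _ ≤ _ := by rw [add_mul]; exact add_le_add h1 h2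

theorem RateOn.sum {ι : Type*} (s : Finset ι) {F : ι → ℝ → E → ℂ} {F₀ : ι → E → ℂ}
    (h : ∀ i ∈ s, RateOn B (F i) (F₀ i)) :
    RateOn B (fun δ p => ∑ i ∈ s, F i δ p) fun p => ∑ i ∈ s, F₀ i p := by
  classical
  induction s using Finset.induction_on with
  | empty => simpa using RateOn.const B 0
  | insert i s hi ih =>
    simp only [sum_insert hi]
    exact (h i (mem_insert_self i s)).add (ih fun j hj => h j (mem_insert_of_mem hj))

theorem RateOn.mul (hF : RateOn B F F₀) (hG : RateOn B G G₀) :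
    RateOn B (fun δ p => F δ p * G δ p) fun p => F₀ p * G₀ p := by
  obtain ⟨K, b, hK, hb, hb1, h0, h⟩ := hF
  obtain ⟨K', b', hK', hb', hb1', h0', h'⟩ := hG
  refine ⟨3 * K * K', min b b', by positivity, lt_min hb hb', min_le_of_left_le hb1,
    fun p hp => ?_, fun δ hδ hδb p hp => ?_⟩
  · rw [norm_mul]
    have := mul_le_mul (h0 p hp) (h0' p hp) (norm_nonneg _) hK.le
    nlinarith [mul_pos hK hK']
  · have h1 := h δ hδ (hδb.trans (min_le_left _ _)) p hp
    have h2 := h' δ hδ (hδb.trans (min_le_right _ _)) p hp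
    have hδ1 : δ ≤ 1 := hδb.trans (min_le_of_left_le hb1)
    have e : F δ p * G δ p - F₀ p * G₀ p = (F δ p - F₀ p) * (G δ p - G₀ p) +
        (F δ p - F₀ p) * G₀ p + F₀ p * (G δ p - G₀ p) := by ring
    have a1 : ‖(F δ p - F₀ p) * (G δ p - G₀ p)‖ ≤ K * δ * (K' * 1) := by
      rw [norm_mul]
      exact mul_le_mul h1 (h2.trans (mul_le_mul_of_nonneg_left hδ1 hK'.le)) (norm_nonneg _)
        (by positivity)
    have a2 : ‖(F δ p - F₀ p) * G₀ p‖ ≤ K * δ * K' := by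
      rw [norm_mul]
      exact mul_le_mul h1 (h0' p hp) (norm_nonneg _) (by positivity)
    have a3 : ‖F₀ p * (G δ p - G₀ p)‖ ≤ K * (K' * δ) := by
      rw [norm_mul]
      exact mul_le_mul (h0 p hp) h2 (norm_nonneg _) hK.le
    rw [e]
    refine (norm_add₃_le).trans ?_
    linarith

theorem RateOn.star (hF : RateOn B F F₀) :
    RateOn B (fun δ p => star (F δ p)) fun p => star (F₀ p) := by
  obtain ⟨K, b, hK, hb, hb1, h0, h⟩ := hF
  refine ⟨K, b, hK, hb, hb1, fun p hp => by rw [norm_star]; exact h0 p hp,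
    fun δ hδ hδb p hp => ?_⟩
  rw [← star_sub, norm_star]
  exact h δ hδ hδb p hp

theorem RateOn.delta_mul (hF : RateOn B F F₀) :
    RateOn B (fun δ p => (δ : ℂ) * F δ p) fun _ => 0 := by
  obtain ⟨K, b, hK, hb, hb1, h0, h⟩ := hF
  refine ⟨2 * K, b, by positivity, hb, hb1, fun p _ => by simpa using hK.le,
    fun δ hδ hδb p hp => ?_⟩
  have h1 := h δ hδ hδb p hp
  have h2 : ‖F δ p‖ ≤ K * 1 + K := by
    calc ‖F δ p‖ = ‖(F δ p - F₀ p) + F₀ p‖ := by congr 1; ring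
      _ ≤ _ := norm_add_le _ _
      _ ≤ K * 1 + K :=
        add_le_add (h1.trans (mul_le_mul_of_nonneg_left (hδb.trans hb1) hK.le)) (h0 p hp)
  rw [sub_zero, norm_mul, Complex.norm_real, Real.norm_of_nonneg hδ.le]
  nlinarith

theorem RateOn.div (hF : RateOn B F F₀) (hG : RateOn B G G₀) {c : ℝ} (hc : 0 < c)
    (hG₀ : ∀ p ∈ B, c ≤ ‖G₀ p‖) :
    RateOn B (fun δ p => F δ p / G δ p) fun p => F₀ p / G₀ p := by
  have hinv : RateOn B (fun δ p => (G δ p)⁻¹) fun p => (G₀ p)⁻¹ := by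
    obtain ⟨K, b, hK, hb, hb1, h0, h⟩ := hG
    refine ⟨c⁻¹ + 2 * K / c ^ 2, min b (c / (2 * K)), by positivity, lt_min hb (by positivity),
      min_le_of_left_le hb1, fun p hp => ?_, fun δ hδ hδb p hp => ?_⟩
    · rw [norm_inv]
      have := inv_anti₀ hc (hG₀ p hp)
      have : 0 < 2 * K / c ^ 2 := by positivity
      linarith
    · have h1 := h δ hδ (hδb.trans (min_le_left _ _)) p hp
      have h2 : K * δ ≤ c / 2 := by
        have := hδb.trans (min_le_right _ _)
        rw [le_div_iff₀ (by positivity)] at this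
        linarith
      have h3 := hG₀ p hp
      have h4 : c / 2 ≤ ‖G δ p‖ := by
        have : ‖G₀ p‖ ≤ ‖G δ p‖ + ‖G δ p - G₀ p‖ := by
          rw [← norm_sub_rev]
          calc ‖G₀ p‖ = ‖G δ p + (G₀ p - G δ p)‖ := by congr 1; ring
            _ ≤ _ := norm_add_le _ _
        linarith
      have n1 : G δ p ≠ 0 := norm_pos_iff.1 (by linarith)
      have n2 : G₀ p ≠ 0 := norm_pos_iff.1 (by linarith)
      have e : (G δ p)⁻¹ - (G₀ p)⁻¹ = (G₀ p - G δ p) / (G δ p * G₀ p) := by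
        field_simp
      have h5 : c ^ 2 / 2 ≤ ‖G δ p * G₀ p‖ := by
        rw [norm_mul]
        nlinarith [mul_le_mul h4 h3 hc.le (norm_nonneg _)]
      rw [e, norm_div, norm_sub_rev]
      calc ‖G δ p - G₀ p‖ / ‖G δ p * G₀ p‖ ≤ K * δ / (c ^ 2 / 2) :=
            div_le_div₀ (by positivity) h1 (by positivity) h5
        _ = 2 * K / c ^ 2 * δ := by field_simp
        _ ≤ _ := by
          refine mul_le_mul_of_nonneg_right ?_ hδ.le
          have : 0 < c⁻¹ := by positivity
          linarith
  simpa only [div_eq_mul_inv] using hF.mul hinv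

theorem RateOn.congr (hF : RateOn B F F₀) (hFG : ∀ δ, 0 < δ → ∀ p ∈ B, G δ p = F δ p) :
    RateOn B G F₀ := by
  obtain ⟨K, b, hK, hb, hb1, h0, h⟩ := hF
  exact ⟨K, b, hK, hb, hb1, h0, fun δ hδ hδb p hp => by rw [hFG δ hδ p hp]; exact h δ hδ hδb p hp⟩

variable [NormedAddCommGroup E] [NormedSpace ℝ E]

theorem exists_lipschitz_of_contDiff {f : ℝ × E → ℂ} (hf : ContDiff ℝ 1 f) (hB : IsCompact B)
    (hBc : Convex ℝ B) : ∃ K : ℝ, 0 < K ∧ (∀ δ ∈ Set.Icc (0 : ℝ) 1, ∀ p ∈ B, ‖f (δ, p)‖ ≤ K) ∧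
      ∀ δ ∈ Set.Icc (0 : ℝ) 1, ∀ p ∈ B, ‖f (δ, p) - f (0, p)‖ ≤ K * δ := by
  have hcomp : IsCompact (Set.Icc (0 : ℝ) 1 ×ˢ B) := isCompact_Icc.prod hB
  obtain ⟨K, hK⟩ := hf.contDiffOn.exists_lipschitzOnWith (s := Set.Icc (0 : ℝ) 1 ×ˢ B) one_ne_zero
    ((convex_Icc 0 1).prod hBc) hcomp
  obtain ⟨K', hK'⟩ := hcomp.exists_bound_of_continuousOn hf.continuous.continuousOn
  refine ⟨K + |K'| + 1, by positivity, fun δ hδ p hp => ?_, fun δ hδ p hp => ?_⟩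
  · have := hK' (δ, p) ⟨hδ, hp⟩
    have := le_abs_self K'
    have := K.coe_nonneg
    linarith
  · have h := hK.dist_le_mul (δ, p) ⟨hδ, hp⟩ (0, p) ⟨by simp, hp⟩
    rw [dist_eq_norm, Prod.dist_eq, dist_self, max_eq_left dist_nonneg, Real.dist_eq, sub_zero,
      abs_of_nonneg hδ.1] at h
    refine h.trans (mul_le_mul_of_nonneg_right ?_ hδ.1)
    have := abs_nonneg K'
    linarith

theorem rateOn_of_contDiff {f : ℝ × E → ℂ} (hf : ContDiff ℝ 1 f) (hB : IsCompact B)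
    (hBc : Convex ℝ B) : RateOn B (fun δ p => f (δ, p)) fun p => f (0, p) := by
  obtain ⟨K, hK, h1, h2⟩ := exists_lipschitz_of_contDiff hf hB hBc
  exact ⟨K, 1, hK, one_pos, le_rfl, h1 0 (by simp), fun δ hδ hδ1 => h2 δ ⟨hδ.le, hδ1⟩⟩

/-- The mean value inequality for $f(s,p)-s f_1(p)$, whose derivative in $s$ is $O(\delta)$ because
$\partial_\delta f$ is Lipschitz. This is why two derivatives are assumed. -/
theorem rateOn_div_delta {f : ℝ × E → ℂ} (hf : ContDiff ℝ 2 f) (hB : IsCompact B)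
    (hBc : Convex ℝ B) {f₁ : E → ℂ} (h0 : ∀ p, f (0, p) = 0)
    (h1 : ∀ p, HasDerivAt (fun δ => f (δ, p)) (f₁ p) 0) :
    RateOn B (fun δ p => f (δ, p) / (δ : ℂ)) f₁ := by
  set f' : ℝ × E → ℂ := fun x => fderiv ℝ f x (1, 0) with hf'
  have hf'c : ContDiff ℝ 1 f' := (hf.fderiv_right (m := 1) (by norm_num)).clm_apply contDiff_const
  have hd : ∀ δ p, HasDerivAt (fun δ => f (δ, p)) (f' (δ, p)) δ := by
    intro δ p
    have hfd := (hf.differentiable (by norm_num) (δ, p)).hasFDerivAt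
    exact hfd.comp_hasDerivAt δ ((hasDerivAt_id δ).prodMk (hasDerivAt_const δ p))
  have hf₁ : ∀ p, f₁ p = f' (0, p) := fun p => (h1 p).unique (hd 0 p)
  obtain ⟨K, hK, hK1, hK2⟩ := exists_lipschitz_of_contDiff hf'c hB hBc
  refine ⟨K, 1, hK, one_pos, le_rfl, fun p hp => ?_, fun δ hδ hδ1 p hp => ?_⟩
  · rw [hf₁]
    exact hK1 0 (by simp) p hp
  · have hder : ∀ s ∈ Set.Icc (0 : ℝ) δ, HasDerivWithinAt (fun s : ℝ => f (s, p) - (s : ℂ) * f₁ p)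
        (f' (s, p) - f₁ p) (Set.Icc 0 δ) s := by
      intro s _
      have h2 : HasDerivAt (fun s : ℝ => (s : ℂ) * f₁ p) (f₁ p) s := by
        simpa using (Complex.ofRealCLM.hasDerivAt (x := s)).mul_const (f₁ p)
      exact ((hd s p).sub h2).hasDerivWithinAt
    have hbd : ∀ s ∈ Set.Icc (0 : ℝ) δ, ‖f' (s, p) - f₁ p‖ ≤ K * δ := by
      intro s hs
      rw [hf₁]
      exact (hK2 s ⟨hs.1, hs.2.trans hδ1⟩ p hp).trans (mul_le_mul_of_nonneg_left hs.2 hK.le)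
    have hmv := (convex_Icc (0 : ℝ) δ).norm_image_sub_le_of_norm_hasDerivWithin_le hder hbd
      (Set.left_mem_Icc.2 hδ.le) (Set.right_mem_Icc.2 hδ.le)
    simp only [h0, Complex.ofReal_zero, zero_mul, sub_zero, Real.norm_of_nonneg hδ.le] at hmv
    have hδ' : (δ : ℂ) ≠ 0 := Complex.ofReal_ne_zero.2 hδ.ne'
    have e : f (δ, p) / (δ : ℂ) - f₁ p = (f (δ, p) - (δ : ℂ) * f₁ p) / (δ : ℂ) := by
      field_simp
    rw [e, norm_div, Complex.norm_real, Real.norm_of_nonneg hδ.le, div_le_iff₀ hδ]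
    exact hmv

end Rates

theorem exists_norm_lower_bound {E : Type*} [TopologicalSpace E] {B : Set E} (hB : IsCompact B)
    {G : E → ℂ} (hG : Continuous G) (h : ∀ p ∈ B, G p ≠ 0) :
    ∃ c : ℝ, 0 < c ∧ ∀ p ∈ B, c ≤ ‖G p‖ :=
  hB.exists_forall_le' (f := fun p => ‖G p‖) hG.norm.continuousOn
    (fun p hp => norm_pos_iff.2 (h p hp))

theorem rateOn_div_of_contDiff {E : Type*} [NormedAddCommGroup E] [NormedSpace ℝ E] {B : Set E}
    {F G : ℝ × E → ℂ} (hF : ContDiff ℝ 1 F) (hG : ContDiff ℝ 1 G) (hB : IsCompact B)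
    (hBc : Convex ℝ B) (h : ∀ p ∈ B, G (0, p) ≠ 0) :
    RateOn B (fun δ p => F (δ, p) / G (δ, p)) fun p => F (0, p) / G (0, p) := by
  obtain ⟨c, hc, hlow⟩ := exists_norm_lower_bound hB
    (hG.continuous.comp (Continuous.prodMk_right (0 : ℝ))) h
  exact (rateOn_of_contDiff hF hB hBc).div (rateOn_of_contDiff hG hB hBc) hc hlow

theorem sum_weight_norm_sq {ι : Type*} (s : Finset ι) (c : ι → ℝ) (x : ι → ℂ) :
    ∑ f ∈ s, (c f : ℂ) * star (x f) * x f = ((∑ f ∈ s, c f * ‖x f‖ ^ 2 : ℝ) : ℂ) := by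
  push_cast
  refine sum_congr rfl fun f _ => ?_
  rw [mul_assoc, ← starRingEnd_apply, Complex.conj_mul']

/-- A sum of weighted squared moduli cannot cancel, so a single nonzero minor keeps the denominator
away from zero. -/
theorem sum_weight_ne_zero {ι : Type*} {s : Finset ι} {c : ι → ℝ} (hc : ∀ f, 0 < c f) {x : ι → ℂ}
    {f₀ : ι} (hf : f₀ ∈ s) (hx : x f₀ ≠ 0) : ∑ f ∈ s, (c f : ℂ) * star (x f) * x f ≠ 0 := by
  rw [sum_weight_norm_sq]
  refine Complex.ofReal_ne_zero.2 (ne_of_gt ?_)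
  refine sum_pos' (fun f _ => mul_nonneg (hc f).le (sq_nonneg _)) ⟨f₀, hf, ?_⟩
  exact mul_pos (hc f₀) (pow_pos (norm_pos_iff.2 hx) 2)

theorem det_schurShift_self {T : ℕ} {f : Fin T → ℕ} (hf : StrictMono f) (u : Fin T → ℕ → ℂ) :
    (Matrix.of fun i r => schurShift (u i) (f i) (f r)).det = 1 := by
  rw [Matrix.det_of_isUpperTriangular]
  · exact prod_eq_one fun i _ => by simp [schurShift_self]
  · intro i j hij
    exact schurShift_of_lt _ (hf hij)

theorem schurShift_succ_succ (u : ℕ → ℂ) (v j : ℕ) :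
    schurShift u (v + 1) (j + 1) = schurShift u v j := by
  simp [schurShift]

theorem schurShift_zero_right (u : ℕ → ℂ) (v : ℕ) :
    schurShift u v 0 = if v = 0 then 1 else 0 := by
  by_cases h : v = 0 <;> simp [schurShift, h, schur_zero]

/-! ### Limits near the multiple root and near the simple roots. -/

namespace SpectralData

variable {n : ℕ} (D : SpectralData n)

/-- The sum over the minors which gives `det M`. -/
def waveSum {T : ℕ} (J : Fin T → ℕ) (L : ℕ) (a : ℂ) (g : ℕ → ℂ) (ξ η : ℝ) : ℂ :=
  ∑ f ∈ strictMonoFns T L, (D.C1 : ℂ) ^ (∑ i, f i) * star (D.minorDet J a g f ξ η) *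
    D.minorDet J a (-g) f ξ η

/-- The exponents `δ^(j-1) (α_j ξ + i β_j η) + δ^j (v h_{1,j} + g_j)`. -/
def scaledSeq (δ ξ η : ℝ) (v : ℕ) (g : ℕ → ℂ) (j : ℕ) : ℂ :=
  if j = 0 then 0 else (δ : ℂ) ^ (j - 1) * (D.alpha j * ξ + Complex.I * D.beta j * η) +
    (δ : ℂ) ^ j * ((v : ℂ) * D.h1 j + g j)

/-- One of the $j$ factors $\delta$ goes into the coordinates, so at $\delta=0$ only the exponent
$j=1$ remains. -/
theorem scaledSeq_eq (δ ξ η : ℝ) (v : ℕ) (g : ℕ → ℂ) {j : ℕ} (hj : j ≠ 0) :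
    D.scaledSeq δ (δ * ξ) (δ * η) v g j = (δ : ℂ) ^ j * D.rowSeq ξ η v g j := by
  obtain ⟨k, rfl⟩ := Nat.exists_eq_succ_of_ne_zero hj
  simp only [scaledSeq, rowSeq, if_neg hj]
  push_cast
  simp only [Nat.succ_eq_add_one]
  ring

theorem scaledSeq_zero (hn : 1 ≤ n) (ξ η : ℝ) (v : ℕ) (g : ℕ → ℂ) (j : ℕ) :
    D.scaledSeq 0 ξ η v g j = if j = 1 then D.coord ξ η else 0 := by
  rcases j with _ | _ | j
  · simp [scaledSeq]
  · simp [scaledSeq, D.alpha_one_add hn]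
  · simp [scaledSeq]

theorem contDiff_scaledSeq {E : Type*} [NormedAddCommGroup E] [NormedSpace ℝ E]
    {k : WithTop ℕ∞} {δ ξ η : E → ℝ} (hδ : ContDiff ℝ k δ) (hξ : ContDiff ℝ k ξ)
    (hη : ContDiff ℝ k η) (v : ℕ) (g : ℕ → ℂ) (j : ℕ) :
    ContDiff ℝ k fun p => D.scaledSeq (δ p) (ξ p) (η p) v g j := by
  unfold scaledSeq
  split_ifs
  · exact contDiff_const
  · have hc : ∀ {f : E → ℝ}, ContDiff ℝ k f → ContDiff ℝ k fun p => (f p : ℂ) := fun hf =>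
      Complex.ofRealCLM.contDiff.comp hf
    exact (((hc hδ).pow _).mul ((contDiff_const.mul (hc hξ)).add (contDiff_const.mul (hc hη)))).add
      (((hc hδ).pow _).mul contDiff_const)

theorem coord_sub (ξ η ξ' η' : ℝ) : D.coord (ξ - ξ') (η - η') = D.coord ξ η - D.coord ξ' η' := by
  simp only [coord]
  push_cast
  ring

section Core

variable {m : ℕ} {J : Fin (m + 1) → ℕ} {L : ℕ}

theorem bumpLast_mem (hJ : StrictMono J) (hL : J (Fin.last m) < L) :
    bumpLast m ∈ strictMonoFns (m + 1) (L + 1) := by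
  refine mem_strictMonoFns.2 ⟨fun i => ?_, strictMono_bumpLast⟩
  have h1 := strictMono_le hJ (Fin.last m)
  have := i.isLt
  rw [Fin.val_last] at h1
  unfold bumpLast
  split_ifs <;> omega

theorem val_mem (hJ : StrictMono J) (hL : J (Fin.last m) < L) :
    (fun i : Fin (m + 1) => (i : ℕ)) ∈ strictMonoFns (m + 1) (L + 1) := by
  refine mem_strictMonoFns.2 ⟨fun i => ?_, strictMono_val⟩
  have h1 := strictMono_le hJ (Fin.last m)
  have := i.isLt
  rw [Fin.val_last] at h1
  omega

theorem lowIdx_mem (hJ : StrictMono J) (hL : J (Fin.last m) < L) :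
    lowIdx J ∈ strictMonoFns (m + 1) (L + 1) := by
  refine mem_strictMonoFns.2 ⟨fun i => ?_, strictMono_lowIdx hJ⟩
  have h1 := lowIdx_le hJ i
  have h2 := hJ.monotone (Fin.le_last i)
  omega

theorem sum_ge_succ {f : Fin (m + 1) → ℕ} (hf : StrictMono f)
    (hne : f ≠ fun i : Fin (m + 1) => (i : ℕ)) : ∑ i : Fin (m + 1), (i : ℕ) + 1 ≤ ∑ i, f i := by
  rcases strictMono_trichotomy hf with h | h | h
  · exact absurd h hne
  · rw [h, sum_bumpLast]
  · omega

/-- The determinant of the matrix of the wave of lower order. -/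
def lowerDet (J : Fin (m + 1) → ℕ) (L : ℕ) (g : ℕ → ℂ) (ξ η : ℝ) : ℂ :=
  (Matrix.of fun p r : Fin m => ∑ v ∈ range L, (D.C1 : ℂ) ^ v *
    star (schurShift (D.rowSeq ξ η (v + 1) g) v (J p.castSucc)) *
    schurShift (D.rowSeq ξ η (v + 1) (-g)) v (J r.castSucc)).det

theorem reducedDet_zero (hJ : StrictMono J) (f : Fin (m + 1) → ℕ) (b : ℂ)
    (u : Fin (m + 1) → ℕ → ℂ) : reducedDet J f b 0 u =
      b ^ reducedExp J * (Matrix.of fun i r => schurShift (u i) (f i) (lowIdx J r)).det := by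
  rw [reducedExp, ← prod_pow_eq_pow_sum, ← Matrix.det_mul_row, reducedDet]
  congr 1
  ext i r
  simp only [Matrix.of_apply]
  rw [sum_eq_single (lowIdx J r)]
  · simp
  · intro k hk hne
    have := (mem_Icc.1 hk).1
    rw [zero_pow (by omega)]
    ring
  · intro h
    exact absurd (mem_Icc.2 ⟨le_rfl, lowIdx_le hJ r⟩) h

/-- The sum over the minors after the column reduction and rescaling. -/
def reducedSum (J : Fin (m + 1) → ℕ) (L : ℕ) (b q : ℂ) (g : ℕ → ℂ) (ξ η : ℝ) : ℂ :=
  ∑ f ∈ strictMonoFns (m + 1) (L + 1), (D.C1 : ℂ) ^ (∑ i, f i) *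
    star (reducedDet J f b q fun i => D.rowSeq ξ η (f i) g) *
    reducedDet J f b q fun i => D.rowSeq ξ η (f i) (-g)

/-- At $q=0$ only the degrees $\mathrm{lo}_r$ are left. Cauchy–Binet read backwards assembles one
matrix, `det_sum_cons` removes the column of degree $0$, and lowering shift and degree together by
one yields the degrees $J_0,\dots,J_{m-1}$ with the terms $(v+1)h_{1,j}$. -/
theorem reducedSum_zero (hJ : StrictMono J) (b : ℂ) (g : ℕ → ℂ) (ξ η : ℝ) :
    D.reducedSum J L b 0 g ξ η =
      star (b ^ reducedExp J) * b ^ reducedExp J * (D.C1 : ℂ) ^ m * D.lowerDet J L g ξ η := by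
  have h1 := det_sum_mul_mul (L + 1) (fun v => (D.C1 : ℂ) ^ v)
    (fun v (p : Fin (m + 1)) => star (schurShift (D.rowSeq ξ η v g) v (lowIdx J p)))
    (fun v (r : Fin (m + 1)) => schurShift (D.rowSeq ξ η v (-g)) v (lowIdx J r))
  rw [det_sum_cons] at h1
  · have h2 : (Matrix.of fun p r : Fin m => ∑ v ∈ range L, (D.C1 : ℂ) ^ (v + 1) *
        star (schurShift (D.rowSeq ξ η (v + 1) g) (v + 1) (lowIdx J p.succ)) *
        schurShift (D.rowSeq ξ η (v + 1) (-g)) (v + 1) (lowIdx J r.succ)) =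
        (D.C1 : ℂ) • Matrix.of fun p r : Fin m => ∑ v ∈ range L, (D.C1 : ℂ) ^ v *
          star (schurShift (D.rowSeq ξ η (v + 1) g) v (J p.castSucc)) *
          schurShift (D.rowSeq ξ η (v + 1) (-g)) v (J r.castSucc) := by
      ext p r
      simp only [Matrix.smul_apply, Matrix.of_apply, smul_eq_mul, mul_sum, lowIdx_succ,
        schurShift_succ_succ]
      refine sum_congr rfl fun v _ => ?_
      rw [pow_succ]
      ring
    rw [h2, Matrix.det_smul, Fintype.card_fin, pow_zero, one_mul] at h1
    rw [lowerDet, mul_assoc, h1, reducedSum, mul_sum]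
    refine sum_congr rfl fun f _ => ?_
    rw [reducedDet_zero hJ, reducedDet_zero hJ, prod_pow_eq_pow_sum, star_mul']
    have := RingHom.map_det (starRingEnd ℂ) (Matrix.of fun (i r : Fin (m + 1)) =>
      schurShift (D.rowSeq ξ η (f i) g) (f i) (lowIdx J r))
    rw [starRingEnd_apply] at this
    rw [this]
    change _ = _ * (_ * Matrix.det _ * _)
    have e : (RingHom.mapMatrix (starRingEnd ℂ)) (Matrix.of fun (i r : Fin (m + 1)) =>
        schurShift (D.rowSeq ξ η (f i) g) (f i) (lowIdx J r)) = Matrix.of fun (i r : Fin (m + 1)) =>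
          star (schurShift (D.rowSeq ξ η (f i) g) (f i) (lowIdx J r)) := rfl
    rw [e]
    ring
  · intro v
    rw [lowIdx_zero, schurShift_zero_right]
    split_ifs <;> simp
  · intro v
    rw [lowIdx_zero, schurShift_zero_right]

/-- For the row sequence $f=\mathrm{lo}$ the minor is unitriangular, hence nonzero at every point.
-/
theorem reducedSum_zero_ne (hn : 1 ≤ n) (hJ : StrictMono J) (hL : J (Fin.last m) < L) {b : ℂ}
    (hb : b ≠ 0) (ξ η : ℝ) : D.reducedSum J L b 0 0 ξ η ≠ 0 := by
  have h := sum_weight_ne_zero (s := strictMonoFns (m + 1) (L + 1))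
    (c := fun f => D.C1 ^ (∑ i, f i)) (fun f => pow_pos (D.C1_ne hn) _)
    (x := fun f => reducedDet J f b 0 fun i => D.rowSeq ξ η (f i) 0) (lowIdx_mem hJ hL) (by
      rw [reducedDet_zero hJ, det_schurShift_self (strictMono_lowIdx hJ), mul_one]
      exact pow_ne_zero _ hb)
  unfold reducedSum
  simpa using h

theorem contDiff_rowSeq {E : Type*} [NormedAddCommGroup E] [NormedSpace ℝ E]
    {k : WithTop ℕ∞} {ξ η : E → ℝ} (hξ : ContDiff ℝ k ξ) (hη : ContDiff ℝ k η) (v : ℕ)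
    (g : ℕ → ℂ) (j : ℕ) : ContDiff ℝ k fun p => D.rowSeq (ξ p) (η p) v g j := by
  have hc : ∀ {f : E → ℝ}, ContDiff ℝ k f → ContDiff ℝ k fun p => (f p : ℂ) := fun hf =>
    Complex.ofRealCLM.contDiff.comp hf
  exact (((contDiff_const.mul (hc hξ)).add (contDiff_const.mul (hc hη))).add contDiff_const).add
    contDiff_const

theorem waveSum_inv {δ : ℝ} (hδ : δ ≠ 0) (hJ : StrictMono J) (z₀ : ℂ) (g : ℕ → ℂ) (ξ η : ℝ) :
    (δ : ℂ) ^ (2 * reducedExp J) * D.waveSum J (L + 1) (z₀ * (δ⁻¹ : ℝ)) g ξ η =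
      D.reducedSum J L z₀ δ g ξ η := by
  have hδ' : (δ : ℂ) ≠ 0 := Complex.ofReal_ne_zero.2 hδ
  have h : ∀ g f, reducedDet J f z₀ δ (fun i => D.rowSeq ξ η (f i) g) =
      (δ : ℂ) ^ reducedExp J * D.minorDet J (z₀ * (δ⁻¹ : ℝ)) g f ξ η := by
    intro g f
    -- With $q=1/A$ the large number $z_0A$ becomes $z_0$.
    have := reducedDet_scale hJ f (c := 1) (q := δ) (z₀ * (δ⁻¹ : ℝ))
      (u := fun i => D.rowSeq ξ η (f i) g) (u' := fun i => D.rowSeq ξ η (f i) g)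
      (fun i j _ => by simp)
    rw [one_pow, one_pow, one_mul, one_mul, one_mul] at this
    rw [minorDet, ← this]
    congr 1
    push_cast
    field_simp
  rw [waveSum, reducedSum, mul_sum]
  refine sum_congr rfl fun f _ => ?_
  rw [h, h, star_mul', star_pow, ← starRingEnd_apply (δ : ℂ), Complex.conj_ofReal]
  ring

theorem contDiff_reducedSum (z₀ : ℂ) (g : ℕ → ℂ) : ContDiff ℝ 1 fun x : ℝ × (ℝ × ℝ) =>
    D.reducedSum J L z₀ x.1 g x.2.1 x.2.2 := by
  have h : ∀ (g : ℕ → ℂ) (f : Fin (m + 1) → ℕ), ContDiff ℝ 1 fun x : ℝ × (ℝ × ℝ) =>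
      reducedDet J f z₀ x.1 fun i => D.rowSeq x.2.1 x.2.2 (f i) g := by
    intro g f
    refine contDiff_reducedDet J f contDiff_const (Complex.ofRealCLM.contDiff.comp contDiff_fst) ?_
    intro i j
    exact D.contDiff_rowSeq (contDiff_fst.comp contDiff_snd) (contDiff_snd.comp contDiff_snd) _ _ _
  unfold reducedSum
  refine ContDiff.sum fun f _ => ?_
  exact (contDiff_const.mul ((Complex.conjCLE.contDiff (n := 1)).comp (h g f))).mul (h (-g) f)

/-- The convergence to the wave of lower order near the multiple root. -/
theorem rateOn_near_mult (hn : 1 ≤ n) (hJ : StrictMono J) (hL : J (Fin.last m) < L) {z₀ : ℂ}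
    (hz₀ : z₀ ≠ 0) (g : ℕ → ℂ) (R : ℝ) :
    RateOn (Metric.closedBall (0 : ℝ × ℝ) R)
      (fun δ p => D.waveSum J (L + 1) (z₀ * (δ⁻¹ : ℝ)) g p.1 p.2 /
        D.waveSum J (L + 1) (z₀ * (δ⁻¹ : ℝ)) 0 p.1 p.2)
      (fun p => D.lowerDet J L g p.1 p.2 / D.lowerDet J L 0 p.1 p.2) := by
  have hB : IsCompact (Metric.closedBall (0 : ℝ × ℝ) R) := isCompact_closedBall _ _
  have hcd : ∀ g, ContDiff ℝ 1 fun x : ℝ × (ℝ × ℝ) => D.reducedSum J L z₀ x.1 g x.2.1 x.2.2 :=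
    fun g => D.contDiff_reducedSum (J := J) (L := L) z₀ g
  have hne : ∀ p : ℝ × ℝ, D.reducedSum J L z₀ (0 : ℝ) 0 p.1 p.2 ≠ 0 := by
    intro p
    rw [Complex.ofReal_zero]
    exact D.reducedSum_zero_ne hn hJ hL hz₀ p.1 p.2
  have hdiv := rateOn_div_of_contDiff (hcd g) (hcd 0) hB (convex_closedBall _ _) fun p _ => hne p
  have e : ∀ p : ℝ × ℝ, D.reducedSum J L z₀ (0 : ℝ) g p.1 p.2 / D.reducedSum J L z₀ (0 : ℝ) 0 p.1 p.2 =
      D.lowerDet J L g p.1 p.2 / D.lowerDet J L 0 p.1 p.2 := by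
    intro p
    rw [Complex.ofReal_zero, reducedSum_zero D hJ, reducedSum_zero D hJ, mul_div_mul_left]
    refine mul_ne_zero (mul_ne_zero (star_ne_zero.2 (pow_ne_zero _ hz₀)) (pow_ne_zero _ hz₀))
      (pow_ne_zero _ (Complex.ofReal_ne_zero.2 (D.C1_ne hn).ne'))
  simp only [e] at hdiv
  refine hdiv.congr fun δ hδ p _ => ?_
  rw [← D.waveSum_inv hδ.ne' hJ, ← D.waveSum_inv hδ.ne' hJ, mul_div_mul_left]
  exact pow_ne_zero _ (Complex.ofReal_ne_zero.2 hδ.ne')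

/-- The minor after rescaling around the point `A (ξ₁, η₁)`. -/
def localDet (J f : Fin (m + 1) → ℕ) (z₀ : ℂ) (g : ℕ → ℂ) (p₁ p₂ : ℝ × ℝ) (x : ℝ × (ℝ × ℝ)) : ℂ :=
  (Matrix.of fun i r => schurShift (fun j =>
    D.scaledSeq x.1 (p₁.1 + x.1 * (x.2.1 - p₂.1)) (p₁.2 + x.1 * (x.2.2 - p₂.2)) (f i) g j +
      z₀ ^ j / (j : ℂ)) (f i) (J r)).det

theorem contDiff_localDet (f : Fin (m + 1) → ℕ) (z₀ : ℂ) (g : ℕ → ℂ) (p₁ p₂ : ℝ × ℝ) :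
    ContDiff ℝ 2 (D.localDet J f z₀ g p₁ p₂) := by
  unfold localDet
  refine contDiff_det fun i r => ?_
  simp only [Matrix.of_apply]
  refine contDiff_schurShift (fun j => ?_) _ _
  refine ContDiff.add (D.contDiff_scaledSeq contDiff_fst ?_ ?_ _ _ _) contDiff_const
  · exact contDiff_const.add (contDiff_fst.mul ((contDiff_fst.comp contDiff_snd).sub contDiff_const))
  · exact contDiff_const.add (contDiff_fst.mul ((contDiff_snd.comp contDiff_snd).sub contDiff_const))

theorem localDet_eq (f : Fin (m + 1) → ℕ) (z₀ : ℂ) (g : ℕ → ℂ) (p₁ p₂ : ℝ × ℝ) {δ : ℝ}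
    (hδ : δ ≠ 0) (p : ℝ × ℝ) :
    (δ : ℂ) ^ (∑ i, f i) * D.localDet J f z₀ g p₁ p₂ (δ, p) = (δ : ℂ) ^ (∑ r, J r) *
      D.minorDet J (z₀ * (δ⁻¹ : ℝ)) g f (δ⁻¹ * p₁.1 - p₂.1 + p.1) (δ⁻¹ * p₁.2 - p₂.2 + p.2) := by
  have hδ' : (δ : ℂ) ≠ 0 := Complex.ofReal_ne_zero.2 hδ
  rw [minorDet, ← det_geometric_scale J f (c := (δ : ℂ)) (z₀ * (δ⁻¹ : ℝ))
    (fun i j hj => D.scaledSeq_eq δ (δ⁻¹ * p₁.1 - p₂.1 + p.1) (δ⁻¹ * p₁.2 - p₂.2 + p.2) (f i) g hj)]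
  have h1 : (δ : ℂ) * (z₀ * (δ⁻¹ : ℝ)) = z₀ := by push_cast; field_simp
  have h2 : ∀ a b c : ℝ, δ * (δ⁻¹ * a - b + c) = a + δ * (c - b) := by
    intro a b c
    field_simp
    ring
  rw [h1, h2, h2]
  rfl

theorem localDet_zero (hn : 1 ≤ n) (f : Fin (m + 1) → ℕ) (z₀ : ℂ) (g : ℕ → ℂ) (p₁ p₂ p : ℝ × ℝ) :
    D.localDet J f z₀ g p₁ p₂ (0, p) = colDet J z₀ f (D.coord p₁.1 p₁.2) := by
  simp only [localDet, D.scaledSeq_zero hn, colDet, zero_mul, add_zero]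

/-- The exponent $j$ starts at order $\delta^{j-1}$, so only $j=1,2$ vary to first order. The row
index $v$ drops out because $h_{1,1}=0$. -/
theorem hasDerivAt_scaledSeq (hn : 1 ≤ n) (v : ℕ) (g : ℕ → ℂ) (p₁ p₂ p : ℝ × ℝ) (j : ℕ) :
    HasDerivAt (fun δ : ℝ => D.scaledSeq δ (p₁.1 + δ * (p.1 - p₂.1)) (p₁.2 + δ * (p.2 - p₂.2)) v g j)
      (if j = 1 then D.coord (p.1 - p₂.1) (p.2 - p₂.2) + g 1 else if j = 2 then
        D.alpha 2 * p₁.1 + Complex.I * D.beta 2 * p₁.2 else 0) 0 := by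
  have hid : HasDerivAt (fun δ : ℝ => (δ : ℂ)) 1 0 := Complex.ofRealCLM.hasDerivAt
  have key : ∀ (k : ℕ) (a b c : ℂ), HasDerivAt (fun δ : ℝ => (δ : ℂ) ^ k * (a + δ * b) +
      (δ : ℂ) ^ (k + 1) * c) (if k = 0 then b + c else if k = 1 then a else 0) 0 := by
    intro k a b c
    have h := ((hid.fun_pow k).mul ((hasDerivAt_const (0 : ℝ) a).add (hid.mul_const b))).add
      ((hid.fun_pow (k + 1)).mul_const c)
    refine h.congr_deriv ?_
    rcases k with _ | _ | k <;> simp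
  rcases j with _ | j
  · simpa [scaledSeq] using hasDerivAt_const (0 : ℝ) (0 : ℂ)
  · have h := key j (D.alpha (j + 1) * p₁.1 + Complex.I * D.beta (j + 1) * p₁.2)
      (D.alpha (j + 1) * ((p.1 - p₂.1 : ℝ) : ℂ) + Complex.I * D.beta (j + 1) * ((p.2 - p₂.2 : ℝ) : ℂ))
      ((v : ℂ) * D.h1 (j + 1) + g (j + 1))
    have e : (fun δ : ℝ => D.scaledSeq δ (p₁.1 + δ * (p.1 - p₂.1)) (p₁.2 + δ * (p.2 - p₂.2)) v g
        (j + 1)) = fun δ : ℝ => (δ : ℂ) ^ j * ((D.alpha (j + 1) * p₁.1 +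
          Complex.I * D.beta (j + 1) * p₁.2) + δ * (D.alpha (j + 1) * ((p.1 - p₂.1 : ℝ) : ℂ) +
          Complex.I * D.beta (j + 1) * ((p.2 - p₂.2 : ℝ) : ℂ))) +
          (δ : ℂ) ^ (j + 1) * ((v : ℂ) * D.h1 (j + 1) + g (j + 1)) := by
      ext δ
      simp only [scaledSeq, Nat.succ_ne_zero, if_false, Nat.add_sub_cancel]
      push_cast
      ring
    rw [e]
    refine h.congr_deriv ?_
    rcases j with _ | _ | j
    · simp only [if_true, zero_add, D.h1_one hn, ← D.alpha_one_add hn]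
      ring
    · simp
    · simp

/-- The exponent $j=2$ contributes the two determinants with a row raised by two. The condition on
$\sigma$ makes the shift of the centre cancel exactly this contribution, which is the origin of the
correction with $W^{[2]}/W'$. -/
theorem hasDerivAt_localDet (hn : 1 ≤ n) {z₀ ζ σ : ℂ} (g : ℕ → ℂ)
    (hσ : σ * colDet J z₀ (bumpLast m) ζ =
      (D.alpha 2 * (D.point ζ).1 + Complex.I * D.beta 2 * (D.point ζ).2) *
        ((if m = 0 then 0 else colDet J z₀ (bumpPenult m) ζ) + colDet J z₀ (bumpLastTwo m) ζ))
    (p : ℝ × ℝ) :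
    HasDerivAt (fun δ => D.localDet J (fun i => i) z₀ g (D.point ζ) (D.point σ) (δ, p))
      ((D.coord p.1 p.2 + g 1) * colDet J z₀ (bumpLast m) ζ) 0 := by
  set z : ℕ → ℂ := fun j => (if j = 1 then ζ else 0) + z₀ ^ j / (j : ℂ) with hz
  have h0 : ∀ (v j : ℕ), D.scaledSeq 0 ((D.point ζ).1 + 0 * (p.1 - (D.point σ).1))
      ((D.point ζ).2 + 0 * (p.2 - (D.point σ).2)) v g j + z₀ ^ j / (j : ℂ) = z j := by
    intro v j
    rw [D.scaledSeq_zero hn, zero_mul, zero_mul, add_zero, add_zero, D.coord_point hn]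
  have h := hasDerivAt_det_shift (t := 0)
    (M := fun δ => Matrix.of fun (i r : Fin (m + 1)) => schurShift (fun j => D.scaledSeq δ
      ((D.point ζ).1 + δ * (p.1 - (D.point σ).1)) ((D.point ζ).2 + δ * (p.2 - (D.point σ).2)) i g j +
      z₀ ^ j / (j : ℂ)) i (J r))
    (G := fun v r => schurShift z v (J r))
    (s₁ := D.coord (p.1 - (D.point σ).1) (p.2 - (D.point σ).2) + g 1)
    (s₂ := D.alpha 2 * (D.point ζ).1 + Complex.I * D.beta 2 * (D.point ζ).2)
    (fun i r => by simp only [Matrix.of_apply, h0])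
    (fun i r => by
      simp only [Matrix.of_apply]
      have hd := hasDerivAt_schurShift (t := 0) (z := fun δ j => D.scaledSeq δ
        ((D.point ζ).1 + δ * (p.1 - (D.point σ).1)) ((D.point ζ).2 + δ * (p.2 - (D.point σ).2)) i g j +
        z₀ ^ j / (j : ℂ))
        (fun j => (D.hasDerivAt_scaledSeq hn i g (D.point ζ) (D.point σ) p j).add_const _) i (J r)
      simp only [h0] at hd
      exact hd)
  refine h.congr_deriv ?_
  rw [D.coord_sub, D.coord_point hn]
  have e : ∀ f : Fin (m + 1) → ℕ, (Matrix.of fun i r => schurShift z (f i) (J r)).det =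
      colDet J z₀ f ζ := fun f => rfl
  rw [e, e, e]
  linear_combination -hσ

/-- The convergence to a first-order wave near a simple root. -/
theorem rateOn_near_simple (hn : 1 ≤ n) (hJ : StrictMono J) (hL : J (Fin.last m) < L) {z₀ ζ σ : ℂ}
    (hζ : colDet J z₀ (fun i => i) ζ = 0) (hζ' : colDet J z₀ (bumpLast m) ζ ≠ 0)
    (hσ : σ * colDet J z₀ (bumpLast m) ζ =
      (D.alpha 2 * (D.point ζ).1 + Complex.I * D.beta 2 * (D.point ζ).2) *
        ((if m = 0 then 0 else colDet J z₀ (bumpPenult m) ζ) + colDet J z₀ (bumpLastTwo m) ζ))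
    (g : ℕ → ℂ) (R : ℝ) :
    RateOn (Metric.closedBall (0 : ℝ × ℝ) R)
      (fun δ p => D.waveSum J (L + 1) (z₀ * (δ⁻¹ : ℝ)) g (δ⁻¹ * (D.point ζ).1 - (D.point σ).1 + p.1)
          (δ⁻¹ * (D.point ζ).2 - (D.point σ).2 + p.2) /
        D.waveSum J (L + 1) (z₀ * (δ⁻¹ : ℝ)) 0 (δ⁻¹ * (D.point ζ).1 - (D.point σ).1 + p.1)
          (δ⁻¹ * (D.point ζ).2 - (D.point σ).2 + p.2))
      (fun p => (star (D.coord p.1 p.2 + g 1) * (D.coord p.1 p.2 - g 1) + D.C1) /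
        (star (D.coord p.1 p.2) * D.coord p.1 p.2 + D.C1)) := by
  set B := Metric.closedBall (0 : ℝ × ℝ) R with hBdef
  have hB : IsCompact B := isCompact_closedBall _ _
  have hBc : Convex ℝ B := convex_closedBall _ _
  set S₀ : ℕ := ∑ i : Fin (m + 1), (i : ℕ) with hS₀
  set V₀ : Fin (m + 1) → ℕ := fun i => i with hV₀
  set P := colDet J z₀ (bumpLast m) ζ with hP
  set φ : (ℕ → ℂ) → (Fin (m + 1) → ℕ) → ℝ × (ℝ × ℝ) → ℂ := fun g f =>
    D.localDet J f z₀ g (D.point ζ) (D.point σ) with hφ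
  -- The weighted minor divided by $\delta^{S_0+1}$. For the rows $0,\dots,m$ the missing power
  -- comes from the vanishing of the minor at the root.
  set T : (ℕ → ℂ) → (Fin (m + 1) → ℕ) → ℝ → ℝ × ℝ → ℂ := fun g f δ p =>
    if f = V₀ then φ g f (δ, p) / (δ : ℂ) else
      (δ : ℂ) ^ (∑ i, f i - (S₀ + 1)) * φ g f (δ, p) with hT
  set T₀ : (ℕ → ℂ) → (Fin (m + 1) → ℕ) → ℝ × ℝ → ℂ := fun g f p =>
    if f = V₀ then (D.coord p.1 p.2 + g 1) * P else if f = bumpLast m then P else 0 with hT₀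
  have hTrate : ∀ g, ∀ f ∈ strictMonoFns (m + 1) (L + 1), RateOn B (T g f) (T₀ g f) := by
    intro g f hf
    by_cases h1 : f = V₀
    · subst h1
      simp only [hT, hT₀, if_true]
      refine rateOn_div_delta (D.contDiff_localDet _ _ _ _ _) hB hBc (fun p => ?_)
        (D.hasDerivAt_localDet hn g hσ)
      rw [D.localDet_zero hn, D.coord_point hn, hζ]
    · have hr := rateOn_of_contDiff
        ((D.contDiff_localDet (J := J) f z₀ g (D.point ζ) (D.point σ)).of_le one_le_two) hB hBc
      simp only [hT, hT₀, if_neg h1]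
      by_cases h2 : f = bumpLast m
      · subst h2
        rw [sum_bumpLast, Nat.sub_self]
        simp only [pow_zero, one_mul, if_true]
        simp only [D.localDet_zero hn, D.coord_point hn] at hr
        exact hr
      · simp only [if_neg h2]
        have h3 : S₀ + 2 ≤ ∑ i, f i := by
          rcases strictMono_trichotomy (mem_strictMonoFns.1 hf).2 with h | h | h
          · exact absurd h h1
          · exact absurd h h2
          · exact h
        have hpow : ∀ k : ℕ, RateOn B (fun δ p => (δ : ℂ) ^ (k + 1) * φ g f (δ, p)) fun _ => 0 := by
          intro k
          induction k with
          | zero => simpa using hr.delta_mul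
          | succ k ih =>
            have := ih.delta_mul
            simp only [← mul_assoc, ← pow_succ'] at this
            exact this
        have h4 := hpow (∑ i, f i - (S₀ + 1) - 1)
        rw [show ∑ i, f i - (S₀ + 1) - 1 + 1 = ∑ i, f i - (S₀ + 1) by omega] at h4
        exact h4
  have hminor : ∀ g, ∀ f ∈ strictMonoFns (m + 1) (L + 1), ∀ δ : ℝ, 0 < δ → ∀ p : ℝ × ℝ,
      (δ : ℂ) ^ (∑ r, J r) * D.minorDet J (z₀ * (δ⁻¹ : ℝ)) g f
        (δ⁻¹ * (D.point ζ).1 - (D.point σ).1 + p.1) (δ⁻¹ * (D.point ζ).2 - (D.point σ).2 + p.2) =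
      (δ : ℂ) ^ (S₀ + 1) * T g f δ p := by
    intro g f hf δ hδ p
    have hδ' : (δ : ℂ) ≠ 0 := Complex.ofReal_ne_zero.2 hδ.ne'
    rw [← D.localDet_eq f z₀ g (D.point ζ) (D.point σ) hδ.ne' p]
    simp only [hT]
    split_ifs with h1
    · subst h1
      rw [pow_succ]
      field_simp
      rfl
    · rw [← mul_assoc, ← pow_add]
      congr 2
      have := sum_ge_succ (mem_strictMonoFns.1 hf).2 h1
      omega
  have hwave : ∀ g, ∀ δ : ℝ, 0 < δ → ∀ p : ℝ × ℝ,
      (δ : ℂ) ^ (2 * ∑ r, J r) * D.waveSum J (L + 1) (z₀ * (δ⁻¹ : ℝ)) g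
        (δ⁻¹ * (D.point ζ).1 - (D.point σ).1 + p.1) (δ⁻¹ * (D.point ζ).2 - (D.point σ).2 + p.2) =
      (δ : ℂ) ^ (2 * (S₀ + 1)) * ∑ f ∈ strictMonoFns (m + 1) (L + 1),
        (D.C1 : ℂ) ^ (∑ i, f i) * star (T g f δ p) * T (-g) f δ p := by
    intro g δ hδ p
    rw [waveSum, mul_sum (strictMonoFns _ _), mul_sum (strictMonoFns _ _)]
    refine sum_congr rfl fun f hf => ?_
    have e1 := hminor g f hf δ hδ p
    have e2 := hminor (-g) f hf δ hδ p
    have hs : star (δ : ℂ) = δ := by rw [← starRingEnd_apply, Complex.conj_ofReal]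
    have e3 := congrArg star e1
    rw [star_mul', star_mul', star_pow, star_pow, hs] at e3
    calc _ = (D.C1 : ℂ) ^ (∑ i, f i) * ((δ : ℂ) ^ (∑ r, J r) * star (D.minorDet J (z₀ * (δ⁻¹ : ℝ)) g f
        (δ⁻¹ * (D.point ζ).1 - (D.point σ).1 + p.1) (δ⁻¹ * (D.point ζ).2 - (D.point σ).2 + p.2))) *
        ((δ : ℂ) ^ (∑ r, J r) * D.minorDet J (z₀ * (δ⁻¹ : ℝ)) (-g) f
        (δ⁻¹ * (D.point ζ).1 - (D.point σ).1 + p.1) (δ⁻¹ * (D.point ζ).2 - (D.point σ).2 + p.2)) := by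
          ring
      _ = _ := by rw [e2, e3]; ring
  have hsumrate : ∀ g, RateOn B (fun δ p => ∑ f ∈ strictMonoFns (m + 1) (L + 1),
      (D.C1 : ℂ) ^ (∑ i, f i) * star (T g f δ p) * T (-g) f δ p)
      (fun p => (D.C1 : ℂ) ^ S₀ * (star P * P) *
        (star (D.coord p.1 p.2 + g 1) * (D.coord p.1 p.2 - g 1) + D.C1)) := by
    intro g
    have h := RateOn.sum (B := B) (strictMonoFns (m + 1) (L + 1))
      (F := fun f δ p => (D.C1 : ℂ) ^ (∑ i, f i) * star (T g f δ p) * T (-g) f δ p)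
      (F₀ := fun f p => (D.C1 : ℂ) ^ (∑ i, f i) * star (T₀ g f p) * T₀ (-g) f p) fun f hf =>
      ((RateOn.const B ((D.C1 : ℂ) ^ (∑ i, f i))).mul (hTrate g f hf).star).mul (hTrate (-g) f hf)
    have e : ∀ p : ℝ × ℝ, ∑ f ∈ strictMonoFns (m + 1) (L + 1), (D.C1 : ℂ) ^ (∑ i, f i) *
        star (T₀ g f p) * T₀ (-g) f p = (D.C1 : ℂ) ^ S₀ * (star P * P) *
        (star (D.coord p.1 p.2 + g 1) * (D.coord p.1 p.2 - g 1) + D.C1) := by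
      intro p
      -- Exactly two row sequences survive; the extra factor $C_1$ of the second one becomes the
      -- constant term of the limit.
      have hs := Finset.sum_eq_add_of_mem (s := strictMonoFns (m + 1) (L + 1))
        (f := fun f : Fin (m + 1) → ℕ =>
          (D.C1 : ℂ) ^ (∑ i, f i) * star (T₀ g f p) * T₀ (-g) f p) V₀ (bumpLast m)
        (val_mem hJ hL) (bumpLast_mem hJ hL) bumpLast_ne_val.symm (by
          intro f _ hf
          simp only [hT₀, if_neg hf.1, if_neg hf.2]
          simp)
      rw [hs]
      have hne : bumpLast m ≠ V₀ := bumpLast_ne_val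
      simp only [hT₀, if_true, if_neg hne, sum_bumpLast, Pi.neg_apply, star_mul']
      rw [← hS₀, pow_succ]
      ring
    simp only [e] at h
    exact h
  have hC := D.C1_ne hn
  have hlow : ∀ p ∈ B, D.C1 ^ S₀ * ‖P‖ ^ 2 * D.C1 ≤ ‖(D.C1 : ℂ) ^ S₀ * (star P * P) *
      (star (D.coord p.1 p.2 + (0 : ℕ → ℂ) 1) * (D.coord p.1 p.2 - (0 : ℕ → ℂ) 1) + D.C1)‖ := by
    intro p _
    have e : (D.C1 : ℂ) ^ S₀ * (star P * P) *
      (star (D.coord p.1 p.2 + (0 : ℕ → ℂ) 1) * (D.coord p.1 p.2 - (0 : ℕ → ℂ) 1) + D.C1) =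
      ((D.C1 ^ S₀ * ‖P‖ ^ 2 * (‖D.coord p.1 p.2‖ ^ 2 + D.C1) : ℝ) : ℂ) := by
      simp only [Pi.zero_apply, add_zero, sub_zero]
      rw [← starRingEnd_apply, ← starRingEnd_apply, Complex.conj_mul', Complex.conj_mul']
      push_cast
      ring
    rw [e, Complex.norm_real, Real.norm_of_nonneg (by positivity)]
    refine mul_le_mul_of_nonneg_left ?_ (by positivity)
    have := sq_nonneg ‖D.coord p.1 p.2‖
    linarith
  have hPpos : 0 < ‖P‖ := norm_pos_iff.2 hζ'
  have hdiv := (hsumrate g).div (hsumrate 0) (by positivity) hlow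
  have e : ∀ p : ℝ × ℝ, (D.C1 : ℂ) ^ S₀ * (star P * P) *
        (star (D.coord p.1 p.2 + g 1) * (D.coord p.1 p.2 - g 1) + D.C1) /
      ((D.C1 : ℂ) ^ S₀ * (star P * P) *
        (star (D.coord p.1 p.2 + (0 : ℕ → ℂ) 1) * (D.coord p.1 p.2 - (0 : ℕ → ℂ) 1) + D.C1)) =
      (star (D.coord p.1 p.2 + g 1) * (D.coord p.1 p.2 - g 1) + D.C1) /
        (star (D.coord p.1 p.2) * D.coord p.1 p.2 + D.C1) := by
    intro p
    rw [mul_div_mul_left]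
    · simp
    · exact mul_ne_zero (pow_ne_zero _ (Complex.ofReal_ne_zero.2 hC.ne'))
        (mul_ne_zero (star_ne_zero.2 hζ') hζ')
  simp only [e] at hdiv
  refine hdiv.congr fun δ hδ p _ => ?_
  have hδ' : (δ : ℂ) ≠ 0 := Complex.ofReal_ne_zero.2 hδ.ne'
  rw [← mul_div_mul_left _ _ (pow_ne_zero (2 * ∑ r, J r) hδ'), hwave g δ hδ p, hwave 0 δ hδ p,
    mul_div_mul_left _ _ (pow_ne_zero _ hδ')]

end Core

end SpectralData

/-! ### Estimates far from all roots. -/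

theorem exists_pos_forall_le {ι : Type*} (s : Finset ι) (f : ι → ℝ) (h : ∀ i ∈ s, 0 < f i) :
    ∃ d : ℝ, 0 < d ∧ ∀ i ∈ s, d ≤ f i := by
  classical
  induction s using Finset.induction_on with
  | empty => exact ⟨1, one_pos, by simp⟩
  | insert a s ha ih =>
    obtain ⟨d, hd, h'⟩ := ih fun i hi => h i (mem_insert_of_mem hi)
    refine ⟨min d (f a), lt_min hd (h a (mem_insert_self a s)), fun i hi => ?_⟩
    rcases mem_insert.1 hi with rfl | hi
    · exact min_le_right _ _
    · exact (min_le_left _ _).trans (h' i hi)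

theorem exists_pos_forall_ge {ι : Type*} (s : Finset ι) (f : ι → ℝ) :
    ∃ K : ℝ, 0 < K ∧ ∀ i ∈ s, f i ≤ K := by
  refine ⟨∑ i ∈ s, |f i| + 1, by positivity, fun i hi => ?_⟩
  have h1 := single_le_sum (f := fun i => |f i|) (fun i _ => abs_nonneg _) hi
  have h2 := le_abs_self (f i)
  linarith

/-- A point that keeps a distance from all the points `ζ A` is close to at most one of them on the
scale `A + ρ`. -/
theorem exists_prod_lower_bound (S : Finset ℂ) (hS : ∀ ζ ∈ S, ζ ≠ 0) {lo up : ℝ} (hlo : 0 < lo)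
    (hup : 0 < up) : ∃ c : ℝ, 0 < c ∧ ∀ (A ρ R : ℝ) (W : ℂ), 0 < A → 0 < ρ → 0 < R → lo * ρ ≤ ‖W‖ →
      ‖W‖ ≤ up * ρ → R ≤ ρ → (∀ ζ ∈ S, R ≤ ‖W - ζ * A‖) →
      c * R ≤ ρ * ∏ ζ ∈ S, (‖W - ζ * A‖ / (A + ρ)) := by
  obtain ⟨d, hd, hdS⟩ := exists_pos_forall_le S (fun ζ => ‖ζ‖) fun ζ hζ => norm_pos_iff.2 (hS ζ hζ)
  obtain ⟨s, hs, hsS⟩ := exists_pos_forall_le (S ×ˢ S |>.filter fun x => x.1 ≠ x.2)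
    (fun x => ‖x.1 - x.2‖) fun x hx => norm_pos_iff.2 (sub_ne_zero.2 (mem_filter.1 hx).2)
  obtain ⟨Z, hZ, hZS⟩ := exists_pos_forall_ge S fun ζ => ‖ζ‖
  set C := 2 * (Z + 1) / lo with hC
  have hCpos : 0 < C := by positivity
  -- If one factor is below $c$, the bounds $lo/2$ and $d/2$ force $A$ and $\rho$ to be comparable.
  -- A second such factor would give $|\zeta-\zeta'|A<2c(1+C)A\le sA$, against the separation $s$.
  obtain ⟨c, hc, hcle⟩ := exists_pos_forall_le (univ : Finset (Fin 4))
    ![1, lo / 2, d / 2, s / (2 * (1 + C))] fun i _ => by fin_cases i <;> simp <;> positivity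
  have hc1 : c ≤ 1 := hcle 0 (mem_univ _)
  have hc2 : c ≤ lo / 2 := hcle 1 (mem_univ _)
  have hc3 : c ≤ d / 2 := hcle 2 (mem_univ _)
  have hc4 : c ≤ s / (2 * (1 + C)) := hcle 3 (mem_univ _)
  set c6 := (2 * (up + 1) / d + 1)⁻¹ with hc6
  have hc6pos : 0 < c6 := by positivity
  have hc61 : c6 ≤ 1 := inv_le_one_of_one_le₀ (by
    have : 0 < 2 * (up + 1) / d := by positivity
    linarith)
  refine ⟨c ^ S.card * c6, by positivity, fun A ρ R W hA hρ hR h1 h2 h3 h4 => ?_⟩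
  have hAρ : 0 < A + ρ := by positivity
  by_cases hall : ∀ ζ ∈ S, c ≤ ‖W - ζ * A‖ / (A + ρ)
  · have hp : c ^ S.card ≤ ∏ ζ ∈ S, (‖W - ζ * A‖ / (A + ρ)) := by
      rw [← prod_const]
      exact prod_le_prod (fun _ _ => hc.le) hall
    calc c ^ S.card * c6 * R ≤ c ^ S.card * 1 * ρ := by gcongr
      _ = ρ * c ^ S.card := by ring
      _ ≤ _ := mul_le_mul_of_nonneg_left hp hρ.le
  · push Not at hall
    obtain ⟨ζ, hζ, hlt⟩ := hall
    rw [div_lt_iff₀ hAρ] at hlt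
    have hn : ‖ζ * A‖ = ‖ζ‖ * A := by rw [norm_mul, Complex.norm_real, Real.norm_of_nonneg hA.le]
    have e1 : ‖ζ‖ * A ≤ ‖W‖ + ‖W - ζ * A‖ := by
      rw [← hn, ← norm_neg (W - _), neg_sub]
      calc ‖ζ * A‖ = ‖W + (ζ * A - W)‖ := by congr 1; ring
        _ ≤ _ := norm_add_le _ _
    have e2 : ‖W‖ ≤ ‖ζ‖ * A + ‖W - ζ * A‖ := by
      rw [← hn]
      calc ‖W‖ = ‖ζ * A + (W - ζ * A)‖ := by congr 1; ring
        _ ≤ _ := norm_add_le _ _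
    have hdζ := hdS ζ hζ
    have hZζ := hZS ζ hζ
    have e3 : c6 * (A + ρ) ≤ ρ := by
      have : d / 2 * A ≤ (up + 1) * ρ := by nlinarith
      rw [hc6, inv_mul_le_iff₀ (by positivity)]
      have e : (2 * (up + 1) / d + 1) * ρ = (up + 1) * ρ * (2 / d) + ρ := by ring
      rw [e]
      have : A ≤ (up + 1) * ρ * (2 / d) := by
        calc A = d / 2 * A * (2 / d) := by field_simp
          _ ≤ _ := mul_le_mul_of_nonneg_right this (by positivity)
      linarith
    have e4 : ρ ≤ C * A := by
      have : lo / 2 * ρ ≤ (Z + 1) * A := by nlinarith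
      calc ρ = lo / 2 * ρ * (2 / lo) := by field_simp
        _ ≤ (Z + 1) * A * (2 / lo) := mul_le_mul_of_nonneg_right this (by positivity)
        _ = C * A := by rw [hC]; ring
    have hother : ∀ ζ' ∈ S.erase ζ, c ≤ ‖W - ζ' * A‖ / (A + ρ) := by
      intro ζ' hζ'
      rw [le_div_iff₀ hAρ]
      by_contra hlt'
      push Not at hlt'
      have hsζ := hsS (ζ, ζ') (mem_filter.2 ⟨mem_product.2 ⟨hζ, (mem_erase.1 hζ').2⟩,
        (mem_erase.1 hζ').1.symm⟩)
      simp only at hsζ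
      have hd1 : ‖ζ - ζ'‖ * A ≤ ‖W - ζ' * A‖ + ‖W - ζ * A‖ := by
        calc ‖ζ - ζ'‖ * A = ‖(W - ζ' * A) - (W - ζ * A)‖ := by
              rw [sub_sub_sub_cancel_left, ← sub_mul, norm_mul, Complex.norm_real,
                Real.norm_of_nonneg hA.le]
          _ ≤ _ := norm_sub_le _ _
      have hd2 : c * (2 * (1 + C)) ≤ s := by rwa [le_div_iff₀ (by positivity)] at hc4
      nlinarith [mul_le_mul_of_nonneg_right hsζ hA.le, mul_le_mul_of_nonneg_right hd2 hA.le,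
        mul_le_mul_of_nonneg_left e4 hc.le]
    -- The single small factor is bounded below by $R/(A+\rho)$, and `c6` bounds $\rho/(A+\rho)$
    -- from below.
    have hp : c ^ S.card ≤ ∏ ζ' ∈ S.erase ζ, (‖W - ζ' * A‖ / (A + ρ)) := by
      calc c ^ S.card ≤ c ^ (S.erase ζ).card := pow_le_pow_of_le_one hc.le hc1
            (card_le_card (erase_subset _ _))
        _ = ∏ _ζ' ∈ S.erase ζ, c := (prod_const _).symm
        _ ≤ _ := prod_le_prod (fun _ _ => hc.le) hother
    rw [← mul_prod_erase _ _ hζ]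
    calc c ^ S.card * c6 * R = c6 * (R * c ^ S.card) := by ring
      _ ≤ (ρ / (A + ρ)) * (‖W - ζ * A‖ * ∏ ζ' ∈ S.erase ζ, (‖W - ζ' * A‖ / (A + ρ))) := by
        refine mul_le_mul ((le_div_iff₀ hAρ).2 e3) (mul_le_mul (h4 ζ hζ) hp (by positivity)
          (norm_nonneg _)) (by positivity) (by positivity)
      _ = _ := by ring

/-- Numerator and denominator have the same leading part. The denominator is at least a quarter of
$c_{f_0}|P|^2$ by positivity, and each of the two deviations costs $\tfrac52\eta|P|^2$ per weight,
whence the factor $20$. -/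
theorem norm_ratio_sub_one_le {ι : Type*} {s : Finset ι} {c : ι → ℝ} (hc : ∀ f, 0 < c f) {f₀ : ι}
    (hf₀ : f₀ ∈ s) {P : ℂ} (hP : P ≠ 0) {e : ι → ℂ} (he₀ : e f₀ = 1)
    (he : ∀ f ∈ s, e f = 0 ∨ e f = 1) {η : ℝ} (hη : η ≤ 1 / 2) {x y z : ι → ℂ}
    (hx : ∀ f ∈ s, ‖x f - e f * P‖ ≤ η * ‖P‖) (hy : ∀ f ∈ s, ‖y f - e f * P‖ ≤ η * ‖P‖)
    (hz : ∀ f ∈ s, ‖z f - e f * P‖ ≤ η * ‖P‖) :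
    ‖(∑ f ∈ s, (c f : ℂ) * star (x f) * y f) / (∑ f ∈ s, (c f : ℂ) * star (z f) * z f) - 1‖ ≤
      20 * (∑ f ∈ s, c f) / c f₀ * η := by
  have hPpos : 0 < ‖P‖ := norm_pos_iff.2 hP
  have hη0 : 0 ≤ η := by
    by_contra h
    push Not at h
    have := (norm_nonneg _).trans (hx f₀ hf₀)
    nlinarith
  have hen : ∀ f ∈ s, ‖e f‖ ≤ 1 := fun f hf => by rcases he f hf with h | h <;> simp [h]
  have key : ∀ f ∈ s, ∀ a b : ℂ, ‖a - e f * P‖ ≤ η * ‖P‖ → ‖b - e f * P‖ ≤ η * ‖P‖ →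
      ‖star a * b - star (e f * P) * (e f * P)‖ ≤ 5 / 2 * η * ‖P‖ ^ 2 := by
    intro f hf a b ha hb
    have heP : ‖e f * P‖ ≤ ‖P‖ := by
      rw [norm_mul]
      exact mul_le_of_le_one_left hPpos.le (hen f hf)
    have hb' : ‖b‖ ≤ 3 / 2 * ‖P‖ := by
      calc ‖b‖ = ‖(b - e f * P) + e f * P‖ := by congr 1; ring
        _ ≤ η * ‖P‖ + ‖P‖ := (norm_add_le _ _).trans (add_le_add hb heP)
        _ ≤ _ := by nlinarith
    calc ‖star a * b - star (e f * P) * (e f * P)‖ =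
          ‖star (a - e f * P) * b + star (e f * P) * (b - e f * P)‖ := by
            rw [star_sub]; congr 1; ring
      _ ≤ ‖a - e f * P‖ * ‖b‖ + ‖e f * P‖ * ‖b - e f * P‖ := by
        refine (norm_add_le _ _).trans ?_
        rw [norm_mul, norm_mul, norm_star, norm_star]
      _ ≤ η * ‖P‖ * (3 / 2 * ‖P‖) + ‖P‖ * (η * ‖P‖) := by gcongr
      _ = _ := by ring
  set Q := ∑ f ∈ s, (c f : ℂ) * star (z f) * z f with hQ
  have hden : c f₀ * ‖P‖ ^ 2 / 4 ≤ ‖Q‖ := by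
    rw [hQ, sum_weight_norm_sq, Complex.norm_real]
    refine le_trans ?_ (le_abs_self _)
    have h1 := single_le_sum (f := fun f => c f * ‖z f‖ ^ 2)
      (fun f _ => mul_nonneg (hc f).le (sq_nonneg _)) hf₀
    refine le_trans ?_ h1
    have h2 : ‖P‖ / 2 ≤ ‖z f₀‖ := by
      have h3 := hz f₀ hf₀
      rw [he₀, one_mul] at h3
      have h4 : ‖P‖ ≤ ‖z f₀‖ + ‖z f₀ - P‖ := by
        rw [norm_sub_rev]
        calc ‖P‖ = ‖z f₀ + (P - z f₀)‖ := by congr 1; ring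
          _ ≤ _ := norm_add_le _ _
      nlinarith
    have h5 : (‖P‖ / 2) ^ 2 ≤ ‖z f₀‖ ^ 2 := pow_le_pow_left₀ (by positivity) h2 2
    have := mul_le_mul_of_nonneg_left h5 (hc f₀).le
    linarith
  have hpos : 0 < c f₀ * ‖P‖ ^ 2 / 4 := by have := hc f₀; positivity
  have hQne : Q ≠ 0 := norm_pos_iff.1 (hpos.trans_le hden)
  have hnum : ‖(∑ f ∈ s, (c f : ℂ) * star (x f) * y f) - Q‖ ≤ ∑ f ∈ s, c f * (5 * η * ‖P‖ ^ 2) := by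
    rw [hQ, ← sum_sub_distrib]
    refine norm_sum_le_of_le _ fun f hf => ?_
    have h1 := key f hf _ _ (hx f hf) (hy f hf)
    have h2 := key f hf _ _ (hz f hf) (hz f hf)
    calc ‖(c f : ℂ) * star (x f) * y f - (c f : ℂ) * star (z f) * z f‖ =
          c f * ‖(star (x f) * y f - star (e f * P) * (e f * P)) -
            (star (z f) * z f - star (e f * P) * (e f * P))‖ := by
            nth_rw 3 [← Real.norm_of_nonneg (hc f).le]
            rw [← Complex.norm_real, ← norm_mul]
            congr 1
            ring
      _ ≤ _ := by
        refine mul_le_mul_of_nonneg_left ((norm_sub_le _ _).trans ?_) (hc f).le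
        linarith
  rw [div_sub_one hQne, norm_div]
  calc _ ≤ (∑ f ∈ s, c f * (5 * η * ‖P‖ ^ 2)) / (c f₀ * ‖P‖ ^ 2 / 4) :=
        div_le_div₀ (sum_nonneg fun f _ => mul_nonneg (hc f).le (by positivity)) hnum hpos hden
    _ = _ := by
      have := (hc f₀).ne'
      rw [← sum_mul]
      field_simp
      ring

namespace SpectralData

variable {n : ℕ} (D : SpectralData n)

/-- The coordinate is a real-linear isomorphism of the plane, since $\operatorname{Im}\chi_0\ne0$
and $\chi^{[1]}\ne0$. -/
theorem exists_norm_coord_bounds (hn : 1 ≤ n) : ∃ lo up : ℝ, 0 < lo ∧ 0 < up ∧ ∀ ξ η : ℝ,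
    lo * √(ξ ^ 2 + η ^ 2) ≤ ‖D.coord ξ η‖ ∧ ‖D.coord ξ η‖ ≤ up * √(ξ ^ 2 + η ^ 2) := by
  have hi := abs_pos.2 D.c0_im_ne
  have h1 : 0 < ‖D.c1‖ := norm_pos_iff.2 (D.c1_relations hn).1
  have hcoord : ∀ ξ η : ℝ, D.coord ξ η = Complex.I * D.c1 * (ξ + D.c0 * η) := fun ξ η => rfl
  have hnorm : ∀ ξ η : ℝ, ‖D.coord ξ η‖ = ‖D.c1‖ * ‖(ξ : ℂ) + D.c0 * η‖ := by
    intro ξ η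
    rw [hcoord, norm_mul, norm_mul, Complex.norm_I, one_mul]
  set k := 1 + (1 + ‖D.c0‖) / |D.c0.im| with hk
  have hkpos : 0 < k := by positivity
  refine ⟨‖D.c1‖ / k, ‖D.c1‖ * (1 + ‖D.c0‖), by positivity, by positivity, fun ξ η => ?_⟩
  have hξ : |ξ| ≤ √(ξ ^ 2 + η ^ 2) := Real.abs_le_sqrt (by nlinarith [sq_nonneg η])
  have hη : |η| ≤ √(ξ ^ 2 + η ^ 2) := Real.abs_le_sqrt (by nlinarith [sq_nonneg ξ])
  have hs : √(ξ ^ 2 + η ^ 2) ≤ |ξ| + |η| := by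
    rw [Real.sqrt_le_left (by positivity)]
    nlinarith [sq_abs ξ, sq_abs η, abs_nonneg ξ, abs_nonneg η]
  set u : ℂ := (ξ : ℂ) + D.c0 * η with hu
  have hn1 : ∀ y : ℝ, ‖D.c0 * (y : ℂ)‖ = ‖D.c0‖ * |y| := fun y => by
    rw [norm_mul, Complex.norm_real, Real.norm_eq_abs]
  rw [hnorm]
  constructor
  · have him : |D.c0.im| * |η| ≤ ‖u‖ := by
      have := Complex.abs_im_le_norm u
      simpa [hu, abs_mul] using this
    have hη' : |η| ≤ ‖u‖ / |D.c0.im| := by rwa [le_div_iff₀ hi, mul_comm]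
    have hξ' : |ξ| ≤ ‖u‖ + ‖D.c0‖ * |η| := by
      rw [← hn1, ← Real.norm_eq_abs, ← Complex.norm_real]
      calc ‖(ξ : ℂ)‖ = ‖u - D.c0 * η‖ := by congr 1; rw [hu]; ring
        _ ≤ _ := norm_sub_le _ _
    have h2 : √(ξ ^ 2 + η ^ 2) ≤ k * ‖u‖ := by
      have h3 : ‖D.c0‖ * |η| ≤ ‖D.c0‖ * (‖u‖ / |D.c0.im|) := by gcongr
      have h4 : k * ‖u‖ = ‖u‖ + ‖D.c0‖ * (‖u‖ / |D.c0.im|) + ‖u‖ / |D.c0.im| := by rw [hk]; ring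
      linarith
    rw [div_mul_eq_mul_div, div_le_iff₀ hkpos]
    nlinarith
  · have h2 : ‖u‖ ≤ |ξ| + ‖D.c0‖ * |η| := by
      rw [← hn1, ← Real.norm_eq_abs, ← Complex.norm_real]
      exact norm_add_le _ _
    have h3 : ‖D.c0‖ * |η| ≤ ‖D.c0‖ * √(ξ ^ 2 + η ^ 2) := by gcongr
    rw [mul_assoc]
    refine mul_le_mul_of_nonneg_left ?_ h1.le
    linarith

section Far

variable {m : ℕ} {J : Fin (m + 1) → ℕ} {L : ℕ}

theorem colDet_mul (z₀ y : ℂ) (A : ℂ) (f : Fin (m + 1) → ℕ) :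
    A ^ (∑ i, f i) * colDet J (z₀ * A) f (y * A) = A ^ (∑ i, J i) * colDet J z₀ f y := by
  rw [mul_comm z₀ A]
  refine det_geometric_scale J f z₀ (u := fun _ j => if j = 1 then y else 0)
    (u' := fun _ j => if j = 1 then y * A else 0) fun i j hj => ?_
  by_cases h : j = 1 <;> simp [h, mul_comm]

/-- Homogeneity under the joint scaling of $a$ and $y$ carries the factorization from $z_0$ to
$z_0A$. -/
theorem colDet_eq_prod (hJ : StrictMono J) {z₀ κ : ℂ} {Γ₀ : ℕ} {S : Finset ℂ}
    (hprod : ∀ y, colDet J z₀ (fun i => i) y = κ * y ^ Γ₀ * ∏ ζ ∈ S, (y - ζ))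
    (hcard : S.card = reducedExp J)
    (hdeg : ∑ i : Fin (m + 1), (i : ℕ) + Γ₀ = ∑ r, lowIdx J r) {A : ℝ} (hA : 0 < A) (W : ℂ) :
    colDet J (z₀ * A) (fun i => i) W = κ * W ^ Γ₀ * ∏ ζ ∈ S, (W - ζ * A) := by
  have hA' : (A : ℂ) ≠ 0 := Complex.ofReal_ne_zero.2 hA.ne'
  have h := colDet_mul (J := J) z₀ (W / A) A (fun i => i)
  rw [hprod, div_mul_cancel₀ _ hA'] at h
  have h1 : ∑ r, J r = ∑ i : Fin (m + 1), (i : ℕ) + Γ₀ + S.card := by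
    have := reducedExp_add hJ
    omega
  have h2 : (A : ℂ) ^ S.card * ∏ ζ ∈ S, (W / A - ζ) = ∏ ζ ∈ S, (W - ζ * A) := by
    rw [← prod_const, ← prod_mul_distrib]
    refine prod_congr rfl fun ζ _ => ?_
    field_simp
  refine mul_left_cancel₀ (pow_ne_zero (∑ i : Fin (m + 1), (i : ℕ)) hA') ?_
  rw [h, h1, pow_add, pow_add, ← h2, div_pow]
  field_simp

/-- The minor in the variables scaled by the distance from the multiple root. -/
def farDet (J f : Fin (m + 1) → ℕ) (z₀ : ℂ) (g : ℕ → ℂ) (x : ℝ × (ℝ × ℝ × ℝ × ℝ)) : ℂ :=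
  reducedDet J f (z₀ * x.2.2.2.1) x.2.2.2.2 fun i => D.scaledSeq x.1 x.2.1 x.2.2.1 (f i) g

theorem contDiff_farDet (f : Fin (m + 1) → ℕ) (z₀ : ℂ) (g : ℕ → ℂ) :
    ContDiff ℝ 1 (D.farDet J f z₀ g) := by
  have hc : ∀ {h : ℝ × (ℝ × ℝ × ℝ × ℝ) → ℝ}, ContDiff ℝ 1 h → ContDiff ℝ 1 fun p => (h p : ℂ) :=
    fun hf => Complex.ofRealCLM.contDiff.comp hf
  unfold farDet
  have h2 : ContDiff ℝ 1 fun x : ℝ × (ℝ × ℝ × ℝ × ℝ) => x.2.2.2 :=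
    contDiff_snd.comp (contDiff_snd.comp contDiff_snd)
  refine contDiff_reducedDet J f (contDiff_const.mul (hc (contDiff_fst.comp h2)))
    (hc (contDiff_snd.comp h2)) fun i j => D.contDiff_scaledSeq contDiff_fst
      (contDiff_fst.comp contDiff_snd) (contDiff_fst.comp (contDiff_snd.comp contDiff_snd)) _ _ _

/-- The scaled parameters of `farDet`. -/
def farPoint (A ρ ξ η : ℝ) : ℝ × ℝ × ℝ × ℝ := (ρ⁻¹ * ξ, ρ⁻¹ * η, A / (A + ρ), ρ / (A + ρ))

theorem farPoint_mem {A ρ ξ η : ℝ} (hA : 0 < A) (hρ : 0 < ρ) (h : √(ξ ^ 2 + η ^ 2) = ρ) :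
    farPoint A ρ ξ η ∈ Metric.closedBall (0 : ℝ × ℝ × ℝ × ℝ) 1 := by
  have hξ : |ξ| ≤ ρ := h ▸ Real.abs_le_sqrt (by nlinarith [sq_nonneg η])
  have hη : |η| ≤ ρ := h ▸ Real.abs_le_sqrt (by nlinarith [sq_nonneg ξ])
  rw [mem_closedBall_zero_iff]
  refine norm_prod_le_iff.2 ⟨?_, norm_prod_le_iff.2 ⟨?_, norm_prod_le_iff.2 ⟨?_, ?_⟩⟩⟩ <;>
    simp only [farPoint, Real.norm_eq_abs]
  · rw [abs_mul, abs_inv, abs_of_pos hρ, inv_mul_le_iff₀ hρ]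
    linarith
  · rw [abs_mul, abs_inv, abs_of_pos hρ, inv_mul_le_iff₀ hρ]
    linarith
  · rw [abs_of_pos (by positivity), div_le_one (by positivity)]
    linarith
  · rw [abs_of_pos (by positivity), div_le_one (by positivity)]
    linarith

/-- The scaling with $c=1/\rho$ and $q=\rho/(A+\rho)$ gives $caq=z_0A/(A+\rho)$. When $\rho$ is the
distance, all parameters stay in a fixed ball whatever the ratio of $A$ and $\rho$. -/
theorem farDet_eq (hJ : StrictMono J) (f : Fin (m + 1) → ℕ) (z₀ : ℂ) (g : ℕ → ℂ) {A ρ : ℝ}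
    (hρ : 0 < ρ) (ξ η : ℝ) :
    (ρ⁻¹ : ℂ) ^ (∑ i, f i) * D.farDet J f z₀ g (ρ⁻¹, farPoint A ρ ξ η) =
      (ρ⁻¹ : ℂ) ^ (∑ i, J i) * ((ρ / (A + ρ) : ℝ) : ℂ) ^ reducedExp J *
        D.minorDet J (z₀ * A) g f ξ η := by
  have h := reducedDet_scale hJ f (c := (ρ⁻¹ : ℂ)) (q := ((ρ / (A + ρ) : ℝ) : ℂ)) (z₀ * A)
    (u := fun i => D.rowSeq ξ η (f i) g)
    (u' := fun i => D.scaledSeq ρ⁻¹ (ρ⁻¹ * ξ) (ρ⁻¹ * η) (f i) g)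
    (fun i j hj => by rw [D.scaledSeq_eq _ _ _ _ _ hj]; push_cast; rfl)
  rw [minorDet, ← h, farDet]
  congr 2
  have h1 : (ρ : ℂ) ≠ 0 := Complex.ofReal_ne_zero.2 hρ.ne'
  simp only [farPoint]
  push_cast
  field_simp

theorem farDet_zero (hn : 1 ≤ n) (hJ : StrictMono J) (f : Fin (m + 1) → ℕ) (z₀ : ℂ) (g : ℕ → ℂ)
    {A ρ : ℝ} (hρ : 0 < ρ) (ξ η : ℝ) :
    (ρ⁻¹ : ℂ) ^ (∑ i, f i) * D.farDet J f z₀ g (0, farPoint A ρ ξ η) =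
      (ρ⁻¹ : ℂ) ^ (∑ i, J i) * ((ρ / (A + ρ) : ℝ) : ℂ) ^ reducedExp J *
        colDet J (z₀ * A) f (D.coord ξ η) := by
  have hcoord : D.coord (ρ⁻¹ * ξ) (ρ⁻¹ * η) = (ρ⁻¹ : ℂ) * D.coord ξ η := by
    simp only [coord]
    push_cast
    ring
  have h := reducedDet_scale hJ f (c := (ρ⁻¹ : ℂ)) (q := ((ρ / (A + ρ) : ℝ) : ℂ)) (z₀ * A)
    (u := fun _ j => if j = 1 then D.coord ξ η else 0)
    (u' := fun i => D.scaledSeq 0 (ρ⁻¹ * ξ) (ρ⁻¹ * η) (f i) g)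
    (fun i j hj => by
      rw [D.scaledSeq_zero hn, hcoord]
      by_cases h : j = 1 <;> simp [h])
  rw [colDet, ← h, farDet]
  congr 2
  have h1 : (ρ : ℂ) ≠ 0 := Complex.ofReal_ne_zero.2 hρ.ne'
  simp only [farPoint]
  push_cast
  field_simp

/-- For the rows $0,\dots,m$ the error is the Lipschitz bound between $1/\rho$ and $0$ on the
compact parameter set; every other row sequence has a larger sum and carries an extra factor
$1/\rho$. -/
theorem exists_minorDet_bound (hn : 1 ≤ n) (hJ : StrictMono J) (z₀ : ℂ) (g : ℕ → ℂ)
    {f : Fin (m + 1) → ℕ} (hf : StrictMono f) :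
    ∃ K : ℝ, 0 < K ∧ ∀ A ρ ξ η : ℝ, 0 < A → 1 ≤ ρ → √(ξ ^ 2 + η ^ 2) = ρ →
      ‖D.minorDet J (z₀ * A) g f ξ η -
        (if f = fun i : Fin (m + 1) => (i : ℕ) then 1 else 0) *
          colDet J (z₀ * A) (fun i => i) (D.coord ξ η)‖ * (ρ⁻¹ ^ (∑ i, J i) *
            (ρ / (A + ρ)) ^ reducedExp J) ≤ ρ⁻¹ ^ (∑ i : Fin (m + 1), (i : ℕ)) * ρ⁻¹ * K := by
  obtain ⟨K, hK, h1, h2⟩ := exists_lipschitz_of_contDiff (D.contDiff_farDet (J := J) f z₀ g)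
    (isCompact_closedBall 0 1) (convex_closedBall _ _)
  refine ⟨K, hK, fun A ρ ξ η hA hρ hsq => ?_⟩
  have hρ0 : 0 < ρ := by linarith
  have hinv : ρ⁻¹ ∈ Set.Icc (0 : ℝ) 1 := ⟨by positivity, inv_le_one_of_one_le₀ hρ⟩
  have hmem := farPoint_mem hA hρ0 hsq
  have e1 := D.farDet_eq hJ f z₀ g (A := A) hρ0 ξ η
  have e2 := D.farDet_zero hn hJ f z₀ g (A := A) hρ0 ξ η
  have hG : ∀ x : ℂ, ‖x‖ * (ρ⁻¹ ^ (∑ i, J i) * (ρ / (A + ρ)) ^ reducedExp J) =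
      ‖(ρ⁻¹ : ℂ) ^ (∑ i, J i) * ((ρ / (A + ρ) : ℝ) : ℂ) ^ reducedExp J * x‖ := by
    intro x
    rw [norm_mul, norm_mul, norm_pow, norm_pow, Complex.norm_real, norm_inv, Complex.norm_real,
      Real.norm_of_nonneg hρ0.le, Real.norm_of_nonneg (by positivity)]
    ring
  have hc : ∀ k, ‖(ρ⁻¹ : ℂ) ^ k‖ = ρ⁻¹ ^ k := fun k => by
    rw [norm_pow, norm_inv, Complex.norm_real, Real.norm_of_nonneg hρ0.le]
  rw [hG, mul_sub, ← e1]
  split_ifs with h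
  · subst h
    rw [one_mul, ← e2, ← mul_sub, norm_mul, hc, mul_assoc]
    refine mul_le_mul_of_nonneg_left ?_ (by positivity)
    rw [mul_comm ρ⁻¹]
    exact h2 _ hinv _ hmem
  · rw [zero_mul, mul_zero, sub_zero, norm_mul, hc, ← pow_succ]
    refine mul_le_mul ?_ (h1 _ hinv _ hmem) (norm_nonneg _) (by positivity)
    exact pow_le_pow_of_le_one hinv.1 hinv.2 (sum_ge_succ hf h)

/-- Far from all the roots the ratio of the determinants tends to `1`. -/
theorem waveSum_ratio_far (hn : 1 ≤ n) (hJ : StrictMono J) (hL : J (Fin.last m) < L) {z₀ κ : ℂ}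
    (hκ : κ ≠ 0) {Γ₀ : ℕ} {S : Finset ℂ} (hS : ∀ ζ ∈ S, ζ ≠ 0)
    (hprod : ∀ y, colDet J z₀ (fun i => i) y = κ * y ^ Γ₀ * ∏ ζ ∈ S, (y - ζ))
    (hcard : S.card = reducedExp J)
    (hdeg : ∑ i : Fin (m + 1), (i : ℕ) + Γ₀ = ∑ r, lowIdx J r) (g : ℕ → ℂ) {ε : ℝ} (hε : 0 < ε) :
    ∃ R : ℝ, 1 ≤ R ∧ ∀ A ξ η : ℝ, 0 < A → R ≤ √(ξ ^ 2 + η ^ 2) →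
      (∀ ζ ∈ S, R ≤ ‖D.coord ξ η - ζ * A‖) →
      ‖D.waveSum J (L + 1) (z₀ * A) g ξ η / D.waveSum J (L + 1) (z₀ * A) 0 ξ η - 1‖ ≤ ε := by
  set V₀ : Fin (m + 1) → ℕ := fun i => i with hV₀
  set s := strictMonoFns (m + 1) (L + 1) with hs
  obtain ⟨lo, up, hlo, hup, hcb⟩ := D.exists_norm_coord_bounds hn
  obtain ⟨cL, hcL, hlow⟩ := exists_prod_lower_bound S hS hlo hup
  have hbound : ∀ g, ∃ K : ℝ, 0 < K ∧ ∀ f ∈ s, ∀ A ρ ξ η : ℝ, 0 < A → 1 ≤ ρ →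
      √(ξ ^ 2 + η ^ 2) = ρ → ‖D.minorDet J (z₀ * A) g f ξ η - (if f = V₀ then 1 else 0) *
          colDet J (z₀ * A) V₀ (D.coord ξ η)‖ * (ρ⁻¹ ^ (∑ i, J i) *
            (ρ / (A + ρ)) ^ reducedExp J) ≤ ρ⁻¹ ^ (∑ i, V₀ i) * ρ⁻¹ * K := by
    intro g
    have h : ∀ f : Fin (m + 1) → ℕ, ∃ K : ℝ, f ∈ s → ∀ A ρ ξ η : ℝ, 0 < A → 1 ≤ ρ →
      √(ξ ^ 2 + η ^ 2) = ρ → ‖D.minorDet J (z₀ * A) g f ξ η - (if f = V₀ then 1 else 0) *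
          colDet J (z₀ * A) V₀ (D.coord ξ η)‖ * (ρ⁻¹ ^ (∑ i, J i) *
            (ρ / (A + ρ)) ^ reducedExp J) ≤ ρ⁻¹ ^ (∑ i, V₀ i) * ρ⁻¹ * K := by
      intro f
      by_cases hf : f ∈ s
      · obtain ⟨K, _, hK⟩ := D.exists_minorDet_bound hn hJ z₀ g (mem_strictMonoFns.1 hf).2
        exact ⟨K, fun _ => hK⟩
      · exact ⟨0, fun h => absurd h hf⟩
    choose K hK using h
    obtain ⟨K', hK', hle⟩ := exists_pos_forall_ge s K
    refine ⟨K', hK', fun f hf A ρ ξ η hA hρ hsq => (hK f hf A ρ ξ η hA hρ hsq).trans ?_⟩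
    have : 0 < ρ := by linarith
    exact mul_le_mul_of_nonneg_left (hle f hf) (by positivity)
  obtain ⟨K₁, hK₁, hb₁⟩ := hbound g
  obtain ⟨K₂, hK₂, hb₂⟩ := hbound (-g)
  obtain ⟨K₃, hK₃, hb₃⟩ := hbound 0
  set K := K₁ + K₂ + K₃ with hK
  set κ' := ‖κ‖ * lo ^ Γ₀ * cL with hκ'
  have hκpos : 0 < κ' := by
    have := norm_pos_iff.2 hκ
    positivity
  have hC := D.C1_ne hn
  set c : (Fin (m + 1) → ℕ) → ℝ := fun f => D.C1 ^ (∑ i, f i) with hc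
  have hcpos : ∀ f, 0 < c f := fun f => pow_pos hC _
  set Q := 20 * (∑ f ∈ s, c f) / c V₀ with hQ
  have hQ0 : 0 ≤ Q := div_nonneg (mul_nonneg (by norm_num) (sum_nonneg fun f _ => (hcpos f).le))
    (hcpos _).le
  -- The second summand makes the relative error of the minors at most $1/2$, the third makes the
  -- final error at most $\varepsilon$.
  refine ⟨1 + 2 * K / κ' + Q * K / (κ' * ε), by
    have : 0 < 2 * K / κ' := by positivity
    have : 0 ≤ Q * K / (κ' * ε) := by positivity
    linarith, fun A ξ η hA hR hRS => ?_⟩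
  set R := 1 + 2 * K / κ' + Q * K / (κ' * ε) with hRdef
  have hR1 : 1 ≤ R := by
    have : 0 < 2 * K / κ' := by positivity
    have : 0 ≤ Q * K / (κ' * ε) := by positivity
    linarith
  have hR2 : 2 * K / κ' ≤ R := by
    have : 0 ≤ Q * K / (κ' * ε) := by positivity
    linarith
  have hR3 : Q * K / (κ' * ε) ≤ R := by
    have : 0 < 2 * K / κ' := by positivity
    linarith
  have hR0 : 0 < R := by linarith
  set ρ := √(ξ ^ 2 + η ^ 2) with hρ
  have hρ1 : 1 ≤ ρ := hR1.trans hR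
  have hρ0 : 0 < ρ := by linarith
  set W := D.coord ξ η with hW
  set P := colDet J (z₀ * A) V₀ W with hP
  set G := ρ⁻¹ ^ (∑ i, J i) * (ρ / (A + ρ)) ^ reducedExp J with hG
  have hGpos : 0 < G := by positivity
  -- In the normalization of the error bound the leading minor is a product of distances to the
  -- roots, hence larger than the error by a factor proportional to $R$.
  have hPlow : κ' * R * (ρ⁻¹ ^ (∑ i, V₀ i) * ρ⁻¹) ≤ ‖P‖ * G := by
    have h1 := hlow A ρ R W hA hρ0 hR0 (hcb ξ η).1 (hcb ξ η).2 hR hRS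
    have h2 : ‖P‖ * G = ρ⁻¹ ^ (∑ i, V₀ i) * (‖κ‖ * (ρ⁻¹ * ‖W‖) ^ Γ₀ *
        ∏ ζ ∈ S, (‖W - ζ * A‖ / (A + ρ))) := by
      have h3 : ∑ r, J r = ∑ i, V₀ i + Γ₀ + S.card := by
        rw [hcard, ← reducedExp_add hJ, ← hdeg]
        exact Nat.add_comm _ _
      rw [hP, colDet_eq_prod hJ hprod hcard hdeg hA, hG, h3, ← hcard, norm_mul, norm_mul, norm_pow,
        norm_prod, prod_div_distrib, prod_const, pow_add, pow_add, mul_pow, div_pow]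
      have : A + ρ ≠ 0 := by positivity
      generalize ∏ ζ ∈ S, ‖W - ζ * A‖ = Q'
      simp only [inv_pow]
      field_simp
    have h4 : lo ≤ ρ⁻¹ * ‖W‖ := by
      rw [← div_eq_inv_mul, le_div_iff₀ hρ0]
      exact (hcb ξ η).1
    have h5 : cL * R * ρ⁻¹ ≤ ∏ ζ ∈ S, (‖W - ζ * A‖ / (A + ρ)) := by
      rw [← div_eq_mul_inv, div_le_iff₀ hρ0]
      linarith
    rw [h2]
    calc κ' * R * (ρ⁻¹ ^ (∑ i, V₀ i) * ρ⁻¹) =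
          ρ⁻¹ ^ (∑ i, V₀ i) * (‖κ‖ * lo ^ Γ₀ * (cL * R * ρ⁻¹)) := by rw [hκ']; ring
      _ ≤ _ := by gcongr
  have hPG : 0 < ‖P‖ * G := lt_of_lt_of_le (by positivity) hPlow
  have hP0 : P ≠ 0 := by
    rintro h
    rw [h, norm_zero, zero_mul] at hPG
    exact lt_irrefl _ hPG
  have conv : ∀ {g : ℕ → ℂ} {K₀ : ℝ}, K₀ ≤ K → (∀ f ∈ s, ∀ A ρ ξ η : ℝ, 0 < A → 1 ≤ ρ →
      √(ξ ^ 2 + η ^ 2) = ρ → ‖D.minorDet J (z₀ * A) g f ξ η - (if f = V₀ then 1 else 0) *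
          colDet J (z₀ * A) V₀ (D.coord ξ η)‖ * (ρ⁻¹ ^ (∑ i, J i) *
            (ρ / (A + ρ)) ^ reducedExp J) ≤ ρ⁻¹ ^ (∑ i, V₀ i) * ρ⁻¹ * K₀) →
      ∀ f ∈ s, ‖D.minorDet J (z₀ * A) g f ξ η - (if f = V₀ then 1 else 0) * P‖ ≤
        K / (κ' * R) * ‖P‖ := by
    intro g K₀ hK₀ hb f hf
    have h1 := hb f hf A ρ ξ η hA hρ1 rfl
    refine le_of_mul_le_mul_right (h1.trans ?_) hGpos
    calc ρ⁻¹ ^ (∑ i, V₀ i) * ρ⁻¹ * K₀ ≤ ρ⁻¹ ^ (∑ i, V₀ i) * ρ⁻¹ * K := by gcongr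
      _ = K / (κ' * R) * (κ' * R * (ρ⁻¹ ^ (∑ i, V₀ i) * ρ⁻¹)) := by field_simp
      _ ≤ K / (κ' * R) * (‖P‖ * G) := by gcongr
      _ = _ := by ring
  have hfin := norm_ratio_sub_one_le hcpos (val_mem hJ hL) hP0
    (e := fun f => if f = V₀ then 1 else 0) (by simp [hV₀])
    (fun f _ => by by_cases h : f = V₀ <;> simp [h]) (η := K / (κ' * R)) (by
      rw [div_le_iff₀ hκpos] at hR2
      rw [div_le_iff₀ (by positivity)]
      linarith) (conv (by linarith) hb₁) (conv (by linarith) hb₂) (conv (by linarith) hb₃)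
  have e1 : D.waveSum J (L + 1) (z₀ * A) g ξ η / D.waveSum J (L + 1) (z₀ * A) 0 ξ η =
      (∑ f ∈ s, (c f : ℂ) * star (D.minorDet J (z₀ * A) g f ξ η) *
        D.minorDet J (z₀ * A) (-g) f ξ η) / (∑ f ∈ s, (c f : ℂ) *
        star (D.minorDet J (z₀ * A) 0 f ξ η) * D.minorDet J (z₀ * A) 0 f ξ η) := by
    simp only [waveSum, hc, neg_zero, Complex.ofReal_pow]
    rfl
  rw [e1]
  refine hfin.trans ?_
  change Q * (K / (κ' * R)) ≤ ε
  rw [div_le_iff₀ (by positivity)] at hR3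
  rw [← mul_div_assoc, div_le_iff₀ (by positivity)]
  linarith

end Far

end SpectralData

/-! ### Gluing the local limits into uniform statements on regions. -/

section Regions

theorem RateOn.comp {E E' : Type*} {B : Set E} {B' : Set E'} {F : ℝ → E → ℂ} {F₀ : E → ℂ}
    (hF : RateOn B F F₀) {g : E' → E} (hg : ∀ p ∈ B', g p ∈ B) :
    RateOn B' (fun δ p => F δ (g p)) fun p => F₀ (g p) := by
  obtain ⟨K, b, hK, hb, hb1, h0, h⟩ := hF
  exact ⟨K, b, hK, hb, hb1, fun p hp => h0 _ (hg p hp),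
    fun δ hδ hδb p hp => h δ hδ hδb _ (hg p hp)⟩

theorem RateOn.exists_large {E : Type*} {B : Set E} {F : ℝ → E → ℂ} {F₀ : E → ℂ}
    (hF : RateOn B (fun δ p => F δ⁻¹ p) F₀) : ∃ K : ℝ, 0 < K ∧ ∃ A₀ : ℝ, 0 < A₀ ∧
      ∀ A : ℝ, A₀ ≤ A → ∀ p ∈ B, ‖F A p - F₀ p‖ ≤ K * A⁻¹ := by
  obtain ⟨K, b, hK, hb, hb1, h0, h⟩ := hF
  refine ⟨K, hK, b⁻¹, inv_pos.2 hb, fun A hA p hp => ?_⟩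
  have hApos : 0 < A := (inv_pos.2 hb).trans_le hA
  have := h A⁻¹ (inv_pos.2 hApos) (inv_le_of_inv_le₀ hb hA) p hp
  simpa only [inv_inv] using this

theorem RateOn.exists_le {E : Type*} {B : Set E} {F : ℝ → E → ℂ} {F₀ : E → ℂ}
    (hF : RateOn B (fun δ p => F δ⁻¹ p) F₀) {ε : ℝ} (hε : 0 < ε) : ∃ A₀ : ℝ, 0 < A₀ ∧
      ∀ A : ℝ, A₀ ≤ A → ∀ p ∈ B, ‖F A p - F₀ p‖ ≤ ε := by
  obtain ⟨K, hK, A₀, hA₀, h⟩ := hF.exists_large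
  refine ⟨A₀ + K / ε, by positivity, fun A hA p hp => ?_⟩
  have h1 : 0 < K / ε := by positivity
  have hApos : 0 < A := by linarith
  refine (h A (by linarith) p hp).trans ?_
  have h2 : K / ε ≤ A := by linarith
  rw [div_le_iff₀ hε] at h2
  rw [← div_eq_mul_inv, div_le_iff₀ hApos]
  linarith

theorem exists_forall_large {ι : Type*} (s : Finset ι) {P : ι → ℝ → Prop}
    (h : ∀ i ∈ s, ∃ A₀ : ℝ, 0 < A₀ ∧ ∀ A, A₀ ≤ A → P i A) :
    ∃ A₀ : ℝ, 0 < A₀ ∧ ∀ A, A₀ ≤ A → ∀ i ∈ s, P i A := by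
  classical
  induction s using Finset.induction_on with
  | empty => exact ⟨1, one_pos, by simp⟩
  | insert a s ha ih =>
    obtain ⟨A₁, h₁, h₁'⟩ := ih fun i hi => h i (mem_insert_of_mem hi)
    obtain ⟨A₂, _, h₂'⟩ := h a (mem_insert_self a s)
    refine ⟨max A₁ A₂, lt_max_of_lt_left h₁, fun A hA i hi => ?_⟩
    rcases mem_insert.1 hi with rfl | hi
    · exact h₂' A ((le_max_right _ _).trans hA)
    · exact h₁' A ((le_max_left _ _).trans hA) i hi

theorem exists_separation {E ι : Type*} [NormedAddCommGroup E] {S : Finset ι} {u : ι → E}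
    (hu : ∀ i ∈ S, u i ≠ 0)
    (hinj : ∀ i ∈ S, ∀ j ∈ S, j ≠ i → u j ≠ u i) :
    ∃ c : ℝ, 0 < c ∧ (∀ i ∈ S, 3 * c ≤ ‖u i‖) ∧ ∀ i ∈ S, ∀ j ∈ S, j ≠ i → 3 * c ≤ ‖u i - u j‖ := by
  classical
  obtain ⟨d, hd, hdS⟩ := exists_pos_forall_le S (fun i => ‖u i‖) fun i hi => norm_pos_iff.2 (hu i hi)
  obtain ⟨d', hd', hdS'⟩ := exists_pos_forall_le (S ×ˢ S |>.filter fun x => x.2 ≠ x.1)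
    (fun x => ‖u x.1 - u x.2‖) fun x hx => by
      obtain ⟨hx1, hx2⟩ := mem_filter.1 hx
      obtain ⟨hx3, hx4⟩ := mem_product.1 hx1
      exact norm_pos_iff.2 (sub_ne_zero.2 (hinj _ hx3 _ hx4 hx2).symm)
  refine ⟨min d d' / 3, by positivity, fun i hi => ?_, fun i hi j hj hij => ?_⟩
  · have := hdS i hi
    have := min_le_left d d'
    linarith
  · have := hdS' (i, j) (mem_filter.2 ⟨mem_product.2 ⟨hi, hj⟩, hij⟩)
    have := min_le_right d d'
    simp only at *
    linarith

variable {E ι : Type*} [NormedAddCommGroup E] [NormedSpace ℝ E] {S : Finset ι} {u v : ι → E}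
  {F : ℝ → E → ℂ} {φ ψ : E → ℂ}

theorem exists_far_from_centers (hfar : ∀ ε : ℝ, 0 < ε → ∃ R : ℝ, 0 < R ∧ ∀ (A : ℝ) (p : E), 0 < A →
      R ≤ ‖p‖ → (∀ i ∈ S, R ≤ ‖p - A • u i‖) → ‖F A p - 1‖ ≤ ε) (v : ι → E) {ε : ℝ} (hε : 0 < ε) :
    ∃ R : ℝ, 0 < R ∧ ∀ (A : ℝ) (p : E), 0 < A → R ≤ ‖p‖ →
      (∀ i ∈ S, R ≤ ‖p - (A • u i - v i)‖) → ‖F A p - 1‖ ≤ ε := by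
  obtain ⟨R, hR, h⟩ := hfar ε hε
  obtain ⟨V, hV, hvV⟩ := exists_pos_forall_ge S fun i => ‖v i‖
  refine ⟨R + V, by positivity, fun A p hA hp hi => h A p hA (by linarith) fun i his => ?_⟩
  have h1 := hi i his
  have h2 : ‖v i‖ ≤ V := hvV i his
  have h3 : ‖p - (A • u i - v i)‖ ≤ ‖p - A • u i‖ + ‖v i‖ := by
    calc ‖p - (A • u i - v i)‖ = ‖(p - A • u i) + v i‖ := by congr 1; abel
      _ ≤ _ := norm_add_le _ _
  linarith

/-- The limit $\psi$ inherits its decay from $F$: for a fixed point, $A$ can be taken so large that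
all other centres are far away. -/
theorem exists_lower_wave_far {c : ℝ} (hc : 0 < c) (hcu : ∀ i ∈ S, 3 * c ≤ ‖u i‖)
    (hfar : ∀ ε : ℝ, 0 < ε → ∃ R : ℝ, 0 < R ∧ ∀ (A : ℝ) (p : E), 0 < A →
      R ≤ ‖p‖ → (∀ i ∈ S, R ≤ ‖p - A • u i‖) → ‖F A p - 1‖ ≤ ε)
    (hmult : ∀ R, RateOn (Metric.closedBall 0 R) (fun δ p => F δ⁻¹ p) ψ) {ε : ℝ} (hε : 0 < ε) :
    ∃ R : ℝ, 0 < R ∧ ∀ p : E, R ≤ ‖p‖ → ‖ψ p - 1‖ ≤ ε := by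
  obtain ⟨R, hR, h⟩ := hfar (ε / 2) (by positivity)
  refine ⟨R, hR, fun p hp => ?_⟩
  obtain ⟨A₀, hA₀, h'⟩ := (hmult ‖p‖).exists_le (half_pos hε)
  set A := A₀ + (‖p‖ + R) / c with hA
  have h0 : 0 ≤ (‖p‖ + R) / c := by positivity
  have hApos : 0 < A := by linarith
  have h1 := h' A (by linarith) p (by simp)
  have h2 := h A p hApos hp fun i hi => by
    have h3 : A * ‖u i‖ ≤ ‖p - A • u i‖ + ‖p‖ := by
      calc A * ‖u i‖ = ‖A • u i‖ := by rw [norm_smul, Real.norm_of_nonneg hApos.le]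
        _ = ‖p - (p - A • u i)‖ := by congr 1; abel
        _ ≤ ‖p‖ + ‖p - A • u i‖ := norm_sub_le _ _
        _ = _ := add_comm _ _
    have h4 : (‖p‖ + R) / c * c = ‖p‖ + R := div_mul_cancel₀ _ hc.ne'
    have h5 : c * A ≤ A * ‖u i‖ := by nlinarith [hcu i hi]
    nlinarith
  calc ‖ψ p - 1‖ = ‖(F A p - 1) - (F A p - ψ p)‖ := by congr 1; ring
    _ ≤ ‖F A p - 1‖ + ‖F A p - ψ p‖ := norm_sub_le _ _
    _ ≤ _ := by linarith

theorem centers_separated {c : ℝ} (hc : 0 < c) (hcu : ∀ i ∈ S, 3 * c ≤ ‖u i‖)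
    (hcuu : ∀ i ∈ S, ∀ j ∈ S, j ≠ i → 3 * c ≤ ‖u i - u j‖) (v : ι → E) :
    ∃ A₀ : ℝ, 0 < A₀ ∧ ∀ A, A₀ ≤ A → ∀ i ∈ S, 2 * c * A < ‖A • u i - v i‖ ∧
      ∀ j ∈ S, j ≠ i → 2 * c * A < ‖(A • u i - v i) - (A • u j - v j)‖ := by
  obtain ⟨V, hV, hvV⟩ := exists_pos_forall_ge S fun i => ‖v i‖
  refine ⟨3 * V / c, by positivity, fun A hA i hi => ?_⟩
  have hApos : 0 < A := lt_of_lt_of_le (by positivity) hA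
  rw [div_le_iff₀ hc] at hA
  have hvi : ‖v i‖ ≤ V := hvV i hi
  refine ⟨?_, fun j hj hij => ?_⟩
  · have h1 : A * ‖u i‖ ≤ ‖A • u i - v i‖ + ‖v i‖ := by
      calc A * ‖u i‖ = ‖A • u i‖ := by rw [norm_smul, Real.norm_of_nonneg hApos.le]
        _ = ‖(A • u i - v i) + v i‖ := by congr 1; abel
        _ ≤ _ := norm_add_le _ _
    have := mul_le_mul_of_nonneg_left (hcu i hi) hApos.le
    nlinarith
  · have hvj : ‖v j‖ ≤ V := hvV j hj
    have h1 : A * ‖u i - u j‖ ≤ ‖(A • u i - v i) - (A • u j - v j)‖ + (‖v i‖ + ‖v j‖) := by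
      calc A * ‖u i - u j‖ = ‖A • (u i - u j)‖ := by rw [norm_smul, Real.norm_of_nonneg hApos.le]
        _ = ‖((A • u i - v i) - (A • u j - v j)) + (v i - v j)‖ := by
          congr 1; rw [smul_sub]; abel
        _ ≤ _ := (norm_add_le _ _).trans (by gcongr; exact norm_sub_le _ _)
    have := mul_le_mul_of_nonneg_left (hcuu i hi j hj hij) hApos.le
    nlinarith

/-- The centres move apart linearly in $A$, so a point is within $R$ of at most one of them. There
the local limit applies and the other profiles are negligible; elsewhere both sides are close to
$1$. -/
theorem simple_region {c : ℝ} (hc : 0 < c) (hcu : ∀ i ∈ S, 3 * c ≤ ‖u i‖)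
    (hcuu : ∀ i ∈ S, ∀ j ∈ S, j ≠ i → 3 * c ≤ ‖u i - u j‖)
    (hfar : ∀ ε : ℝ, 0 < ε → ∃ R : ℝ, 0 < R ∧ ∀ (A : ℝ) (p : E), 0 < A →
      R ≤ ‖p‖ → (∀ i ∈ S, R ≤ ‖p - A • u i‖) → ‖F A p - 1‖ ≤ ε)
    (hnear : ∀ i ∈ S, ∀ R, RateOn (Metric.closedBall 0 R)
      (fun δ p => F δ⁻¹ (δ⁻¹ • u i - v i + p)) φ)
    (hφ : ∀ ε : ℝ, 0 < ε → ∃ R : ℝ, 0 < R ∧ ∀ p : E, R ≤ ‖p‖ → ‖φ p - 1‖ ≤ ε)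
    {ε : ℝ} (hε : 0 < ε) : ∃ A₀ : ℝ, 0 < A₀ ∧ ∀ A, A₀ ≤ A → ∀ p : E, c * A < ‖p‖ →
      ‖F A p - (1 + ∑ i ∈ S, (φ (p - (A • u i - v i)) - 1))‖ ≤ ε := by
  classical
  have hM : (0 : ℝ) < 2 * (S.card + 1) := by positivity
  obtain ⟨R₁, hR₁, h₁⟩ := exists_far_from_centers hfar v (half_pos hε)
  obtain ⟨R₂, hR₂, h₂⟩ := hφ (ε / (2 * (S.card + 1))) (by positivity)
  set R := R₁ + R₂ with hR
  obtain ⟨A₁, hA₁, h₃⟩ := centers_separated hc hcu hcuu v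
  obtain ⟨A₂, hA₂, h₄⟩ := exists_forall_large S
    (P := fun i A => ∀ p ∈ Metric.closedBall (0 : E) R,
      ‖F A (A • u i - v i + p) - φ p‖ ≤ ε / 2) fun i hi =>
      RateOn.exists_le (F := fun A p => F A (A • u i - v i + p)) (hnear i hi R) (half_pos hε)
  have hsum : ∀ T ⊆ S, ∀ q : ι → E, (∀ i ∈ T, R ≤ ‖q i‖) → ‖∑ i ∈ T, (φ (q i) - 1)‖ ≤ ε / 2 := by
    intro T hT q hq
    have h5 := norm_sum_le_of_le T fun i hi => h₂ (q i) (by linarith [hq i hi])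
    refine h5.trans ?_
    rw [sum_const, nsmul_eq_mul]
    have hcard : (T.card : ℝ) ≤ S.card + 1 := by
      have : (T.card : ℝ) ≤ S.card := by exact_mod_cast card_le_card hT
      linarith
    calc (T.card : ℝ) * (ε / (2 * (S.card + 1))) ≤ (S.card + 1) * (ε / (2 * (S.card + 1))) := by
          gcongr
      _ = ε / 2 := by field_simp
  refine ⟨A₁ + A₂ + R / c, by positivity, fun A hA p hp => ?_⟩
  have hRc : 0 < R / c := by positivity
  have hApos : 0 < A := by linarith
  have hRA : R ≤ c * A := by
    have : R / c ≤ A := by linarith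
    rwa [div_le_iff₀ hc, mul_comm] at this
  by_cases hall : ∀ i ∈ S, R ≤ ‖p - (A • u i - v i)‖
  · have h5 := h₁ A p hApos (by linarith) fun i hi => by linarith [hall i hi]
    have h6 := hsum S subset_rfl _ hall
    calc _ = ‖(F A p - 1) - ∑ i ∈ S, (φ (p - (A • u i - v i)) - 1)‖ := by congr 1; ring
      _ ≤ _ := norm_sub_le _ _
      _ ≤ ε := by linarith
  · push Not at hall
    obtain ⟨i, hi, hlt⟩ := hall
    have h5 := h₄ A (by linarith) i hi (p - (A • u i - v i)) (by
      rw [mem_closedBall_zero_iff]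
      exact hlt.le)
    rw [add_sub_cancel] at h5
    have h6 := hsum (S.erase i) (erase_subset _ _) (fun j => p - (A • u j - v j)) fun j hj => by
      obtain ⟨hji, hj⟩ := mem_erase.1 hj
      have h7 := (h₃ A (by linarith) i hi).2 j hj hji
      have h8 : ‖(A • u i - v i) - (A • u j - v j)‖ ≤
          ‖p - (A • u j - v j)‖ + ‖p - (A • u i - v i)‖ := by
        calc _ = ‖(p - (A • u j - v j)) - (p - (A • u i - v i))‖ := by congr 1; abel
          _ ≤ _ := norm_sub_le _ _
      linarith
    rw [← add_sum_erase _ _ hi]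
    calc _ = ‖(F A p - φ (p - (A • u i - v i))) -
          ∑ j ∈ S.erase i, (φ (p - (A • u j - v j)) - 1)‖ := by congr 1; ring
      _ ≤ _ := norm_sub_le _ _
      _ ≤ ε := by linarith

/-- On a fixed ball this is the local limit. Between that ball and radius $cA$ the other centres are
still far, and both functions are close to $1$. -/
theorem multiple_region {c : ℝ} (hc : 0 < c) (hcu : ∀ i ∈ S, 3 * c ≤ ‖u i‖)
    (hcuu : ∀ i ∈ S, ∀ j ∈ S, j ≠ i → 3 * c ≤ ‖u i - u j‖)
    (hfar : ∀ ε : ℝ, 0 < ε → ∃ R : ℝ, 0 < R ∧ ∀ (A : ℝ) (p : E), 0 < A →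
      R ≤ ‖p‖ → (∀ i ∈ S, R ≤ ‖p - A • u i‖) → ‖F A p - 1‖ ≤ ε)
    (hmult : ∀ R, RateOn (Metric.closedBall 0 R) (fun δ p => F δ⁻¹ p) ψ)
    {ε : ℝ} (hε : 0 < ε) : ∃ A₀ : ℝ, 0 < A₀ ∧ ∀ A, A₀ ≤ A → ∀ p : E, ‖p‖ ≤ c * A →
      ‖F A p - ψ p‖ ≤ ε := by
  obtain ⟨R₁, hR₁, h₁⟩ := exists_far_from_centers hfar (fun _ => 0) (half_pos hε)
  obtain ⟨R₂, hR₂, h₂⟩ := exists_lower_wave_far hc hcu hfar hmult (half_pos hε)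
  set R := R₁ + R₂ with hR
  obtain ⟨A₁, hA₁, h₃⟩ := centers_separated hc hcu hcuu fun _ => 0
  obtain ⟨A₂, hA₂, h₄⟩ := (hmult R).exists_le hε
  refine ⟨A₁ + A₂ + R / c, by positivity, fun A hA p hp => ?_⟩
  have hRc : 0 < R / c := by positivity
  have hApos : 0 < A := by linarith
  have hRA : R ≤ c * A := by
    have : R / c ≤ A := by linarith
    rwa [div_le_iff₀ hc, mul_comm] at this
  rcases le_total R ‖p‖ with h | h
  · have h5 := h₁ A p hApos (by linarith) fun i hi => by
      have h6 := (h₃ A (by linarith) i hi).1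
      have h7 : ‖A • u i - 0‖ ≤ ‖p - (A • u i - 0)‖ + ‖p‖ := by
        rw [norm_sub_rev p]
        calc ‖A • u i - 0‖ = ‖(A • u i - 0 - p) + p‖ := by congr 1; abel
          _ ≤ _ := norm_add_le _ _
      linarith
    have h6 := h₂ p (by linarith)
    calc ‖F A p - ψ p‖ = ‖(F A p - 1) - (ψ p - 1)‖ := by congr 1; ring
      _ ≤ _ := norm_sub_le _ _
      _ ≤ ε := by linarith
  · exact h₄ A (by linarith) p (by rwa [mem_closedBall_zero_iff])

end Regions

/-! ### The polynomials $W_{\mathcal N}$, $W'_{\mathcal N}$ and $W^{[2]}_{\mathcal N}$ in terms of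
`colDet`. -/

section Polynomials

open Polynomial

variable {n m : ℕ} {N : Fin n → ℕ}

theorem hasDerivAt_colDet (J : Fin (m + 1) → ℕ) (a y : ℂ) :
    HasDerivAt (fun s : ℝ => colDet J a (fun i => i) (y + s)) (colDet J a (bumpLast m) y) 0 := by
  have hid : HasDerivAt (fun s : ℝ => (s : ℂ)) 1 0 := Complex.ofRealCLM.hasDerivAt
  have h := hasDerivAt_det_shift (t := 0)
    (M := fun s => Matrix.of fun (i r : Fin (m + 1)) =>
      schurShift (fun j => (if j = 1 then y + (s : ℂ) else 0) + a ^ j / (j : ℂ)) i (J r))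
    (G := fun v r => schurShift (fun j => (if j = 1 then y else 0) + a ^ j / (j : ℂ)) v (J r))
    (s₁ := 1) (s₂ := 0) (fun i r => by simp) (fun i r => by
      have hd := hasDerivAt_schurShift (t := 0) (s₁ := 1) (s₂ := 0)
        (z := fun s j => (if j = 1 then y + (s : ℂ) else 0) + a ^ j / (j : ℂ))
        (fun j => by
          by_cases h1 : j = 1
          · simpa [h1] using hid
          · simp only [if_neg h1]
            simpa using hasDerivAt_const (0 : ℝ) (a ^ j / (j : ℂ))) i (J r)
      simpa using hd)
  refine h.congr_deriv ?_
  rw [one_mul, zero_mul, add_zero]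
  rfl

theorem gmamWronskian_eq (kap : Fin n → ℕ → ℂ) : gmamWronskian N kap =
    (Matrix.of fun p r : BlockIdx N => phiSub kap r.1 (degIdx r) (posIdx p)).det := by
  simp only [gmamWronskian, iterate_derivative_phi]

theorem exists_eval_gmam (hm : ∑ l, N l = m + 1) (e : Fin (m + 1) ≃ BlockIdx N)
    (he : StrictMono fun i => degIdx (e i)) (kap : Fin n → ℕ → ℂ) (kap11 z₀ w : ℂ) (hz₀ : z₀ ≠ 0)
    (hkap1 : ∀ l, kap l 1 = kap11)
    (hkap : ∀ l i, 1 < i → ¬ (n + 1) ∣ i → kap l i = z₀ ^ i / (i : ℂ)) (hw : w = z₀ - kap11) :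
    (gmam N kap).Monic ∧ ∃ s : ℂ, s ≠ 0 ∧
      (∀ z, (gmam N kap).eval z = s * colDet (fun i => degIdx (e i)) z₀ (fun i => i) (z - w)) ∧
      (∀ z, (gmam N kap).derivative.eval z =
        s * colDet (fun i => degIdx (e i)) z₀ (bumpLast m) (z - w)) ∧
      ∀ z, (gmam N kap).IsRoot z → (gmamTwo N kap).eval z =
        s * ((if m = 0 then 0 else colDet (fun i => degIdx (e i)) z₀ (bumpPenult m) (z - w)) +
          colDet (fun i => degIdx (e i)) z₀ (bumpLastTwo m) (z - w)) := by
  obtain ⟨s, hs, h⟩ := exists_eval_det_phiSub hm e kap kap11 z₀ w hkap1 hkap hw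
  have hW : ∀ z, (gmamWronskian N kap).eval z =
      s * colDet (fun i => degIdx (e i)) z₀ (fun i => i) (z - w) := fun z => by
    rw [gmamWronskian_eq]
    exact h (fun i => i) z
  have hW0 := (root_structure he hz₀ hs hW).1
  have hc : gmamConst N kap ≠ 0 := inv_ne_zero (leadingCoeff_ne_zero.2 hW0)
  have hev : ∀ z, (gmam N kap).eval z =
      gmamConst N kap * s * colDet (fun i => degIdx (e i)) z₀ (fun i => i) (z - w) := fun z => by
    rw [gmam, eval_mul, eval_C, hW, mul_assoc]
  refine ⟨?_, gmamConst N kap * s, mul_ne_zero hc hs, hev, fun z => ?_, fun z hz => ?_⟩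
  · rw [Monic, gmam, leadingCoeff_mul, leadingCoeff_C, gmamConst]
    exact inv_mul_cancel₀ (leadingCoeff_ne_zero.2 hW0)
  · have h1 : HasDerivAt (fun t : ℝ => (gmam N kap).eval (z + (t : ℂ)))
        ((gmam N kap).derivative.eval z) 0 := by
      have h2 := ((gmam N kap).hasDerivAt (z + ((0 : ℝ) : ℂ))).comp_const_add z ((0 : ℝ) : ℂ)
      have h3 := HasDerivAt.comp_ofReal h2
      rwa [Complex.ofReal_zero, add_zero] at h3
    have h5 := (hasDerivAt_colDet (fun i => degIdx (e i)) z₀ (z - w)).const_mul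
      (gmamConst N kap * s)
    refine h1.unique (h5.congr_of_eventuallyEq (Filter.Eventually.of_forall fun t => ?_))
    simp only [hev]
    congr 2
    ring
  · have h1 := hz
    rw [IsRoot, hev] at h1
    have h0 : colDet (fun i => degIdx (e i)) z₀ (fun i => i) (z - w) = 0 :=
      (mul_eq_zero.1 h1).resolve_left (mul_ne_zero hc hs)
    rw [gmamTwo, eval_mul, eval_C, eval_add,
      h fun i => if i + 1 = ∑ l, N l - 1 then ∑ l, N l else i,
      h fun i => if i + 1 = ∑ l, N l then ∑ l, N l + 1 else i, hm, Nat.add_sub_cancel]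
    have e2 : (fun i : Fin (m + 1) => if (i : ℕ) + 1 = m + 1 then m + 1 + 1 else (i : ℕ)) =
        bumpLastTwo m := rfl
    rw [e2]
    -- For a single polynomial there is no penultimate row, and the first determinant of $W^{[2]}$
    -- is the Wronskian itself; it vanishes because $z$ is a root.
    by_cases hm0 : m = 0
    · subst hm0
      simp only [Nat.succ_ne_zero, if_false, if_true] at h0 ⊢
      rw [h0]
      ring
    · rw [if_neg hm0]
      have e1 : (fun i : Fin (m + 1) => if (i : ℕ) + 1 = m then m + 1 else (i : ℕ)) =
        bumpPenult m := rfl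
      rw [e1]
      ring

/-- Without its entry $0$, $\mathrm{lo}$ consists of the degrees for $\hat{\mathcal N}$ raised by
one, and the row indices $1,\dots,m$ are raised likewise. -/
theorem sum_lowIdx_sub_eq_gammaDeg (hN : Antitone N) (hpos : 0 < ∑ l, N l)
    {e : Fin (m + 1) ≃ BlockIdx N} (he : StrictMono fun i => degIdx (e i)) :
    (∑ r, lowIdx (fun i => degIdx (e i)) r : ℚ) - ∑ i : Fin (m + 1), ((i : ℕ) : ℚ) =
      gammaDeg (lowerVec N) := by
  have hT := sum_lowerVec hN hpos
  have hcard := Fintype.card_congr e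
  rw [Fintype.card_fin, card_blockIdx] at hcard
  have hm : ∑ l, lowerVec N l = m := by omega
  obtain ⟨e', he'⟩ := exists_strictMono_equiv (T := m) (b := fun p : BlockIdx (lowerVec N) => degIdx p)
    (by rw [card_blockIdx, hm]) degIdx_injective
  rw [gammaDeg_eq, hm, ← e'.sum_comp fun p => (degIdx p : ℚ)]
  simp only [degIdx_lowerVec hN hpos he he']
  rw [Fin.sum_univ_succ, lowIdx_zero, Fin.sum_univ_succ, sum_range]
  simp only [lowIdx_succ, Fin.val_succ, Fin.val_zero]
  push_cast
  simp only [sum_add_distrib]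
  ring

end Polynomials

/-! ### Positions in the plane, the explicit first-order wave and the assembly. -/

theorem planeDist_eq (x t : ℝ) (q : ℝ × ℝ) : planeDist x t q = ‖(⟨x - q.1, t - q.2⟩ : ℂ)‖ := by
  rw [planeDist, Complex.norm_eq_sqrt_sq_add_sq]

theorem mem_closedBall_re_im {R : ℝ} (p : ℂ) (hp : p ∈ Metric.closedBall (0 : ℂ) R) :
    (p.re, p.im) ∈ Metric.closedBall (0 : ℝ × ℝ) R := by
  rw [mem_closedBall_zero_iff] at hp ⊢
  exact norm_prod_le_iff.2 ⟨(Complex.abs_re_le_norm p).trans hp, (Complex.abs_im_le_norm p).trans hp⟩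

namespace SpectralData

variable {n : ℕ} (D : SpectralData n)

theorem norm_plane (k : Fin n) (x t : ℝ) : ‖D.plane k x t‖ = |amp n D.lam0 k| := by
  rw [plane, planeWave, norm_mul, Complex.norm_real, Real.norm_eq_abs, mul_comm Complex.I,
    Complex.norm_exp_ofReal_mul_I, mul_one]

theorem plane_ne (k : Fin n) (x t : ℝ) : D.plane k x t ≠ 0 := by
  rw [← norm_ne_zero_iff, norm_plane]
  exact abs_ne_zero.2 (D.amp_ne k)

theorem point_add (a b : ℂ) : D.point (a + b) = D.point a + D.point b := by
  simp only [point, Prod.mk_add_mk, Prod.mk.injEq, add_div, Complex.add_re, Complex.add_im,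
    and_true]
  ring

theorem point_mul_real (a : ℂ) (r : ℝ) :
    D.point (a * r) = (r * (D.point a).1, r * (D.point a).2) := by
  have h : a * r / (Complex.I * D.c1) = a / (Complex.I * D.c1) * r := by ring
  simp only [point, h, Complex.re_mul_ofReal, Complex.im_mul_ofReal, Prod.mk.injEq]
  constructor <;> ring

theorem point_sub (a b : ℂ) : D.point (a - b) = D.point a - D.point b := by
  have h := D.point_add (a - b) b
  rw [sub_add_cancel] at h
  rw [h, add_sub_cancel_right]

/-- The limit of the correction of the position of a first-order wave. -/
def shiftLimit (N : Fin n → ℕ) (kap : Fin n → ℕ → ℂ) (w z : ℂ) : ℂ :=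
  (D.alpha 2 * (D.point (z - w)).1 + Complex.I * D.beta 2 * (D.point (z - w)).2) *
    ((gmamTwo N kap).eval z / (gmam N kap).derivative.eval z)

/-- $(x_0,t_0)$ is linear in $A$, so $\hat\kappa_2A^{-1}$ is constant and merely replaces the point
of $z$ by the point of $z-w$. -/
theorem shift_eq (N : Fin n → ℕ) (kap : Fin n → ℕ → ℂ) (w z : ℂ) {A : ℝ} (hA : A ≠ 0) :
    D.shift N kap w A z = D.shiftLimit N kap w z := by
  have hA' : (A : ℂ) ≠ 0 := Complex.ofReal_ne_zero.2 hA
  have h : D.kapHat w A 2 * (A : ℂ)⁻¹ =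
      -(D.alpha 2 * (D.point w).1 + Complex.I * D.beta 2 * (D.point w).2) := by
    rw [kapHat, multCenter, point_mul_real]
    push_cast
    field_simp
  rw [shift, shiftLimit, h, point_sub, Prod.fst_sub, Prod.snd_sub]
  push_cast
  ring

/-- A point of the `(x,t)`-plane as a complex number. -/
def pointC (w : ℂ) : ℂ := ⟨(D.point w).1, (D.point w).2⟩

theorem simpleCenter_eq (N : Fin n → ℕ) (kap : Fin n → ℕ → ℂ) (w z : ℂ) {A : ℝ} (hA : A ≠ 0) :
    D.simpleCenter N kap w A z =
      ((D.multCenter w A).1 + (A • D.pointC (z - w) - D.pointC (D.shiftLimit N kap w z)).re,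
        (D.multCenter w A).2 + (A • D.pointC (z - w) - D.pointC (D.shiftLimit N kap w z)).im) := by
  rw [simpleCenter, D.shift_eq N kap w z hA, multCenter]
  have h : z * (A : ℂ) - D.shiftLimit N kap w z =
      (z - w) * A + w * A - D.shiftLimit N kap w z := by ring
  rw [h, point_sub, point_add, point_mul_real _ (z - w)]
  simp only [Complex.sub_re, Complex.sub_im, Complex.smul_re, Complex.smul_im, smul_eq_mul, pointC]
  ext <;> simp <;> ring

theorem coord_pointC (hn : 1 ≤ n) (w : ℂ) : D.coord (D.pointC w).re (D.pointC w).im = w :=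
  D.coord_point hn w

/-- Division by $|\chi^{[1]}|^2$, using $h_{2,1}^{[k]}=\chi^{[1]}/(\chi_0+b_k)$ and
$C_1=|\chi^{[1]}|^2/(4(\operatorname{Im}\chi_0)^2)$. The mixed terms combine into twice a real part.
-/
theorem ratio_eq_firstHat (hn : 1 ≤ n) (k : Fin n) (ξ η : ℝ) :
    (star (D.coord ξ η + D.h2 k 1) * (D.coord ξ η - D.h2 k 1) + D.C1) /
      (star (D.coord ξ η) * D.coord ξ η + D.C1) = D.firstHat k ξ η := by
  have hc1 := (D.c1_relations hn).1
  have hb := D.c0_add_waveNum_ne k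
  have him := D.c0_im_ne
  rw [D.h2_one]
  set b := waveNum n D.lam0 k with hbdef
  set β : ℂ := D.c0 + (b : ℂ) with hβ
  set y : ℂ := (ξ : ℂ) + D.c0 * η with hy
  have hcs : star D.c1 * D.c1 = ((‖D.c1‖ ^ 2 : ℝ) : ℂ) := by
    rw [← starRingEnd_apply, Complex.conj_mul']
    push_cast
    rfl
  have hβs : star β * β = ((‖β‖ ^ 2 : ℝ) : ℂ) := by
    rw [← starRingEnd_apply, Complex.conj_mul']
    push_cast
    rfl
  have hC1 : (D.C1 : ℂ) = star D.c1 * D.c1 * ((1 / (4 * D.c0.im ^ 2) : ℝ) : ℂ) := by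
    have h4 : ‖D.c0 - star D.c0‖ ^ 2 = 4 * D.c0.im ^ 2 := by
      rw [D.c0_sub_star, norm_mul, norm_mul, Complex.norm_I, Complex.norm_real, Real.norm_eq_abs]
      rw [mul_pow, sq_abs]
      norm_num
    rw [hcs, ← Complex.ofReal_mul, C1, h4]
    congr 1
    ring
  have hys : star y * y = (((ξ + D.c0.re * η) ^ 2 + D.c0.im ^ 2 * η ^ 2 : ℝ) : ℂ) := by
    rw [← starRingEnd_apply, Complex.conj_mul', ← Complex.ofReal_pow, Complex.sq_norm,
      Complex.normSq_apply]
    congr 1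
    simp only [hy, Complex.mul_re, Complex.add_re, Complex.add_im, Complex.ofReal_re,
      Complex.ofReal_im, Complex.mul_im]
    ring
  have hre : star y * star β + y * β =
      ((2 * ((D.c0.re + b) * (ξ + D.c0.re * η) - D.c0.im ^ 2 * η) : ℝ) : ℂ) := by
    rw [← star_mul', ← starRingEnd_apply, add_comm, Complex.add_conj]
    congr 1
    simp only [hy, hβ, Complex.mul_re, Complex.add_re, Complex.add_im, Complex.ofReal_re,
      Complex.ofReal_im, Complex.mul_im]
    ring
  have hcoord : D.coord ξ η = Complex.I * D.c1 * y := rfl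
  have hIs : star Complex.I = -Complex.I := Complex.conj_I
  have hsβ : star β ≠ 0 := star_ne_zero.2 hb
  have hsc : star D.c1 ≠ 0 := star_ne_zero.2 hc1
  have hden : (star y * y + ((1 / (4 * D.c0.im ^ 2) : ℝ) : ℂ)) ≠ 0 := by
    rw [hys, ← Complex.ofReal_add]
    refine Complex.ofReal_ne_zero.2 (ne_of_gt ?_)
    have : 0 < 1 / (4 * D.c0.im ^ 2) := by positivity
    positivity
  have hII := Complex.I_mul_I
  have hnum : star (Complex.I * D.c1 * y + D.c1 / β) * (Complex.I * D.c1 * y - D.c1 / β) + D.C1 =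
      star D.c1 * D.c1 * ((star y * y + ((1 / (4 * D.c0.im ^ 2) : ℝ) : ℂ)) +
        Complex.I * ((star y * star β + y * β) + Complex.I) / (star β * β)) := by
    rw [hC1, star_add, star_mul', star_mul', star_div₀, hIs]
    field_simp
    linear_combination (- star y * y * β * star β - 1) * hII
  have hdn : star (Complex.I * D.c1 * y) * (Complex.I * D.c1 * y) + D.C1 =
      star D.c1 * D.c1 * (star y * y + ((1 / (4 * D.c0.im ^ 2) : ℝ) : ℂ)) := by
    rw [hC1, star_mul', star_mul', hIs]
    linear_combination (- star D.c1 * D.c1 * star y * y) * hII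
  rw [hcoord, hnum, hdn, mul_div_mul_left _ _ (mul_ne_zero hsc hc1), add_div, div_self hden]
  unfold firstHat
  simp only
  rw [← hbdef, ← hβ, ← hβs, Complex.ofReal_add _ (1 / (4 * D.c0.im ^ 2)), ← hys, hre]
  congr 2
  push_cast
  field_simp

theorem firstHat_far (hn : 1 ≤ n) (k : Fin n) {ε : ℝ} (hε : 0 < ε) :
    ∃ R : ℝ, 0 < R ∧ ∀ p : ℂ, R ≤ ‖p‖ → ‖D.firstHat k p.re p.im - 1‖ ≤ ε := by
  obtain ⟨lo, up, hlo, hup, hb⟩ := D.exists_norm_coord_bounds hn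
  have hC := D.C1_ne hn
  set g := D.h2 k 1 with hg
  set K := 2 * ‖g‖ + ‖g‖ ^ 2 with hK
  have hK0 : 0 ≤ K := by positivity
  refine ⟨(1 + K / ε) / lo, by positivity, fun p hp => ?_⟩
  rw [div_le_iff₀ hlo] at hp
  set W := D.coord p.re p.im with hW
  have hW1 : 1 + K / ε ≤ ‖W‖ := by
    have := (hb p.re p.im).1
    rw [← Complex.norm_eq_sqrt_sq_add_sq] at this
    rw [hW]
    linarith
  have hKε : 0 ≤ K / ε := by positivity
  have hWpos : 0 < ‖W‖ := by linarith
  have hden : star W * W + D.C1 = ((‖W‖ ^ 2 + D.C1 : ℝ) : ℂ) := by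
    rw [← starRingEnd_apply, Complex.conj_mul']
    push_cast
    rfl
  have hdenpos : 0 < ‖W‖ ^ 2 + D.C1 := by positivity
  have hdne : star W * W + D.C1 ≠ 0 := by
    rw [hden]
    exact Complex.ofReal_ne_zero.2 hdenpos.ne'
  rw [← D.ratio_eq_firstHat hn, ← hW, ← hg, div_sub_one hdne, norm_div, hden, Complex.norm_real,
    Real.norm_of_nonneg hdenpos.le, ← hden, div_le_iff₀ hdenpos]
  have hnum : ‖star (W + g) * (W - g) + D.C1 - (star W * W + D.C1)‖ ≤ K * ‖W‖ := by
    calc _ = ‖star g * W - star W * g - star g * g‖ := by rw [star_add]; congr 1; ring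
      _ ≤ ‖star g * W‖ + ‖star W * g‖ + ‖star g * g‖ :=
        (norm_sub_le _ _).trans (by gcongr; exact norm_sub_le _ _)
      _ = 2 * ‖g‖ * ‖W‖ + ‖g‖ ^ 2 * 1 := by
        rw [norm_mul, norm_mul, norm_mul, norm_star, norm_star]
        ring
      _ ≤ 2 * ‖g‖ * ‖W‖ + ‖g‖ ^ 2 * ‖W‖ := by gcongr; linarith
      _ = _ := by rw [hK]; ring
  have h2 : K ≤ ε * ‖W‖ := by
    have : K / ε ≤ ‖W‖ := by linarith
    rw [div_le_iff₀ hε] at this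
    linarith
  nlinarith

theorem waveHat_lowerVec {N : Fin n → ℕ} (hN : Antitone N) (hpos : 0 < ∑ l, N l) {m : ℕ}
    {e : Fin (m + 1) ≃ BlockIdx N} (he : StrictMono fun i => degIdx (e i)) {L : ℕ}
    (hL : degIdx (e (Fin.last m)) < L) (k : Fin n) (x t : ℝ) :
    D.waveHat (lowerVec N) (fun _ => D.h1) k x t =
      D.lowerDet (fun i => degIdx (e i)) L (D.h2 k) x t /
        D.lowerDet (fun i => degIdx (e i)) L 0 x t := by
  have hT := sum_lowerVec hN hpos
  have hcard := Fintype.card_congr e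
  rw [Fintype.card_fin, card_blockIdx] at hcard
  obtain ⟨e', he'⟩ := exists_strictMono_equiv (T := m) (b := fun p : BlockIdx (lowerVec N) => degIdx p)
    (by rw [card_blockIdx]; omega) degIdx_injective
  have hd := degIdx_lowerVec hN hpos he he'
  have hL' : ∀ i, degIdx (e' i) < L := fun i => by
    rw [hd]
    exact (he.monotone (Fin.le_last _)).trans_lt hL
  have hdet : ∀ g, (D.rwMatrix (lowerVec N) (fun _ => D.h1) g x t).det =
      D.lowerDet (fun i => degIdx (e i)) L g x t := by
    intro g
    rw [D.det_rwMatrix_h1 e' hL', lowerDet]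
    simp only [hd]
  rw [waveHat, wave, hdet, hdet, mul_comm, ← mul_assoc, inv_mul_cancel₀ (D.plane_ne k x t), one_mul]

open Polynomial in
/-- The normalized wave with large internal parameters as a function of the displacement from the
multiple-root position, and its limits. -/
theorem exists_normalized_wave (hn : 1 ≤ n) (N : Fin n → ℕ) (hN : Antitone N)
    (hNpos : 0 < ∑ l, N l) (kap : Fin n → ℕ → ℂ) (kap11 z₀ w : ℂ) (hz₀ : z₀ ≠ 0)
    (hkap1 : ∀ l, kap l 1 = kap11)
    (hkap : ∀ l i, 1 < i → ¬ (n + 1) ∣ i → kap l i = z₀ ^ i / (i : ℂ))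
    (hw : w = z₀ - kap11)
    (hsimple : ∀ z : ℂ, (gmam N kap).IsRoot z → z ≠ w → (gmam N kap).rootMultiplicity z = 1) :
    ((gmam N kap).rootMultiplicity w : ℚ) = gammaDeg (lowerVec N) ∧
    ((otherRoots N kap w).card : ℚ) = gammaDeg N - gammaDeg (lowerVec N) ∧
    ∃ F : Fin n → ℝ → ℂ → ℂ,
      (∀ k A x t, D.wave N (D.largeParam kap w A) k x t = D.plane k x t *
        F k A ⟨x - (D.multCenter w A).1, t - (D.multCenter w A).2⟩) ∧
      (∀ k, ∀ ε : ℝ, 0 < ε → ∃ R : ℝ, 0 < R ∧ ∀ (A : ℝ) (p : ℂ), 0 < A → R ≤ ‖p‖ →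
        (∀ z ∈ otherRoots N kap w, R ≤ ‖p - A • D.pointC (z - w)‖) → ‖F k A p - 1‖ ≤ ε) ∧
      (∀ k, ∀ z ∈ otherRoots N kap w, ∀ R, RateOn (Metric.closedBall 0 R)
        (fun δ p => F k δ⁻¹ (δ⁻¹ • D.pointC (z - w) - D.pointC (D.shiftLimit N kap w z) + p))
        fun p => D.firstHat k p.re p.im) ∧
      ∀ k R, RateOn (Metric.closedBall 0 R) (fun δ p => F k δ⁻¹ p)
        fun p => D.waveHat (lowerVec N) (fun _ => D.h1) k p.re p.im := by
  obtain ⟨m, hm⟩ : ∃ m, ∑ l, N l = m + 1 := Nat.exists_eq_succ_of_ne_zero hNpos.ne'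
  obtain ⟨e, he⟩ := exists_strictMono_equiv (T := m + 1) (b := fun p : BlockIdx N => degIdx p)
    (by rw [card_blockIdx, hm]) degIdx_injective
  obtain ⟨hmonic, s, hs, hev, hder, htwo⟩ :=
    exists_eval_gmam hm e he kap kap11 z₀ w hz₀ hkap1 hkap hw
  set J : Fin (m + 1) → ℕ := fun i => degIdx (e i) with hJ
  set W := gmam N kap with hW
  obtain ⟨-, hmul, hdeg⟩ := root_structure he hz₀ hs hev
  have hprod := eq_prod_otherRoots hmonic hsimple
  change W = (X - C w) ^ W.rootMultiplicity w * ∏ z ∈ otherRoots N kap w, (X - C z) at hprod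
  have hroots : W.natDegree = W.rootMultiplicity w + (otherRoots N kap w).card := by
    conv_lhs => rw [hprod]
    rw [Monic.natDegree_mul ((monic_X_sub_C w).pow _) (monic_prod_X_sub_C _ _),
      natDegree_pow, natDegree_X_sub_C, mul_one, natDegree_finsetProd_X_sub_C_eq_card]
  have hrm : (W.rootMultiplicity w : ℚ) = gammaDeg (lowerVec N) := by
    rw [← sum_lowIdx_sub_eq_gammaDeg hN hNpos he, ← Nat.cast_sum, ← hmul]
    push_cast
    ring
  have hgam : (W.natDegree : ℚ) = gammaDeg N := by
    rw [gammaDeg_eq, hm, ← e.sum_comp fun p => (degIdx p : ℚ), sum_range, ← Nat.cast_sum]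
    change _ = ((∑ r, J r : ℕ) : ℚ) - _
    rw [← hdeg]
    push_cast
    ring
  set L := J (Fin.last m) + 1 with hL
  have hLlt : J (Fin.last m) < L := Nat.lt_succ_self _
  set F : Fin n → ℝ → ℂ → ℂ := fun k A p => D.waveSum J (L + 1) (z₀ * A) (D.h2 k) p.re p.im /
    D.waveSum J (L + 1) (z₀ * A) 0 p.re p.im with hF
  refine ⟨hrm, ?_, F, fun k A x t => ?_, fun k ε hε => ?_, fun k z hz R => ?_, fun k R => ?_⟩
  · rw [← hgam, ← hrm, hroots]
    push_cast
    ring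
  · have hLe : ∀ i, degIdx (e i) < L + 1 := fun i =>
      (he.monotone (Fin.le_last i)).trans_lt (hLlt.trans (Nat.lt_succ_self _))
    rw [wave, D.det_rwMatrix_largeParam hn e hLe kap kap11 z₀ w hkap1 hkap hw,
      D.det_rwMatrix_largeParam hn e hLe kap kap11 z₀ w hkap1 hkap hw]
    rfl
  · have hinj : Function.Injective fun z : ℂ => z - w := fun a b h => sub_left_injective h
    have hcard : ((otherRoots N kap w).image fun z => z - w).card = reducedExp J := by
      rw [card_image_of_injective _ hinj]
      have := reducedExp_add he
      omega
    obtain ⟨lo, up, hlo, hup, hb⟩ := D.exists_norm_coord_bounds hn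
    obtain ⟨R, hR, h⟩ := D.waveSum_ratio_far hn he hLlt (κ := s⁻¹) (inv_ne_zero hs)
      (S := (otherRoots N kap w).image fun z => z - w) (fun ζ hζ => by
        obtain ⟨z, hz, rfl⟩ := mem_image.1 hζ
        exact sub_ne_zero.2 (mem_erase.1 hz).1) (fun y => by
        have h1 := hev (y + w)
        rw [hprod, add_sub_cancel_right] at h1
        simp only [eval_mul, eval_pow, eval_sub, eval_X, eval_C, eval_prod,
          add_sub_cancel_right] at h1
        rw [prod_image fun a _ b _ h => hinj h, mul_assoc]
        rw [eq_inv_mul_iff_mul_eq₀ hs, ← h1]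
        congr 1
        refine prod_congr rfl fun z _ => ?_
        ring) hcard hmul (D.h2 k) hε
    -- $R$ serves the Euclidean distance, $R/lo$ the distance measured in the complex coordinate.
    refine ⟨R + R / lo, by positivity, fun A p hA hp hps => ?_⟩
    have hRlo : 0 < R / lo := by positivity
    refine h A p.re p.im hA ?_ fun ζ hζ => ?_
    · rw [← Complex.norm_eq_sqrt_sq_add_sq]
      linarith
    · obtain ⟨z, hz, rfl⟩ := mem_image.1 hζ
      have h1 := hps z hz
      have h2 := (hb (p - A • D.pointC (z - w)).re (p - A • D.pointC (z - w)).im).1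
      rw [← Complex.norm_eq_sqrt_sq_add_sq, Complex.sub_re, Complex.sub_im, D.coord_sub] at h2
      have h3 : D.coord (A • D.pointC (z - w)).re (A • D.pointC (z - w)).im = (z - w) * A := by
        rw [Complex.smul_re, Complex.smul_im, smul_eq_mul, smul_eq_mul]
        conv_rhs => rw [← D.coord_pointC hn (z - w)]
        simp only [coord]
        push_cast
        ring
      rw [h3] at h2
      have h4 : lo * (R / lo) = R := mul_div_cancel₀ _ hlo.ne'
      have h5 := mul_le_mul_of_nonneg_left h1 hlo.le
      nlinarith
  · obtain ⟨hzw, hz'⟩ := mem_erase.1 hz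
    have hroot : W.IsRoot z := (mem_roots hmonic.ne_zero).1 (Multiset.mem_toFinset.1 hz')
    have hζ : colDet J z₀ (fun i => i) (z - w) = 0 := by
      have h1 : W.eval z = 0 := hroot
      rw [hev] at h1
      exact (mul_eq_zero.1 h1).resolve_left hs
    -- Simplicity of the root is what makes the minor with the raised last row nonzero.
    have hd : W.derivative.eval z ≠ 0 := fun h => by
      have := (one_lt_rootMultiplicity_iff_isRoot hmonic.ne_zero).2 ⟨hroot, h⟩
      rw [hsimple z hroot hzw] at this
      exact lt_irrefl _ this
    have hζ' : colDet J z₀ (bumpLast m) (z - w) ≠ 0 := fun h => hd (by rw [hder, h, mul_zero])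
    have hσ : D.shiftLimit N kap w z * colDet J z₀ (bumpLast m) (z - w) =
      (D.alpha 2 * (D.point (z - w)).1 + Complex.I * D.beta 2 * (D.point (z - w)).2) *
        ((if m = 0 then 0 else colDet J z₀ (bumpPenult m) (z - w)) +
          colDet J z₀ (bumpLastTwo m) (z - w)) := by
      rw [shiftLimit, ← hW, htwo z hroot, hder]
      field_simp
    have h := (D.rateOn_near_simple hn he hLlt hζ hζ' hσ (D.h2 k) R).comp
      (B' := Metric.closedBall (0 : ℂ) R) (g := fun p => (p.re, p.im)) mem_closedBall_re_im
    simp only [D.ratio_eq_firstHat hn] at h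
    refine h.congr fun δ _ p _ => ?_
    simp only [hF, Complex.add_re, Complex.add_im, Complex.sub_re, Complex.sub_im, Complex.smul_re,
      Complex.smul_im, smul_eq_mul]
    rfl
  · have h := (D.rateOn_near_mult hn he hLlt hz₀ (D.h2 k) R).comp
      (B' := Metric.closedBall (0 : ℂ) R) (g := fun p => (p.re, p.im)) mem_closedBall_re_im
    simp only [D.waveHat_lowerVec hN hNpos he hLlt]
    exact h

end SpectralData

end RogueWave

end

theorem theorem4 (n : ℕ) (hn : 1 ≤ n) (D : SpectralData n)
    (N : Fin n → ℕ) (hN : Antitone N) (hNpos : 0 < ∑ l, N l)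
    (kap : Fin n → ℕ → ℂ) (kap11 z₀ w : ℂ) (hz₀ : z₀ ≠ 0)
    (hkap1 : ∀ l, kap l 1 = kap11)
    (hkap : ∀ l i, 1 < i → ¬ (n + 1) ∣ i → kap l i = z₀ ^ i / (i : ℂ))
    (hw : w = z₀ - kap11)
    (hsimple : ∀ z : ℂ, (gmam N kap).IsRoot z → z ≠ w → (gmam N kap).rootMultiplicity z = 1) :
    -- `w` has multiplicity `Γ₀`, and there are `Γ - Γ₀` other (simple) roots
    ((gmam N kap).rootMultiplicity w : ℚ) = gammaDeg (lowerVec N) ∧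
    ((otherRoots N kap w).card : ℚ) = gammaDeg N - gammaDeg (lowerVec N) ∧
    -- the radius `c * A` separates the multiple-root region from the simple-root region
    (∃ c : ℝ, 0 < c ∧
      -- the positions of the first-order waves lie in the simple-root region, far apart
      (∃ A₀ : ℝ, 0 < A₀ ∧ ∀ A : ℝ, A₀ ≤ A → ∀ z ∈ otherRoots N kap w,
        c * A < planeDist (D.simpleCenter N kap w A z).1 (D.simpleCenter N kap w A z).2
          (D.multCenter w A) ∧
        ∀ z' ∈ otherRoots N kap w, z' ≠ z →
          c * A < planeDist (D.simpleCenter N kap w A z).1 (D.simpleCenter N kap w A z).2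
            (D.simpleCenter N kap w A z')) ∧
      -- (1) in the simple-root region the wave splits into the first-order waves
      (∀ ε : ℝ, 0 < ε → ∃ A₀ : ℝ, 0 < A₀ ∧ ∀ A : ℝ, A₀ ≤ A → ∀ x t : ℝ, c * A < planeDist x t (D.multCenter w A) →
        ∀ k : Fin n,
          ‖D.wave N (D.largeParam kap w A) k x t -
            (1 + ∑ z ∈ otherRoots N kap w,
              (D.firstHat k (x - (D.simpleCenter N kap w A z).1)
                (t - (D.simpleCenter N kap w A z).2) - 1)) * D.plane k x t‖ ≤ ε) ∧
      -- (2) in the multiple-root region the wave approaches the lower-order wave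
      (∀ ε : ℝ, 0 < ε → ∃ A₀ : ℝ, 0 < A₀ ∧ ∀ A : ℝ, A₀ ≤ A → ∀ x t : ℝ, planeDist x t (D.multCenter w A) ≤ c * A →
        ∀ k : Fin n,
          ‖D.wave N (D.largeParam kap w A) k x t -
            D.waveHat (lowerVec N) (fun _ => D.h1) k (x - (D.multCenter w A).1)
              (t - (D.multCenter w A).2) * D.plane k x t‖ ≤ ε)) ∧
    -- (1) rate near each simple-root position
    (∀ z ∈ otherRoots N kap w, ∀ R : ℝ, 0 < R → ∃ K : ℝ, 0 < K ∧ ∃ A₀ : ℝ, 0 < A₀ ∧ ∀ A : ℝ, A₀ ≤ A → ∀ x t : ℝ,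
      planeDist x t (D.simpleCenter N kap w A z) ≤ R → ∀ k : Fin n,
        ‖D.wave N (D.largeParam kap w A) k x t -
          D.firstHat k (x - (D.simpleCenter N kap w A z).1)
            (t - (D.simpleCenter N kap w A z).2) * D.plane k x t‖ ≤ K * A⁻¹) ∧
    -- (2) rate near the multiple-root position
    (∀ R : ℝ, 0 < R → ∃ K : ℝ, 0 < K ∧ ∃ A₀ : ℝ, 0 < A₀ ∧ ∀ A : ℝ, A₀ ≤ A → ∀ x t : ℝ,
      planeDist x t (D.multCenter w A) ≤ R → ∀ k : Fin n,
        ‖D.wave N (D.largeParam kap w A) k x t -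
          D.waveHat (lowerVec N) (fun _ => D.h1) k (x - (D.multCenter w A).1)
            (t - (D.multCenter w A).2) * D.plane k x t‖ ≤ K * A⁻¹) ∧
    -- (3) far from all these positions the wave tends to the plane-wave background
    (∀ ε : ℝ, 0 < ε → ∃ R : ℝ, 0 < R ∧ ∃ A₀ : ℝ, 0 < A₀ ∧ ∀ A : ℝ, A₀ ≤ A → ∀ x t : ℝ,
      R ≤ planeDist x t (D.multCenter w A) →
      (∀ z ∈ otherRoots N kap w, R ≤ planeDist x t (D.simpleCenter N kap w A z)) →
      ∀ k : Fin n, ‖D.wave N (D.largeParam kap w A) k x t - D.plane k x t‖ ≤ ε) := by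
  obtain ⟨hmult, hcard, F, hwave, hfar, hnear, hlow⟩ :=
    D.exists_normalized_wave hn N hN hNpos kap kap11 z₀ w hz₀ hkap1 hkap hw hsimple
  set S := otherRoots N kap w with hS
  set u : ℂ → ℂ := fun z => D.pointC (z - w) with hu
  set v : ℂ → ℂ := fun z => D.pointC (D.shiftLimit N kap w z) with hv
  set disp : ℝ → ℝ → ℝ → ℂ := fun A x t =>
    ⟨x - (D.multCenter w A).1, t - (D.multCenter w A).2⟩ with hdisp
  have hdist : ∀ A x t, planeDist x t (D.multCenter w A) = ‖disp A x t‖ := fun A x t =>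
    planeDist_eq x t _
  have hsub : ∀ A : ℝ, A ≠ 0 → ∀ x t z, (⟨x - (D.simpleCenter N kap w A z).1,
      t - (D.simpleCenter N kap w A z).2⟩ : ℂ) = disp A x t - (A • u z - v z) := by
    intro A hA x t z
    rw [D.simpleCenter_eq N kap w z hA]
    apply Complex.ext <;> simp only [hdisp, Complex.sub_re, Complex.sub_im] <;> ring
  have hdistS : ∀ A : ℝ, A ≠ 0 → ∀ x t z, planeDist x t (D.simpleCenter N kap w A z) =
      ‖disp A x t - (A • u z - v z)‖ := fun A hA x t z => by rw [planeDist_eq, hsub A hA]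
  have hdispS : ∀ A : ℝ, A ≠ 0 → ∀ z, disp A (D.simpleCenter N kap w A z).1
      (D.simpleCenter N kap w A z).2 = A • u z - v z := by
    intro A hA z
    have h := hsub A hA (D.simpleCenter N kap w A z).1 (D.simpleCenter N kap w A z).2 z
    rw [sub_self, sub_self] at h
    exact sub_eq_zero.1 h.symm
  have hhat : ∀ A : ℝ, A ≠ 0 → ∀ k x t z, D.firstHat k (x - (D.simpleCenter N kap w A z).1)
      (t - (D.simpleCenter N kap w A z).2) = D.firstHat k (disp A x t - (A • u z - v z)).re
        (disp A x t - (A • u z - v z)).im := fun A hA k x t z => by rw [← hsub A hA]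
  have hu0 : ∀ z, u z = 0 → z = w := fun z h => by
    have h1 := D.coord_pointC hn (z - w)
    change D.coord (u z).re (u z).im = z - w at h1
    rw [h] at h1
    simpa [SpectralData.coord, eq_comm, sub_eq_zero] using h1
  have huinj : ∀ z z', u z = u z' → z = z' := fun z z' h => by
    have h1 := D.coord_pointC hn (z - w)
    change D.coord (u z).re (u z).im = z - w at h1
    rw [h] at h1
    exact sub_left_injective (h1.symm.trans (D.coord_pointC hn (z' - w)))
  -- The rescaled centres are separated by $3c$; the bounded corrections reduce this to $2c$, and
  -- the regions are divided at $c$.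
  obtain ⟨c, hc, hcu, hcuu⟩ := exists_separation (S := S) (u := u)
    (fun z hz h => (Finset.mem_erase.1 hz).1 (hu0 z h)) fun z _ z' _ hne h => hne (huinj _ _ h)
  -- The plane waves have constant modulus, so a tolerance $\varepsilon/a$ for the normalized wave
  -- suffices for all components.
  obtain ⟨a, ha, hamp⟩ := exists_pos_forall_ge Finset.univ fun k : Fin n => |amp n D.lam0 k|
  have hbound : ∀ {ε : ℝ} {A x t : ℝ} {k : Fin n} {y : ℂ}, ‖F k A (disp A x t) - y‖ ≤ ε / a →
      ‖D.wave N (D.largeParam kap w A) k x t - y * D.plane k x t‖ ≤ ε := by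
    intro ε A x t k y h
    rw [hwave, mul_comm y, ← mul_sub, norm_mul, D.norm_plane]
    calc |amp n D.lam0 k| * ‖F k A (disp A x t) - y‖ ≤ a * (ε / a) :=
          mul_le_mul (hamp k (Finset.mem_univ k)) h (norm_nonneg _) ha.le
      _ = ε := mul_div_cancel₀ _ ha.ne'
  refine ⟨hmult, hcard, ⟨c, hc, ?_, fun ε hε => ?_, fun ε hε => ?_⟩, fun z hz R hR => ?_,
    fun R hR => ?_, fun ε hε => ?_⟩
  · obtain ⟨A₀, hA₀, h⟩ := centers_separated hc hcu hcuu v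
    refine ⟨A₀, hA₀, fun A hA z hz => ?_⟩
    have hApos : 0 < A := hA₀.trans_le hA
    have hcA : 0 < c * A := mul_pos hc hApos
    rw [hdist, hdispS A hApos.ne']
    refine ⟨by linarith [(h A hA z hz).1], fun z' hz' hne => ?_⟩
    rw [hdistS A hApos.ne', hdispS A hApos.ne']
    linarith [(h A hA z hz).2 z' hz' hne]
  · obtain ⟨A₀, hA₀, h⟩ := exists_forall_large (Finset.univ : Finset (Fin n)) fun k _ =>
      simple_region hc hcu hcuu (hfar k) (hnear k) (fun ε hε => D.firstHat_far hn k hε)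
        (div_pos hε ha)
    refine ⟨A₀, hA₀, fun A hA x t hxt k => hbound ?_⟩
    rw [hdist] at hxt
    simp only [hhat A (hA₀.trans_le hA).ne']
    exact h A hA k (Finset.mem_univ k) _ hxt
  · obtain ⟨A₀, hA₀, h⟩ := exists_forall_large (Finset.univ : Finset (Fin n)) fun k _ =>
      multiple_region hc hcu hcuu (hfar k) (hlow k) (div_pos hε ha)
    refine ⟨A₀, hA₀, fun A hA x t hxt k => hbound ?_⟩
    rw [hdist] at hxt
    exact h A hA k (Finset.mem_univ k) _ hxt
  · choose K hK A₁ hA₁ h using fun k : Fin n => RateOn.exists_large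
      (F := fun A p => F k A (A • u z - v z + p)) (hnear k z hz R)
    obtain ⟨K₀, hK₀, hKle⟩ := exists_pos_forall_ge Finset.univ K
    obtain ⟨A₀, hA₀, hAle⟩ := exists_pos_forall_ge Finset.univ A₁
    refine ⟨a * K₀, mul_pos ha hK₀, A₀, hA₀, fun A hA x t hxt k => hbound ?_⟩
    have hApos : 0 < A := hA₀.trans_le hA
    rw [hdistS A hApos.ne'] at hxt
    have h1 := h k A ((hAle k (Finset.mem_univ k)).trans hA) (disp A x t - (A • u z - v z))
      (by rwa [mem_closedBall_zero_iff])
    rw [add_sub_cancel] at h1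
    rw [hhat A hApos.ne', mul_assoc, mul_div_cancel_left₀ _ ha.ne']
    exact h1.trans (mul_le_mul_of_nonneg_right (hKle k (Finset.mem_univ k)) (inv_nonneg.2 hApos.le))
  · choose K hK A₁ hA₁ h using fun k : Fin n => RateOn.exists_large (F := F k) (hlow k R)
    obtain ⟨K₀, hK₀, hKle⟩ := exists_pos_forall_ge Finset.univ K
    obtain ⟨A₀, hA₀, hAle⟩ := exists_pos_forall_ge Finset.univ A₁
    refine ⟨a * K₀, mul_pos ha hK₀, A₀, hA₀, fun A hA x t hxt k => hbound ?_⟩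
    have hApos : 0 < A := hA₀.trans_le hA
    rw [hdist] at hxt
    have h1 := h k A ((hAle k (Finset.mem_univ k)).trans hA) (disp A x t)
      (by rwa [mem_closedBall_zero_iff])
    rw [mul_assoc, mul_div_cancel_left₀ _ ha.ne']
    exact h1.trans (mul_le_mul_of_nonneg_right (hKle k (Finset.mem_univ k)) (inv_nonneg.2 hApos.le))
  · choose R hR h using fun k : Fin n => exists_far_from_centers (hfar k) v (div_pos hε ha)
    obtain ⟨R₀, hR₀, hRle⟩ := exists_pos_forall_ge Finset.univ R
    -- The far estimate holds for every $A>0$, so any positive threshold would do.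
    refine ⟨R₀, hR₀, 1, one_pos, fun A hA x t hxt hxtS k => ?_⟩
    have hApos : 0 < A := one_pos.trans_le hA
    have hk := hRle k (Finset.mem_univ k)
    rw [hdist] at hxt
    have h1 := h k A (disp A x t) hApos (hk.trans hxt) fun z hz => by
      rw [← hdistS A hApos.ne']
      exact hk.trans (hxtS z hz)
    simpa using hbound h1
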